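/- Let $m\ge 1$ and let $G=I_2(m)$ be the dihedral group of order $2m$ acting on $E=\mathbb R^2$, with orthonormal basis $\xi,\eta$, dual basis $x,y$, and reflections $s_1,\dots,s_m$, where $s_j$ is the reflection in the root $\alpha_j=\sin(\pi j/m)\,\xi-\cos(\pi j/m)\,\eta$. Let $c$ be a real-valued function on the reflections that is constant on conjugacy classes, $c_j=c(s_j)$. The rational Cherednik algebra $H_c(G,E)$ is generated by $E^*_{\mathbb C}$, $E_{\mathbb C}$ and $\mathbb C[G]$, subject to the relations of the smash product of the tensor algebra of $E_{\mathbb C}\oplus E^*_{\mathbb C}$ with $\mathbb C[G]$, to $[u,u']=0$ for $u,u'\in E$, $[f,f']=0$ for $f,f'\in E^*$, and to $[u,f]=\langle f,u\rangle-2\sum_{s}\frac{\langle f,\alpha_s\rangle\langle a_s,u\rangle}{\langle a_s,\alpha_s\rangle}c(s)s$ for $u\in E$, $f\in E^*$, where the sum is over all reflections and $\alpha_s\in E$, $a_s\in E^*$ are $-1$-eigenvectors of $s$. Let $\tau$ be an irreducible complex representation of $G$ with space $V(\tau)$, and let $M_c(\tau)=\mathbb C[E]\otimes V(\tau)$ be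 its standard module (on which $E$ acts by Dunkl operators and kills $1\otimes V(\tau)$), with degree-$k$ part $M_c(\tau)_k$. Assume that $M_c(\tau)$ is irreducible and is unitarisable, that is, carries a positive definite Hermitian form that is contravariant for the conjugate-linear anti-involution of $H_c(G,E)$ exchanging $x\leftrightarrow\xi$, $y\leftrightarrow\eta$ and fixing all reflections (this holds for every real $c$ close enough to $0$). Put $z=x+iy$, $\bar z=x-iy$, $\zeta=\frac12(\xi-i\eta)$, $\bar\zeta=\frac12(\xi+i\eta)$, $$E_+=\tfrac12(x^2+y^2),\quad E_-=-\tfrac12(\xi^2+\eta^2),\quad Z_0=\bar z\bar\zeta-z\zeta,\quad \sigma=\sum_{s}c(s)s,$$ let $N_c(\tau)\in\mathbb R$ be the scalar by which $\sigma$ acts on $V(\tau)$, let $\mathcal H_c(\tau)_k=M_c(\tau)_k\cap\ker E_-$, and let $\epsilon\in\mathbb R$. Put $\omega=e^{2\pi i/m}$, $\sigma_n=\sum_{j=1}^m c_j\omega^{jn}$ and, for $m$ even, let $\sigma_{n,\bar0}$, $\sigma_{n,\bar1}$ be the parts of this sum with $j$ even, respectively odd. Up to isomorphism, $\tau$ is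 one of: the trivial or the sign character; for $m$ even, one of the characters $\chi_{\bar0},\chi_{\bar1}$, where $\chi_{\bar u}(s_j)=-1$ if $j\equiv u \bmod 2$ and $\chi_{\bar u}(s_j)=1$ otherwise; or $\rho^{(u)}$ with $1\le u<m/2$, with basis $\{z,\bar z\}$ of $V(\tau)$ and $s_j z=\omega^{ju}\bar z$, $s_j\bar z=\omega^{-ju}z$. Let $\sigma(\tau)_k$ consist of the single element $\sigma_k$, $-\sigma_k$, $-\sigma_{k,\bar0}+\sigma_{k,\bar1}$, $\sigma_{k,\bar0}-\sigma_{k,\bar1}$ when $\tau$ is the trivial character, the sign character, $\chi_{\bar0}$, $\chi_{\bar1}$ respectively, and of the two (labelled) elements $\sigma_{k+u},\sigma_{k-u}$ when $\tau=\rho^{(u)}$. For one-dimensional $\tau$ let $z(\sigma_{\tau,k})=\bar z(\sigma_{\tau,k})$ be the basis vector of $V(\tau)$; for $\tau=\rho^{(u)}$ let $z(\sigma_{k+u})=z$, $\bar z(\sigma_{k+u})=\bar z$, $z(\sigma_{k-u})=\bar z$, $\bar z(\sigma_{k-u})=z$. (a) Let $k>0$. The elements of $\sigma(\tau)_k$ are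 real, and the eigenvalues of $Z_0+\epsilon\sigma$ on $\mathcal H_c(\tau)_k$ are exactly the real numbers $$\lambda(\sigma_{\tau,k})^{\pm}=\pm\sqrt{(k-N_c(\tau))^2-(1-\epsilon^2)\sigma_{\tau,k}^2},\qquad \sigma_{\tau,k}\in\sigma(\tau)_k,$$ the numbers under the root being non-negative. With the rising factorial $(a)_j$, the operator $$\mathrm{Proj}_k=\sum_{j=0}^{\lfloor k/2\rfloor}\frac{(-1)^j}{j!\,(N_c(\tau)-k+1)_j}E_+^jE_-^j$$ is well defined (no denominator vanishes) and is the projection of $M_c(\tau)_k$ onto $\mathcal H_c(\tau)_k$ that vanishes on $E_+M_c(\tau)_{k-2}$. The vectors $$h(\epsilon,\sigma_{\tau,k})^{+}=\mathrm{Proj}_k\left[(k-N_c(\tau)+\lambda(\sigma_{\tau,k})^{+})\,\bar z^k\otimes\bar z(\sigma_{\tau,k})-\sigma_{\tau,k}(1-\epsilon)\,z^k\otimes z(\sigma_{\tau,k})\right],$$ $$h(\epsilon,\sigma_{\tau,k})^{-}=\mathrm{Proj}_k\left[(k-N_c(\tau)-\lambda(\sigma_{\tau,k})^{-})\,z^k\otimes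 z(\sigma_{\tau,k})-\sigma_{\tau,k}(1+\epsilon)\,\bar z^k\otimes\bar z(\sigma_{\tau,k})\right],$$ for $\sigma_{\tau,k}\in\sigma(\tau)_k$, are eigenvectors of $Z_0+\epsilon\sigma$ with eigenvalues $\lambda(\sigma_{\tau,k})^{\pm}$ and form a basis of $\mathcal H_c(\tau)_k$. (b) In degree $0$ one has $\mathcal H_c(\tau)_0=1\otimes V(\tau)$, and $Z_0+\epsilon\sigma$ acts on it by $\epsilon$ times the element of $\sigma(\tau)_0$ if $\tau$ is one-dimensional, and by $0$ if $\tau=\rho^{(u)}$. (c) All other eigenvectors are generated by $E_+$: for every $\mu\in\mathbb C$, the $\mu$-eigenspace of $Z_0+\epsilon\sigma$ on $M_c(\tau)$ is the span of the vectors $E_+^jh$ with $j\ge0$ and $h$ a $\mu$-eigenvector of $Z_0+\epsilon\sigma$ in some $\mathcal H_c(\tau)_k$, $k\ge0$. -/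

import Mathlib

open scoped TensorProduct

noncomputable section

namespace DihedralCherednik

open MvPolynomial DihedralGroup

/-! ## The dihedral group acting on the Euclidean plane

`DihedralGroup m` is `I_2(m)`; its reflections are `sr j`, `j : ZMod m`, where the residue class
of `m` is represented by `0`. All vectors of `E = ℝ²` and of its dual are written in an
orthonormal basis `ξ 0, ξ 1` of `E` and the dual basis `x 0, x 1`. -/

/-- The angle `2πj/m`. -/
def angle {m : ℕ} (j : ZMod m) : ℝ := 2 * Real.pi * (j.val : ℝ) / (m : ℝ)

/-- The root `α_j = sin(πj/m) ξ - cos(πj/m) η`, in coordinates. The same coordinates give the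
linear form `a_j = sin(πj/m) x - cos(πj/m) y`, and `⟨a_j, α_j⟩ = 1`. -/
def root {m : ℕ} (j : ZMod m) : Fin 2 → ℝ :=
  ![Real.sin (Real.pi * (j.val : ℝ) / (m : ℝ)), -Real.cos (Real.pi * (j.val : ℝ) / (m : ℝ))]

/-- The orthogonal matrix of `g` acting on `E` (and on the dual of `E`): the basis vector `i` is
sent to `∑ k, mat g k i • (basis vector k)`. The element `sr j` is the reflection in the root
`α_j`, and `r k` acts on the coordinate function `z = x + iy` by `exp (2πik/m)`. -/
def mat {m : ℕ} : DihedralGroup m → Matrix (Fin 2) (Fin 2) ℝ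
  | .r k => !![Real.cos (angle k), Real.sin (angle k); -Real.sin (angle k), Real.cos (angle k)]
  | .sr k => !![Real.cos (angle k), Real.sin (angle k); Real.sin (angle k), -Real.cos (angle k)]

/-- A parameter function `c` on reflections is admissible if it is constant on conjugacy
classes of reflections. -/
def IsParameter {m : ℕ} (c : ZMod m → ℝ) : Prop :=
  ∀ (g : DihedralGroup m) (i j : ZMod m), g * sr i * g⁻¹ = sr j → c i = c j

/-! ## The rational Cherednik algebra -/

/-- Generators: the coordinates `x i`, the vectors `ξ i`, and the group elements. -/
inductive Gen (m : ℕ) : Type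
  | x (i : Fin 2) : Gen m
  | xi (i : Fin 2) : Gen m
  | grp (g : DihedralGroup m) : Gen m

/-- The free algebra on the generators. -/
abbrev Free (m : ℕ) : Type := FreeAlgebra ℂ (Gen m)

/-- The generator `x i` in the free algebra. -/
abbrev fx (m : ℕ) (i : Fin 2) : Free m := FreeAlgebra.ι ℂ (Gen.x i)

/-- The generator `ξ i` in the free algebra. -/
abbrev fxi (m : ℕ) (i : Fin 2) : Free m := FreeAlgebra.ι ℂ (Gen.xi i)

/-- The group generator `g` in the free algebra. -/
abbrev fg {m : ℕ} (g : DihedralGroup m) : Free m := FreeAlgebra.ι ℂ (Gen.grp g)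

/-- The defining relations of `H_c(G, E)`: those of the smash product of the tensor algebra of
`E ⊕ E*` with the group algebra of `G`, commutativity of the `x i` and of the `ξ i`, and
`[ξ, x] = ⟨x, ξ⟩ - 2 ∑ₛ ⟨x, αₛ⟩⟨aₛ, ξ⟩/⟨aₛ, αₛ⟩ c(s) s`, where `⟨aₛ, αₛ⟩ = 1`. -/
inductive Rel {m : ℕ} [NeZero m] (c : ZMod m → ℝ) : Free m → Free m → Prop
  | grp_one : Rel c (fg 1) 1
  | grp_mul (g h : DihedralGroup m) : Rel c (fg g * fg h) (fg (g * h))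
  | grp_x (g : DihedralGroup m) (i : Fin 2) :
      Rel c (fg g * fx m i) ((∑ k, (mat g k i : ℂ) • fx m k) * fg g)
  | grp_xi (g : DihedralGroup m) (i : Fin 2) :
      Rel c (fg g * fxi m i) ((∑ k, (mat g k i : ℂ) • fxi m k) * fg g)
  | x_comm (i j : Fin 2) : Rel c (fx m i * fx m j) (fx m j * fx m i)
  | xi_comm (i j : Fin 2) : Rel c (fxi m i * fxi m j) (fxi m j * fxi m i)
  | xi_x (i j : Fin 2) :
      Rel c (fxi m i * fx m j - fx m j * fxi m i)
        ((if i = j then 1 else 0)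
          - ∑ s : ZMod m, ((2 * root s j * root s i * c s : ℝ) : ℂ) • fg (sr s))

/-- The rational Cherednik algebra `H_c(G, E)` of the dihedral group. -/
abbrev Cherednik {m : ℕ} [NeZero m] (c : ZMod m → ℝ) : Type := RingQuot (Rel c)

section Elements

variable {m : ℕ} [NeZero m] (c : ZMod m → ℝ)

/-- The coordinate function `x i` in `H_c`. -/
def hx (i : Fin 2) : Cherednik c := RingQuot.mkAlgHom ℂ (Rel c) (fx m i)

/-- The vector `ξ i` in `H_c`. -/
def hxi (i : Fin 2) : Cherednik c := RingQuot.mkAlgHom ℂ (Rel c) (fxi m i)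

/-- The group element `g` in `H_c`. -/
def hg (g : DihedralGroup m) : Cherednik c := RingQuot.mkAlgHom ℂ (Rel c) (fg g)

/-- `z = x + iy`. -/
def hz : Cherednik c := hx c 0 + Complex.I • hx c 1

/-- The conjugate of `z`. -/
def hzbar : Cherednik c := hx c 0 - Complex.I • hx c 1

/-- `ζ = (ξ - iη)/2`. -/
def hzeta : Cherednik c := (1 / 2 : ℂ) • (hxi c 0 - Complex.I • hxi c 1)

/-- The conjugate of `ζ`. -/
def hzetabar : Cherednik c := (1 / 2 : ℂ) • (hxi c 0 + Complex.I • hxi c 1)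

/-- `E_+ = (x² + y²)/2`. -/
def Eplus : Cherednik c := (1 / 2 : ℂ) • ∑ i, hx c i ^ 2

/-- `E_- = -(ξ² + η²)/2`. -/
def Eminus : Cherednik c := -((1 / 2 : ℂ) • ∑ i, hxi c i ^ 2)

/-- The central element `σ = ∑ₛ c(s) s` of the group algebra. -/
def sigma : Cherednik c := ∑ s : ZMod m, (c s : ℂ) • hg c (sr s)

/-- `Z_0`, the difference of `zbar * zetabar` and `z * zeta`. -/
def Z0 : Cherednik c := hzbar c * hzetabar c - hz c * hzeta c

end Elements

/-! ## Dunkl operators and the standard module -/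

/-- Complex polynomial functions on `E`, in the coordinates `x 0 = x`, `x 1 = y`. -/
abbrev Poly : Type := MvPolynomial (Fin 2) ℂ

/-- The action of `g` on polynomials by algebra automorphisms. -/
def act {m : ℕ} (g : DihedralGroup m) : Poly →ₐ[ℂ] Poly :=
  aeval fun i => ∑ k, (mat g k i : ℂ) • (X k : Poly)

/-- The linear form `a_j`. -/
def rootForm {m : ℕ} (j : ZMod m) : Poly := ∑ k, (root j k : ℂ) • (X k : Poly)

lemma cos_sin_eq {m : ℕ} [NeZero m] (a b : ℤ) (h : (a : ZMod m) = (b : ZMod m)) :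
    Real.cos (2 * Real.pi * a / m) = Real.cos (2 * Real.pi * b / m) ∧
    Real.sin (2 * Real.pi * a / m) = Real.sin (2 * Real.pi * b / m) := by
  rw [ZMod.intCast_eq_intCast_iff_dvd_sub] at h
  obtain ⟨q, hq⟩ := h
  have hm : (m : ℝ) ≠ 0 := Nat.cast_ne_zero.mpr (NeZero.ne m)
  have hb : (b : ℝ) = a + m * q := by exact_mod_cast (by linarith : b = a + m * q)
  have e : 2 * Real.pi * b / m = 2 * Real.pi * a / m + q * (2 * Real.pi) := by
    rw [hb]; field_simp
  rw [e, Real.cos_add_int_mul_two_pi, Real.sin_add_int_mul_two_pi]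
  exact ⟨rfl, rfl⟩

lemma trig_add {m : ℕ} [NeZero m] (j k : ZMod m) :
    Real.cos (angle (j + k)) = Real.cos (angle j + angle k) ∧
    Real.sin (angle (j + k)) = Real.sin (angle j + angle k) := by
  have h := cos_sin_eq (m := m) ((j + k).val : ℤ) ((j.val : ℤ) + (k.val : ℤ)) (by simp)
  have e : angle j + angle k = 2 * Real.pi * ((((j.val : ℤ) + (k.val : ℤ) : ℤ)) : ℝ) / m := by
    unfold angle; push_cast; ring
  rw [e, ← h.1, ← h.2]; simp [angle]

lemma trig_sub {m : ℕ} [NeZero m] (j k : ZMod m) :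
    Real.cos (angle (j - k)) = Real.cos (angle j - angle k) ∧
    Real.sin (angle (j - k)) = Real.sin (angle j - angle k) := by
  have h := cos_sin_eq (m := m) ((j - k).val : ℤ) ((j.val : ℤ) - (k.val : ℤ)) (by simp)
  have e : angle j - angle k = 2 * Real.pi * ((((j.val : ℤ) - (k.val : ℤ) : ℤ)) : ℝ) / m := by
    unfold angle; push_cast; ring
  rw [e, ← h.1, ← h.2]; simp [angle]

lemma mat_mul {m : ℕ} [NeZero m] (g h : DihedralGroup m) : mat (g * h) = mat g * mat h := by
  rcases g with j | j <;> rcases h with k | k <;>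
    simp only [r_mul_r, r_mul_sr, sr_mul_r, sr_mul_sr, mat, trig_add, trig_sub, Real.cos_add,
      Real.sin_add, Real.cos_sub, Real.sin_sub] <;>
    ext a b <;> fin_cases a <;> fin_cases b <;> simp [Matrix.mul_apply, Fin.sum_univ_two] <;> ring

lemma mat_one {m : ℕ} [NeZero m] : mat (1 : DihedralGroup m) = 1 := by
  rw [one_def, mat]
  ext a b
  fin_cases a <;> fin_cases b <;> simp [angle]

lemma mat_orth {m : ℕ} [NeZero m] (g : DihedralGroup m) (i l : Fin 2) :
    ∑ k, mat g k i * mat g k l = if i = l then 1 else 0 := by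
  rcases g with j | j <;> fin_cases i <;> fin_cases l <;>
    simp [mat, Fin.sum_univ_two] <;> nlinarith [Real.sin_sq_add_cos_sq (angle j)]

lemma mat_refl {m : ℕ} (j : ZMod m) (k i : Fin 2) :
    2 * root j k * root j i = (if k = i then 1 else 0) - mat (sr j) k i := by
  have e : angle j = 2 * (Real.pi * (j.val : ℝ) / (m : ℝ)) := by unfold angle; ring
  have h := Real.sin_sq_add_cos_sq (Real.pi * (j.val : ℝ) / (m : ℝ))
  fin_cases k <;> fin_cases i <;>
    simp [mat, root, e, Real.cos_two_mul, Real.sin_two_mul] <;> nlinarith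

lemma root_sq {m : ℕ} (j : ZMod m) : ∑ k, root j k * root j k = 1 := by
  simp [root, Fin.sum_univ_two]
  nlinarith [Real.sin_sq_add_cos_sq (Real.pi * (j.val : ℝ) / (m : ℝ))]

lemma root_tensor_conj {m : ℕ} [NeZero m] (g : DihedralGroup m) (s t : ZMod m)
    (h : g * sr s = sr t * g) (i l : Fin 2) :
    2 * root s i * root s l =
      ∑ k, ∑ p, mat g k i * mat g p l * (2 * root t k * root t p) := by
  have hm : mat g * mat (sr s) = mat (sr t) * mat g := by rw [← mat_mul, ← mat_mul, h]
  have o := mat_orth g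
  have hm' : ∀ a b, ∑ k, mat g a k * mat (sr s) k b = ∑ k, mat (sr t) a k * mat g k b := by
    intro a b
    have := congrFun (congrFun hm a) b
    simpa [Matrix.mul_apply] using this
  have key : ∑ k, mat g k i * ∑ p, mat (sr t) k p * mat g p l = mat (sr s) i l := by
    simp_rw [← hm', Finset.mul_sum]
    rw [Finset.sum_comm]
    simp_rw [← mul_assoc, ← Finset.sum_mul, o]
    simp
  simp_rw [mat_refl]
  have o' := o i l
  simp only [Fin.sum_univ_two] at key o' ⊢
  fin_cases i <;> fin_cases l <;> simp at key o' ⊢ <;> linarith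

lemma act_X {m : ℕ} (g : DihedralGroup m) (i : Fin 2) :
    act g (X i) = ∑ k, (mat g k i : ℂ) • (X k : Poly) := by simp [act]

lemma act_mul {m : ℕ} [NeZero m] (g h : DihedralGroup m) : act (g * h) = (act g).comp (act h) := by
  apply MvPolynomial.algHom_ext
  intro i
  simp only [AlgHom.comp_apply, act_X, mat_mul, Matrix.mul_apply, Fin.sum_univ_two, map_add,
    map_smul]
  push_cast
  module

lemma act_one {m : ℕ} [NeZero m] : act (1 : DihedralGroup m) = AlgHom.id ℂ Poly := by
  apply MvPolynomial.algHom_ext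
  intro i
  rw [act_X, mat_one]
  simp [Matrix.one_apply]

lemma rootForm_ne_zero {m : ℕ} (j : ZMod m) : rootForm j ≠ 0 := by
  intro h
  have h0 : ∀ i, root j i = 0 := by
    intro i
    have := congrArg (MvPolynomial.aeval (fun k => if k = i then (1 : ℂ) else 0)) h
    fin_cases i <;>
      simpa [-Complex.coe_smul, rootForm, MvPolynomial.smul_eval, Fin.sum_univ_two] using this
  simpa [h0] using root_sq j

lemma act_refl_X {m : ℕ} (j : ZMod m) (i : Fin 2) :
    act (sr j) (X i) = X i - ((2 * root j i : ℝ) : ℂ) • rootForm j := by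
  rw [act_X, rootForm]
  have h : ∀ k, ((mat (sr j) k i : ℝ) : ℂ)
      = (if k = i then 1 else 0) - 2 * (root j k : ℂ) * (root j i : ℂ) := by
    intro k
    have h1 : mat (sr j) k i = (if k = i then 1 else 0) - 2 * root j k * root j i := by
      rw [mat_refl]; ring
    rw [h1]; push_cast; split_ifs <;> simp
  simp_rw [h, Fin.sum_univ_two]
  push_cast
  fin_cases i <;> simp <;> module

lemma rootForm_dvd {m : ℕ} (j : ZMod m) (p : Poly) : rootForm j ∣ p - act (sr j) p := by
  rw [← Ideal.mem_span_singleton, ← Ideal.Quotient.mk_eq_mk_iff_sub_mem]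
  have : Ideal.Quotient.mkₐ ℂ (Ideal.span {rootForm j})
      = (Ideal.Quotient.mkₐ ℂ (Ideal.span {rootForm j})).comp (act (sr j)) := by
    apply MvPolynomial.algHom_ext
    intro i
    rw [AlgHom.comp_apply, act_refl_X, map_sub, map_smul]
    have : Ideal.Quotient.mkₐ ℂ (Ideal.span {rootForm j}) (rootForm j) = 0 :=
      Ideal.Quotient.eq_zero_iff_mem.mpr (Ideal.mem_span_singleton_self _)
    rw [this]; simp
  exact congrArg (fun f => f p) this

/-- The divided difference `p ↦ (p - s_j p) / a_j`. -/
def divDiff {m : ℕ} (j : ZMod m) : Poly →ₗ[ℂ] Poly where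
  toFun p := (rootForm_dvd j p).choose
  map_add' p q := by
    apply mul_left_cancel₀ (rootForm_ne_zero j)
    rw [mul_add, ← (rootForm_dvd j p).choose_spec, ← (rootForm_dvd j q).choose_spec,
      ← (rootForm_dvd j (p + q)).choose_spec, map_add]
    ring
  map_smul' a p := by
    apply mul_left_cancel₀ (rootForm_ne_zero j)
    rw [RingHom.id_apply, mul_smul_comm, ← (rootForm_dvd j p).choose_spec,
      ← (rootForm_dvd j (a • p)).choose_spec, map_smul, smul_sub]

/-- The defining property of the divided difference. -/
lemma rootForm_mul_divDiff {m : ℕ} (j : ZMod m) (p : Poly) :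
    rootForm j * divDiff j p = p - act (sr j) p :=
  (rootForm_dvd j p).choose_spec.symm

lemma divDiff_one {m : ℕ} (j : ZMod m) : divDiff j 1 = 0 := by
  apply mul_left_cancel₀ (rootForm_ne_zero j)
  rw [rootForm_mul_divDiff]; simp

lemma divDiff_X_mul {m : ℕ} (j : ZMod m) (i : Fin 2) (p : Poly) :
    divDiff j (X i * p) = X i * divDiff j p + ((2 * root j i : ℝ) : ℂ) • act (sr j) p := by
  apply mul_left_cancel₀ (rootForm_ne_zero j)
  rw [rootForm_mul_divDiff, mul_add, mul_left_comm, rootForm_mul_divDiff, map_mul, act_refl_X]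
  simp only [MvPolynomial.smul_eq_C_mul]
  ring

/-! ### The operators on `ℂ[E] ⊗ V` -/

/-- The underlying space `ℂ[E] ⊗ V(τ)` of the standard module. -/
abbrev StdSpace (V : Type*) [AddCommGroup V] [Module ℂ V] : Type _ := Poly ⊗[ℂ] V

/-- Multiplication by the coordinate `x i`. -/
def xOp (V : Type*) [AddCommGroup V] [Module ℂ V] (i : Fin 2) : Module.End ℂ (StdSpace V) :=
  TensorProduct.map (LinearMap.mulLeft ℂ (X i)) LinearMap.id

/-- The diagonal action of `g`. -/
def gOp {m : ℕ} {V : Type*} [AddCommGroup V] [Module ℂ V]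
    (ρ : Representation ℂ (DihedralGroup m) V) (g : DihedralGroup m) :
    Module.End ℂ (StdSpace V) :=
  TensorProduct.map (act g).toLinearMap (ρ g)

/-- The Dunkl operator of `ξ i`:
`p ⊗ v ↦ ∂ᵢp ⊗ v - ∑ₛ c(s) ⟨aₛ, ξᵢ⟩ ((p - s p) / aₛ) ⊗ s v`. -/
def dunklOp {m : ℕ} [NeZero m] (c : ZMod m → ℝ) {V : Type*} [AddCommGroup V] [Module ℂ V]
    (ρ : Representation ℂ (DihedralGroup m) V) (i : Fin 2) : Module.End ℂ (StdSpace V) :=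
  TensorProduct.map (pderiv i).toLinearMap LinearMap.id
    - ∑ s : ZMod m, ((c s * root s i : ℝ) : ℂ) • TensorProduct.map (divDiff s) (ρ (sr s))

lemma xOp_tmul {V : Type*} [AddCommGroup V] [Module ℂ V] (i : Fin 2) (p : Poly) (v : V) :
    xOp V i (p ⊗ₜ v) = (X i * p) ⊗ₜ v := by simp [xOp]

lemma gOp_tmul {m : ℕ} {V : Type*} [AddCommGroup V] [Module ℂ V]
    (ρ : Representation ℂ (DihedralGroup m) V) (g : DihedralGroup m) (p : Poly) (v : V) :
    gOp ρ g (p ⊗ₜ v) = (act g p) ⊗ₜ (ρ g v) := by simp [gOp]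

lemma dunklOp_tmul {m : ℕ} [NeZero m] (c : ZMod m → ℝ) {V : Type*} [AddCommGroup V] [Module ℂ V]
    (ρ : Representation ℂ (DihedralGroup m) V) (i : Fin 2) (p : Poly) (v : V) :
    dunklOp c ρ i (p ⊗ₜ v) = (pderiv i p) ⊗ₜ v
      - ∑ s : ZMod m, ((c s * root s i : ℝ) : ℂ) • (divDiff s p ⊗ₜ[ℂ] ρ (sr s) v) := by
  simp [dunklOp, LinearMap.sum_apply]

lemma dunklOp_one_tmul {m : ℕ} [NeZero m] (c : ZMod m → ℝ) {V : Type*} [AddCommGroup V]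
    [Module ℂ V] (ρ : Representation ℂ (DihedralGroup m) V) (i : Fin 2) (v : V) :
    dunklOp c ρ i (1 ⊗ₜ v) = 0 := by
  simp [dunklOp_tmul, divDiff_one]

lemma xOp_comm {V : Type*} [AddCommGroup V] [Module ℂ V] (i j : Fin 2) :
    xOp V i * xOp V j = xOp V j * xOp V i := by
  apply TensorProduct.ext'
  intro p v
  simp only [Module.End.mul_apply, xOp_tmul, mul_left_comm]

lemma gOp_xOp {m : ℕ} {V : Type*} [AddCommGroup V] [Module ℂ V]
    (ρ : Representation ℂ (DihedralGroup m) V) (g : DihedralGroup m) (i : Fin 2) :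
    gOp ρ g * xOp V i = (∑ k, (mat g k i : ℂ) • xOp V k) * gOp ρ g := by
  apply TensorProduct.ext'
  intro p v
  simp [Fin.sum_univ_two, Module.End.mul_apply, xOp_tmul, gOp_tmul, act_X, add_mul,
    TensorProduct.add_tmul, TensorProduct.smul_tmul']

lemma gOp_mul {m : ℕ} [NeZero m] {V : Type*} [AddCommGroup V] [Module ℂ V]
    (ρ : Representation ℂ (DihedralGroup m) V) (g h : DihedralGroup m) :
    gOp ρ g * gOp ρ h = gOp ρ (g * h) := by
  apply TensorProduct.ext'
  intro p v
  simp [Module.End.mul_apply, gOp_tmul, act_mul]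

lemma gOp_one {m : ℕ} [NeZero m] {V : Type*} [AddCommGroup V] [Module ℂ V]
    (ρ : Representation ℂ (DihedralGroup m) V) : gOp ρ 1 = 1 := by
  apply TensorProduct.ext'
  intro p v
  simp [gOp_tmul, act_one]

lemma dunklOp_xOp {m : ℕ} [NeZero m] (c : ZMod m → ℝ) {V : Type*} [AddCommGroup V]
    [Module ℂ V] (ρ : Representation ℂ (DihedralGroup m) V) (i j : Fin 2) :
    dunklOp c ρ i * xOp V j - xOp V j * dunklOp c ρ i =
      (if i = j then 1 else 0)
        - ∑ s : ZMod m, ((2 * root s j * root s i * c s : ℝ) : ℂ) • gOp ρ (sr s) := by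
  apply TensorProduct.ext'
  intro p v
  have hp : pderiv i (X j * p) = X j * pderiv i p + (if i = j then p else 0) := by
    rw [Derivation.leibniz, pderiv_X]
    by_cases h : i = j
    · subst h; simp
    · have h' : j ≠ i := fun e => h e.symm
      simp [h, h']
  simp only [LinearMap.sub_apply, Module.End.mul_apply, xOp_tmul, dunklOp_tmul, divDiff_X_mul, hp,
    TensorProduct.add_tmul, LinearMap.sum_apply, LinearMap.smul_apply, gOp_tmul, map_sub, map_sum,
    map_smul, smul_add, Finset.sum_add_distrib]
  have h1 : ∀ s : ZMod m, ((c s * root s i : ℝ) : ℂ) •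
      ((((2 * root s j : ℝ) : ℂ) • act (sr s) p) ⊗ₜ[ℂ] ρ (sr s) v)
      = ((2 * root s j * root s i * c s : ℝ) : ℂ) • (act (sr s) p ⊗ₜ[ℂ] ρ (sr s) v) := by
    intro s
    rw [← TensorProduct.smul_tmul', smul_smul]
    congr 1
    push_cast; ring
  simp only [h1]
  by_cases h : i = j
  · simp only [h, if_true, Module.End.one_apply]; abel
  · simp only [h, if_false, LinearMap.zero_apply, TensorProduct.zero_tmul]; abel

lemma end_eq_zero {V : Type*} [AddCommGroup V] [Module ℂ V] (D : Module.End ℂ (StdSpace V))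
    (L : Fin 2 → Module.End ℂ (StdSpace V)) (h : ∀ i, D * xOp V i = L i * D)
    (h1 : ∀ v, D (1 ⊗ₜ v) = 0) : D = 0 := by
  apply TensorProduct.ext'
  intro p v
  induction p using MvPolynomial.induction_on with
  | C a =>
    have : (C a : Poly) = a • 1 := by rw [MvPolynomial.smul_eq_C_mul, mul_one]
    rw [this, ← TensorProduct.smul_tmul', map_smul, h1]; simp
  | add p q hp hq => rw [TensorProduct.add_tmul, map_add, hp, hq]; simp
  | mul_X p i hp =>
    have := congrArg (fun f => f (p ⊗ₜ[ℂ] v)) (h i)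
    simp only [Module.End.mul_apply, xOp_tmul] at this
    rw [mul_comm, this, hp]; simp

lemma exists_conj {m : ℕ} (g : DihedralGroup m) :
    ∃ e : ZMod m ≃ ZMod m, ∀ s, g * sr s = sr (e s) * g := by
  rcases g with k | k
  · refine ⟨Equiv.subRight (k + k), fun s => ?_⟩
    simp [r_mul_sr, sr_mul_r, sub_add_eq_sub_sub]
  · refine ⟨Equiv.subLeft (k + k), fun s => ?_⟩
    simp only [sr_mul_sr, Equiv.subLeft_apply]
    congr 1; abel

/-- Purely algebraic part of the equivariance of Dunkl operators. -/
lemma cov_aux {m : ℕ} [NeZero m] {c : ZMod m → ℝ} (hc : IsParameter c) {R : Type*} [Ring R]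
    [Algebra ℂ R] (x T : Fin 2 → R) (G : DihedralGroup m → R)
    (hG : ∀ g h, G g * G h = G (g * h))
    (hGx : ∀ g i, G g * x i = (∑ k, (mat g k i : ℂ) • x k) * G g)
    (hT : ∀ a b, T a * x b - x b * T a = (if a = b then 1 else 0)
        - ∑ s : ZMod m, ((2 * root s b * root s a * c s : ℝ) : ℂ) • G (sr s))
    (g : DihedralGroup m) (i l : Fin 2) :
    (G g * T i - (∑ k, (mat g k i : ℂ) • T k) * G g) * x l
      = (∑ k, (mat g k l : ℂ) • x k) * (G g * T i - (∑ k, (mat g k i : ℂ) • T k) * G g) := by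
  obtain ⟨e, he⟩ := exists_conj g
  have hce : ∀ s, c (e s) = c s := fun s =>
    (hc g s (e s) (by rw [he, mul_assoc, mul_inv_cancel, mul_one])).symm
  have hT' : ∀ a b, T a * x b = x b * T a + ((if a = b then 1 else 0)
        - ∑ s : ZMod m, ((2 * root s b * root s a * c s : ℝ) : ℂ) • G (sr s)) := by
    intro a b; rw [← hT]; abel
  have hS : G g * ∑ s : ZMod m, ((2 * root s l * root s i * c s : ℝ) : ℂ) • G (sr s)
      = ∑ k, ∑ p, ((mat g k i * mat g p l : ℝ) : ℂ) •
        ((∑ s : ZMod m, ((2 * root s p * root s k * c s : ℝ) : ℂ) • G (sr s)) * G g) := by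
    have h1 : ∀ k p, (∑ s : ZMod m, ((2 * root s p * root s k * c s : ℝ) : ℂ) • G (sr s))
        = ∑ s : ZMod m, ((2 * root (e s) p * root (e s) k * c s : ℝ) : ℂ) • G (sr (e s)) := by
      intro k p
      rw [← Equiv.sum_comp e]
      simp_rw [hce]
    conv_rhs => simp only [h1]
    simp_rw [Finset.mul_sum, Finset.sum_mul, Finset.smul_sum, mul_smul_comm, smul_mul_assoc,
      hG, ← he, smul_smul]
    rw [Finset.sum_congr rfl (fun k _ => Finset.sum_comm), Finset.sum_comm]
    apply Finset.sum_congr rfl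
    intro s _
    simp_rw [← Finset.sum_smul]
    congr 1
    have := root_tensor_conj g s (e s) (he s) i l
    rw [show 2 * root s l * root s i * c s = (2 * root s i * root s l) * c s by ring, this]
    push_cast
    simp_rw [Finset.sum_mul]
    refine Finset.sum_congr rfl fun k _ => Finset.sum_congr rfl fun p _ => ?_
    ring
  have hO : (if i = l then (1 : R) else 0)
      = ∑ k, ∑ p, ((mat g k i * mat g p l : ℝ) : ℂ) • (if k = p then 1 else 0) := by
    have := mat_orth g i l
    simp only [smul_ite, smul_zero, Finset.sum_ite_eq, Finset.mem_univ, if_true]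
    rw [← Finset.sum_smul, ← Complex.ofReal_sum, this]
    split_ifs <;> simp
  have hL : G g * T i * x l
      = (∑ k, (mat g k l : ℂ) • x k) * (G g * T i) + ((if i = l then (1 : R) else 0) * G g
        - G g * ∑ s : ZMod m, ((2 * root s l * root s i * c s : ℝ) : ℂ) • G (sr s)) := by
    rw [mul_assoc, hT', mul_add, ← mul_assoc, hGx, mul_sub, mul_assoc]
    split_ifs <;> simp
  have h2 : (∑ k, (mat g k i : ℂ) • T k) * (∑ p, (mat g p l : ℂ) • x p)
      = (∑ p, (mat g p l : ℂ) • x p) * (∑ k, (mat g k i : ℂ) • T k)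
      + ∑ k, ∑ p, ((mat g k i * mat g p l : ℝ) : ℂ) • ((if k = p then (1 : R) else 0)
        - ∑ s : ZMod m, ((2 * root s p * root s k * c s : ℝ) : ℂ) • G (sr s)) := by
    rw [Finset.sum_mul_sum, Finset.sum_mul_sum, Finset.sum_comm (f := fun p k => ((mat g p l : ℂ) • x p) * ((mat g k i : ℂ) • T k)),
      ← Finset.sum_add_distrib]
    refine Finset.sum_congr rfl fun k _ => ?_
    rw [← Finset.sum_add_distrib]
    refine Finset.sum_congr rfl fun p _ => ?_
    rw [smul_mul_smul_comm, hT', smul_mul_smul_comm, smul_add]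
    push_cast
    rw [mul_comm (mat g p l : ℂ)]
  have hR : (∑ k, (mat g k i : ℂ) • T k) * G g * x l
      = (∑ k, (mat g k l : ℂ) • x k) * ((∑ k, (mat g k i : ℂ) • T k) * G g)
        + ((∑ k, ∑ p, ((mat g k i * mat g p l : ℝ) : ℂ) • (if k = p then (1 : R) else 0)) * G g
        - ∑ k, ∑ p, ((mat g k i * mat g p l : ℝ) : ℂ) •
        ((∑ s : ZMod m, ((2 * root s p * root s k * c s : ℝ) : ℂ) • G (sr s)) * G g)) := by
    rw [mul_assoc, hGx, ← mul_assoc, h2, add_mul, mul_assoc]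
    congr 1
    simp only [smul_sub, Finset.sum_sub_distrib, sub_mul, Finset.sum_mul, smul_mul_assoc]
  rw [sub_mul, hL, hR, hS, hO, mul_sub]
  abel

lemma gOp_dunklOp {m : ℕ} [NeZero m] {c : ZMod m → ℝ} (hc : IsParameter c) {V : Type*}
    [AddCommGroup V] [Module ℂ V] (ρ : Representation ℂ (DihedralGroup m) V)
    (g : DihedralGroup m) (i : Fin 2) :
    gOp ρ g * dunklOp c ρ i = (∑ k, (mat g k i : ℂ) • dunklOp c ρ k) * gOp ρ g := by
  refine sub_eq_zero.mp (end_eq_zero _ (fun l => ∑ k, (mat g k l : ℂ) • xOp V k) ?_ ?_)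
  · intro l
    exact cov_aux hc (xOp V) (dunklOp c ρ) (gOp ρ) (gOp_mul ρ) (gOp_xOp ρ)
      (dunklOp_xOp c ρ) g i l
  · intro v
    simp [Module.End.mul_apply, gOp_tmul, dunklOp_one_tmul]

/-- Purely algebraic part of the commutativity of Dunkl operators. -/
lemma comm_aux {m : ℕ} [NeZero m] {c : ZMod m → ℝ} {R : Type*} [Ring R]
    [Algebra ℂ R] (x T : Fin 2 → R) (G : DihedralGroup m → R)
    (hGT : ∀ g i, G g * T i = (∑ k, (mat g k i : ℂ) • T k) * G g)
    (hT : ∀ a b, T a * x b - x b * T a = (if a = b then 1 else 0)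
        - ∑ s : ZMod m, ((2 * root s b * root s a * c s : ℝ) : ℂ) • G (sr s))
    (i j l : Fin 2) : (T i * T j - T j * T i) * x l = x l * (T i * T j - T j * T i) := by
  have hT' : ∀ a b, T a * x b = x b * T a + ((if a = b then 1 else 0)
        - ∑ s : ZMod m, ((2 * root s b * root s a * c s : ℝ) : ℂ) • G (sr s)) := by
    intro a b; rw [← hT]; abel
  have hG : ∀ (s : ZMod m) a, G (sr s) * T a = T a * G (sr s)
      - ((root s a : ℝ) : ℂ) • ((∑ k, ((2 * root s k : ℝ) : ℂ) • T k) * G (sr s)) := by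
    intro s a
    have h : ∀ k, ((mat (sr s) k a : ℝ) : ℂ)
        = (if k = a then 1 else 0) - (root s a : ℂ) * ((2 * root s k : ℝ) : ℂ) := by
      intro k
      have h1 : mat (sr s) k a = (if k = a then 1 else 0) - root s a * (2 * root s k) := by
        have := mat_refl s k a; linarith
      rw [h1]; push_cast; split_ifs <;> simp
    rw [hGT]
    simp_rw [h, sub_smul, Finset.sum_sub_distrib, ite_smul, one_smul, zero_smul]
    rw [sub_mul, ← smul_mul_assoc, Finset.smul_sum]
    simp_rw [smul_smul]
    simp
  have main : ∀ a b, T a * T b * x l = x l * (T a * T b)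
        + (((if a = l then (1 : R) else 0) * T b + (if b = l then (1 : R) else 0) * T a)
        - (∑ s : ZMod m, ((2 * root s l * root s b * c s : ℝ) : ℂ) • (T a * G (sr s))
          + ∑ s : ZMod m, ((2 * root s l * root s a * c s : ℝ) : ℂ) • (T b * G (sr s)))
        + ∑ s : ZMod m, ((2 * root s l * root s a * root s b * c s : ℝ) : ℂ) •
            ((∑ k, ((2 * root s k : ℝ) : ℂ) • T k) * G (sr s))) := by
    intro a b
    have e1 : (∑ s : ZMod m, ((2 * root s l * root s a * c s : ℝ) : ℂ) • G (sr s)) * T b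
        = ∑ s : ZMod m, ((2 * root s l * root s a * c s : ℝ) : ℂ) • (T b * G (sr s))
          - ∑ s : ZMod m, ((2 * root s l * root s a * root s b * c s : ℝ) : ℂ) •
            ((∑ k, ((2 * root s k : ℝ) : ℂ) • T k) * G (sr s)) := by
      rw [← Finset.sum_sub_distrib, Finset.sum_mul]
      refine Finset.sum_congr rfl fun s _ => ?_
      rw [smul_mul_assoc, hG, smul_sub, smul_smul]
      congr 2
      push_cast; ring
    have e2 : T a * (if b = l then (1 : R) else 0) = (if b = l then (1 : R) else 0) * T a := by
      split_ifs <;> simp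
    rw [mul_assoc, hT', mul_add, ← mul_assoc, hT', add_mul, mul_sub, sub_mul, e1, e2,
      Finset.mul_sum]
    simp_rw [mul_smul_comm]
    rw [mul_assoc]
    abel
  have e3 : ∀ s : ZMod m, 2 * root s l * root s j * root s i * c s
      = 2 * root s l * root s i * root s j * c s := fun s => by ring
  rw [sub_mul, main, main, mul_sub]
  simp_rw [e3]
  abel

lemma dunklOp_comm {m : ℕ} [NeZero m] {c : ZMod m → ℝ} (hc : IsParameter c) {V : Type*}
    [AddCommGroup V] [Module ℂ V] (ρ : Representation ℂ (DihedralGroup m) V) (i j : Fin 2) :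
    dunklOp c ρ i * dunklOp c ρ j = dunklOp c ρ j * dunklOp c ρ i := by
  refine sub_eq_zero.mp (end_eq_zero _ (fun l => xOp V l) ?_ ?_)
  · intro l
    exact comm_aux (xOp V) (dunklOp c ρ) (gOp ρ) (gOp_dunklOp hc ρ) (dunklOp_xOp c ρ) i j l
  · intro v
    simp [Module.End.mul_apply, dunklOp_one_tmul]

/-- The operator of a generator on `ℂ[E] ⊗ V`. -/
def genOp {m : ℕ} [NeZero m] (c : ZMod m → ℝ) {V : Type*} [AddCommGroup V] [Module ℂ V]
    (ρ : Representation ℂ (DihedralGroup m) V) : Gen m → Module.End ℂ (StdSpace V)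
  | .x i => xOp V i
  | .xi i => dunklOp c ρ i
  | .grp g => gOp ρ g

lemma genOp_rel {m : ℕ} [NeZero m] {c : ZMod m → ℝ} (hc : IsParameter c) {V : Type*}
    [AddCommGroup V] [Module ℂ V] (ρ : Representation ℂ (DihedralGroup m) V)
    ⦃a b : Free m⦄ (h : Rel c a b) :
    FreeAlgebra.lift ℂ (genOp c ρ) a = FreeAlgebra.lift ℂ (genOp c ρ) b := by
  cases h with
  | grp_one => simpa [genOp] using gOp_one ρ
  | grp_mul g h => simpa [genOp] using gOp_mul ρ g h
  | grp_x g i =>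
    simp only [map_mul, map_sum, map_smul, FreeAlgebra.lift_ι_apply, genOp]
    exact gOp_xOp ρ g i
  | grp_xi g i =>
    simp only [map_mul, map_sum, map_smul, FreeAlgebra.lift_ι_apply, genOp]
    exact gOp_dunklOp hc ρ g i
  | x_comm i j => simpa [genOp] using xOp_comm (V := V) i j
  | xi_comm i j => simpa [genOp] using dunklOp_comm hc ρ i j
  | xi_x i j =>
    simp only [map_mul, map_sub, map_sum, map_smul, FreeAlgebra.lift_ι_apply, genOp]
    rw [dunklOp_xOp]
    split_ifs <;> simp

/-- The standard module `M_c(τ)`: the action `π` of `H_c(G, E)` on `ℂ[E] ⊗ V(τ)` in which `E*`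
acts by multiplication, `G` diagonally, and `E` by Dunkl operators (so `E` kills `1 ⊗ V(τ)`). -/
def stdModule {m : ℕ} [NeZero m] {c : ZMod m → ℝ} (hc : IsParameter c) {V : Type*}
    [AddCommGroup V] [Module ℂ V] (ρ : Representation ℂ (DihedralGroup m) V) :
    Cherednik c →ₐ[ℂ] Module.End ℂ (StdSpace V) :=
  RingQuot.liftAlgHom ℂ ⟨FreeAlgebra.lift ℂ (genOp c ρ), genOp_rel hc ρ⟩

lemma stdModule_hx {m : ℕ} [NeZero m] {c : ZMod m → ℝ} (hc : IsParameter c) {V : Type*}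
    [AddCommGroup V] [Module ℂ V] (ρ : Representation ℂ (DihedralGroup m) V) (i : Fin 2) :
    stdModule hc ρ (hx c i) = xOp V i := by
  simp [stdModule, hx, RingQuot.liftAlgHom_mkAlgHom_apply, genOp]

lemma stdModule_hxi {m : ℕ} [NeZero m] {c : ZMod m → ℝ} (hc : IsParameter c) {V : Type*}
    [AddCommGroup V] [Module ℂ V] (ρ : Representation ℂ (DihedralGroup m) V) (i : Fin 2) :
    stdModule hc ρ (hxi c i) = dunklOp c ρ i := by
  simp [stdModule, hxi, RingQuot.liftAlgHom_mkAlgHom_apply, genOp]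

lemma stdModule_hg {m : ℕ} [NeZero m] {c : ZMod m → ℝ} (hc : IsParameter c) {V : Type*}
    [AddCommGroup V] [Module ℂ V] (ρ : Representation ℂ (DihedralGroup m) V)
    (g : DihedralGroup m) : stdModule hc ρ (hg c g) = gOp ρ g := by
  simp [stdModule, hg, RingQuot.liftAlgHom_mkAlgHom_apply, genOp]

/-! ## Degree, harmonics, irreducibility and unitarity -/

section StandardModule

variable {m : ℕ} [NeZero m] {c : ZMod m → ℝ} {V : Type*} [AddCommGroup V] [Module ℂ V]

/-- The degree-`k` part `M_c(τ)_k`: homogeneous polynomials of degree `k` tensored with `V`. -/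
def degreePart (V : Type*) [AddCommGroup V] [Module ℂ V] (k : ℕ) : Submodule ℂ (StdSpace V) :=
  Submodule.span ℂ {t | ∃ (p : Poly) (v : V), p.IsHomogeneous k ∧ t = p ⊗ₜ[ℂ] v}

/-- The Dunkl harmonics `H_c(τ)_k` of degree `k`: the kernel of `E_-` in degree `k`. -/
def harmonics (hc : IsParameter c) (ρ : Representation ℂ (DihedralGroup m) V) (k : ℕ) :
    Submodule ℂ (StdSpace V) :=
  degreePart V k ⊓ LinearMap.ker (stdModule hc ρ (Eminus c))

/-- The standard module is an irreducible `H_c`-module. -/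
def IsIrreducibleStd (hc : IsParameter c) (ρ : Representation ℂ (DihedralGroup m) V) : Prop :=
  Nontrivial (StdSpace V) ∧ ∀ W : Submodule ℂ (StdSpace V),
    (∀ (h : Cherednik c), ∀ w ∈ W, stdModule hc ρ h w ∈ W) → W = ⊥ ∨ W = ⊤

/-- The standard module is unitarisable: it carries a positive definite Hermitian form (linear in
the first variable) that is contravariant for the conjugate-linear anti-involution of `H_c` given
on generators by `x i ↔ ξ i` and `g ↦ g⁻¹` (so that every reflection is fixed). -/
def IsUnitarisableStd (hc : IsParameter c) (ρ : Representation ℂ (DihedralGroup m) V) : Prop :=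
  ∃ β : StdSpace V →ₗ[ℂ] StdSpace V →ₗ⋆[ℂ] ℂ,
    (∀ p q, β q p = (starRingEnd ℂ) (β p q)) ∧
    (∀ p, p ≠ 0 → 0 < (β p p).re) ∧
    (∀ i p q, β (stdModule hc ρ (hx c i) p) q = β p (stdModule hc ρ (hxi c i) q)) ∧
    (∀ i p q, β (stdModule hc ρ (hxi c i) p) q = β p (stdModule hc ρ (hx c i) q)) ∧
    (∀ g p q, β (stdModule hc ρ (hg c g) p) q = β p (stdModule hc ρ (hg c g⁻¹) q))

/-- The operator by which `Z_0 + ε σ` acts on the standard module. -/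
def zOp (hc : IsParameter c) (ρ : Representation ℂ (DihedralGroup m) V) (ε : ℝ) :
    Module.End ℂ (StdSpace V) :=
  stdModule hc ρ (Z0 c + (ε : ℂ) • sigma c)

/-- `Proj_k = ∑_{j ≤ k/2} (-1)^j / (j! (N - k + 1)_j) E_+^j E_-^j`, where `(a)_j` is the rising
factorial; `N` is the scalar by which `σ` acts on `V(τ)`. -/
def proj (hc : IsParameter c) (ρ : Representation ℂ (DihedralGroup m) V) (N : ℝ) (k : ℕ) :
    Module.End ℂ (StdSpace V) :=
  ∑ j ∈ Finset.range (k / 2 + 1),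
    ((((-1) ^ j / ((j.factorial : ℝ) * (ascPochhammer ℝ j).eval (N - k + 1)) : ℝ)) : ℂ) •
      stdModule hc ρ (Eplus c ^ j * Eminus c ^ j)

end StandardModule

/-! ## The irreducible representations and their character sums -/

/-- `ω^(j n)` with `ω = exp (2πi/m)`. -/
def omegaPow {m : ℕ} (j : ZMod m) (n : ℤ) : ℂ :=
  Complex.exp (2 * Real.pi * Complex.I / m) ^ ((j.val : ℤ) * n)

/-- `σ_n = ∑ⱼ c_j ω^(jn)`. -/
def sigmaSum {m : ℕ} [NeZero m] (c : ZMod m → ℝ) (n : ℤ) : ℂ :=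
  ∑ j : ZMod m, (c j : ℂ) * omegaPow j n

/-- The part of `σ_n` with `j` even (used only for even `m`, when parity of `j` makes sense). -/
def sigmaEven {m : ℕ} [NeZero m] (c : ZMod m → ℝ) (n : ℤ) : ℂ :=
  ∑ j : ZMod m, if Even j.val then (c j : ℂ) * omegaPow j n else 0

/-- The part of `σ_n` with `j` odd (used only for even `m`). -/
def sigmaOdd {m : ℕ} [NeZero m] (c : ZMod m → ℝ) (n : ℤ) : ℂ :=
  ∑ j : ZMod m, if Even j.val then 0 else (c j : ℂ) * omegaPow j n

/-- The types of irreducible representations of `I_2(m)`: the trivial and the sign character, for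
even `m` the characters `χ_0` and `χ_1`, and the two-dimensional representations `ρ^(u)` for
`1 ≤ u < m/2`. -/
inductive IrrepType (m : ℕ) : Type
  | triv : IrrepType m
  | sign : IrrepType m
  | chiZero (h : Even m) : IrrepType m
  | chiOne (h : Even m) : IrrepType m
  | rho (u : ℕ) (h₁ : 1 ≤ u) (h₂ : 2 * u < m) : IrrepType m

namespace IrrepType

variable {m : ℕ}

/-- Index set of the standard basis of `V(τ)`, and also of the elements of `σ(τ)_k`: one element
for a character; for `ρ^(u)`, `true` stands for the basis vector `z` and the element `σ_{k+u}`,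
and `false` for the basis vector `zbar` and the element `σ_{k-u}`. -/
def Idx : IrrepType m → Type
  | rho _ _ _ => Bool
  | _ => Unit

/-- The exchange of the basis vectors `z` and `zbar` of `ρ^(u)` (the identity for a character). -/
def conj : (τ : IrrepType m) → τ.Idx → τ.Idx
  | rho _ _ _, a => Bool.not a
  | triv, a => a
  | sign, a => a
  | chiZero _, a => a
  | chiOne _, a => a

/-- The reflection `s_j` sends the basis vector `a` to `coef j a` times the basis vector
`conj a`. -/
def coef : (τ : IrrepType m) → ZMod m → τ.Idx → ℂ
  | triv, _, _ => 1
  | sign, _, _ => -1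
  | chiZero _, j, _ => if Even j.val then -1 else 1
  | chiOne _, j, _ => if Even j.val then 1 else -1
  | rho u _ _, j, true => omegaPow j u
  | rho u _ _, j, false => omegaPow j (-u)

/-- The elements `σ_{τ,k}` of the set `σ(τ)_k`. -/
def sigmaElt [NeZero m] (c : ZMod m → ℝ) (k : ℕ) : (τ : IrrepType m) → τ.Idx → ℂ
  | triv, _ => sigmaSum c k
  | sign, _ => -sigmaSum c k
  | chiZero _, _ => -sigmaEven c k + sigmaOdd c k
  | chiOne _, _ => sigmaEven c k - sigmaOdd c k
  | rho u _ _, true => sigmaSum c (k + u)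
  | rho u _ _, false => sigmaSum c (k - u)

/-- `b` is a standard basis of the representation `ρ`, exhibiting it as one of type `τ`. -/
def IsStandardBasis (τ : IrrepType m) {V : Type*} [AddCommGroup V] [Module ℂ V]
    (ρ : Representation ℂ (DihedralGroup m) V) (b : Module.Basis τ.Idx ℂ V) : Prop :=
  ∀ (j : ZMod m) (a : τ.Idx), ρ (sr j) (b a) = τ.coef j a • b (τ.conj a)

end IrrepType

/-! ## Eigenvalues and eigenvectors -/

/-- The eigenvalue `λ^± = ± √((k - N)² - (1 - ε²) s²)`; the sign is `+` for `true`. -/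
def eigval (N ε : ℝ) (k : ℕ) (s : ℝ) (sgn : Bool) : ℝ :=
  (if sgn then 1 else -1) * Real.sqrt (((k : ℝ) - N) ^ 2 - (1 - ε ^ 2) * s ^ 2)

/-- The polynomial `z = x + iy`. -/
def zPoly : Poly := X 0 + Complex.I • X 1

/-- The polynomial `x - iy`. -/
def zbarPoly : Poly := X 0 - Complex.I • X 1

/-- The eigenvectors `h(ε, s)^±` of degree `k`, where `s = σ_{τ,k}`, `v = z(σ_{τ,k})` and
`w = zbar(σ_{τ,k})`; the sign is `+` for `true`. -/
def eigvec {m : ℕ} [NeZero m] {c : ZMod m → ℝ} (hc : IsParameter c) {V : Type*}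
    [AddCommGroup V] [Module ℂ V] (ρ : Representation ℂ (DihedralGroup m) V)
    (N ε : ℝ) (k : ℕ) (s : ℝ) (v w : V) : Bool → StdSpace V
  | true => proj hc ρ N k
      (((k - N + eigval N ε k s true : ℝ) : ℂ) • ((zbarPoly ^ k) ⊗ₜ[ℂ] w)
        - ((s * (1 - ε) : ℝ) : ℂ) • ((zPoly ^ k) ⊗ₜ[ℂ] v))
  | false => proj hc ρ N k
      (((k - N - eigval N ε k s false : ℝ) : ℂ) • ((zPoly ^ k) ⊗ₜ[ℂ] v)
        - ((s * (1 + ε) : ℝ) : ℂ) • ((zbarPoly ^ k) ⊗ₜ[ℂ] w))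

end DihedralCherednik

end

open DihedralCherednik

namespace DihedralCherednik

open MvPolynomial DihedralGroup

noncomputable section

/-! The operators `E_+` and `E_-` generate a copy of sl₂. Its Cartan element is, up to sign, `euler
- σ + 1`, and `euler - σ` acts on degree `k` by the scalar `k - N` (`Eminus_mul_Eplus`,
`euler_apply`). Both `Z_0` and `σ` commute with this sl₂ (`Z0_mul_Eplus`, `Z0_mul_Eminus`,
`sigma_mul_Eplus`, `sigma_mul_Eminus`). Hence `Z_0 + ε σ` preserves the harmonics and commutes with
`Proj_k`, the extremal projector of sl₂, and it suffices to study it on harmonics.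

Since `z z̄ = 2 E_+`, only the classes of `z^k ⊗ v` and `z̄^k ⊗ w` survive in `M_k` modulo `E_+
M_{k-2}`, and they are independent (`exists_top_components`, `top_components_eq_zero`). Thus
`Proj_k` carries these vectors onto the harmonics of degree `k`. Modulo the image of `E_+`, `Z_0`
acts as `-(k - N) + σ` on multiples of `z` and as `(k - N) - σ` on multiples of `z̄` (`proj_Z0_hz`,
`proj_Z0_hzbar`). Each reflection exchanges the lines of `z^k ⊗ b a` and `z̄^k ⊗ b (conj a)`, and
`σ` exchanges these two vectors with a common real factor `s`, an element of `σ(τ)_k`. So `Z_0 + ε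
σ` splits into 2 × 2 blocks with diagonal entries `∓(k - N)` and off-diagonal entries `s(1 + ε)`,
`-s(1 - ε)`. Such a block has trace zero, and its square is the scalar `(k - N)² - (1 - ε²)s²`; the
eigenvalues and eigenvectors can be read off.

Unitarity enters through `euler = ∑ x_i ξ_i`: contravariance makes its eigenvalues positive in
positive degree (`IsUnitarisableStd.euler_eigenvalue_pos`). The sum and the difference of the two
projected top vectors are eigenvectors of `σ` with eigenvalues `±s`, so `k - N ± s > 0`, that is
`|s| < k - N`. This makes the radicand positive and the eigenvectors independent. In degree 1, where
`Proj_1` is the identity, it gives `N < 1`, and then no denominator of any `Proj_k` vanishes.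

Finally, `E_+` is injective and `p - Proj_k p` lies in its image, so a homogeneous eigenvector is
reduced by induction on the degree to harmonic ones (`Eplus_pow_mem_of_eigenvector`). -/

/-! ## Relations of the Cherednik algebra in complex coordinates -/

section ComplexRelations

/-- The number `ω^j`, written in trigonometric form. -/
def phase {m : ℕ} (j : ZMod m) : ℂ := Real.cos (angle j) + Complex.I * Real.sin (angle j)

/-- The number `ω^(-j)`, written in trigonometric form. -/
def phaseInv {m : ℕ} (j : ZMod m) : ℂ := Real.cos (angle j) - Complex.I * Real.sin (angle j)

lemma phase_mul_phaseInv {m : ℕ} (j : ZMod m) : phase j * phaseInv j = 1 := by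
  have h : (Real.sin (angle j) : ℂ) ^ 2 + (Real.cos (angle j) : ℂ) ^ 2 = 1 := by
    exact_mod_cast Real.sin_sq_add_cos_sq (angle j)
  unfold phase phaseInv
  linear_combination h - (Real.sin (angle j) : ℂ) ^ 2 * Complex.I_sq

variable {m : ℕ} [NeZero m] (c : ZMod m → ℝ)

/-- The element `∑ⱼ c_j ω^j s_j`. -/
def sigmaPos : Cherednik c := ∑ s : ZMod m, ((c s : ℂ) * phase s) • hg c (sr s)

/-- The element `∑ⱼ c_j ω^(-j) s_j`. -/
def sigmaNeg : Cherednik c := ∑ s : ZMod m, ((c s : ℂ) * phaseInv s) • hg c (sr s)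

lemma hx_mul_comm (i j : Fin 2) : hx c i * hx c j = hx c j * hx c i := by
  simpa [hx] using RingQuot.mkAlgHom_rel ℂ (Rel.x_comm (c := c) i j)

lemma hxi_mul_comm (i j : Fin 2) : hxi c i * hxi c j = hxi c j * hxi c i := by
  simpa [hxi] using RingQuot.mkAlgHom_rel ℂ (Rel.xi_comm (c := c) i j)

lemma hg_mul_hx (g : DihedralGroup m) (i : Fin 2) :
    hg c g * hx c i = (∑ k, (mat g k i : ℂ) • hx c k) * hg c g := by
  have := RingQuot.mkAlgHom_rel ℂ (Rel.grp_x (c := c) g i)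
  simpa only [hx, hg, map_mul, map_sum, map_smul] using this

lemma hg_mul_hxi (g : DihedralGroup m) (i : Fin 2) :
    hg c g * hxi c i = (∑ k, (mat g k i : ℂ) • hxi c k) * hg c g := by
  have := RingQuot.mkAlgHom_rel ℂ (Rel.grp_xi (c := c) g i)
  simpa only [hxi, hg, map_mul, map_sum, map_smul] using this

lemma hxi_mul_hx (i j : Fin 2) :
    hxi c i * hx c j = hx c j * hxi c i + ((if i = j then 1 else 0)
      - ∑ s : ZMod m, ((2 * root s j * root s i * c s : ℝ) : ℂ) • hg c (sr s)) := by
  rw [← sub_eq_iff_eq_add']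
  have := RingQuot.mkAlgHom_rel ℂ (Rel.xi_x (c := c) i j)
  simp only [map_sub, map_mul, map_sum, map_smul] at this
  rw [hxi, hx, this]
  split_ifs <;> simp [hg]

lemma hz_mul_hzbar : hz c * hzbar c = hzbar c * hz c := by
  simp only [hz, hzbar, mul_add, add_mul, mul_sub, sub_mul, mul_smul_comm, smul_mul_assoc,
    hx_mul_comm c 1 0]
  module

lemma hzeta_mul_hzetabar : hzeta c * hzetabar c = hzetabar c * hzeta c := by
  simp only [hzeta, hzetabar, mul_add, add_mul, mul_sub, sub_mul, mul_smul_comm, smul_mul_assoc,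
    hxi_mul_comm c 1 0]
  module

lemma hg_mul_hz (s : ZMod m) :
    hg c (sr s) * hz c = phase s • (hzbar c * hg c (sr s)) := by
  simp only [hz, hzbar, phase, mul_add, mul_smul_comm, hg_mul_hx, Fin.sum_univ_two, mat,
    Matrix.of_apply, Matrix.cons_val', Matrix.cons_val_zero, Matrix.cons_val_one,
    Matrix.cons_val_fin_one, sub_mul, add_mul, smul_mul_assoc]
  push_cast
  linear_combination (norm := module)
    Complex.I_sq • ((Real.sin (angle s) : ℂ) • (hx c 1 * hg c (sr s)))

lemma hg_mul_hzbar (s : ZMod m) :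
    hg c (sr s) * hzbar c = phaseInv s • (hz c * hg c (sr s)) := by
  simp only [hz, hzbar, phaseInv, mul_sub, mul_smul_comm, hg_mul_hx, Fin.sum_univ_two, mat,
    Matrix.of_apply, Matrix.cons_val', Matrix.cons_val_zero, Matrix.cons_val_one,
    Matrix.cons_val_fin_one, add_mul, smul_mul_assoc]
  push_cast
  linear_combination (norm := module)
    Complex.I_sq • ((Real.sin (angle s) : ℂ) • (hx c 1 * hg c (sr s)))

lemma hg_mul_hzeta (s : ZMod m) :
    hg c (sr s) * hzeta c = phaseInv s • (hzetabar c * hg c (sr s)) := by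
  simp only [hzeta, hzetabar, phaseInv, mul_sub, mul_smul_comm, hg_mul_hxi, Fin.sum_univ_two, mat,
    Matrix.of_apply, Matrix.cons_val', Matrix.cons_val_zero, Matrix.cons_val_one,
    Matrix.cons_val_fin_one, add_mul, smul_mul_assoc]
  push_cast
  linear_combination (norm := module)
    Complex.I_sq • ((1 / 2 * Real.sin (angle s) : ℂ) • (hxi c 1 * hg c (sr s)))

lemma hg_mul_hzetabar (s : ZMod m) :
    hg c (sr s) * hzetabar c = phase s • (hzeta c * hg c (sr s)) := by
  simp only [hzeta, hzetabar, phase, mul_add, mul_smul_comm, hg_mul_hxi, Fin.sum_univ_two, mat,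
    Matrix.of_apply, Matrix.cons_val', Matrix.cons_val_zero, Matrix.cons_val_one,
    Matrix.cons_val_fin_one, sub_mul, add_mul, smul_mul_assoc]
  push_cast
  linear_combination (norm := module)
    Complex.I_sq • ((1 / 2 * Real.sin (angle s) : ℂ) • (hxi c 1 * hg c (sr s)))

/-- The factor `ω^(±j)` picked up when `s_j` passes a coordinate turns `σ` into a twisted sum. These
identities, read in either direction, trade `sigmaPos` and `sigmaNeg` for `σ`, so that the twisted
sums disappear from all final relations. -/
lemma sigma_mul_hz : sigma c * hz c = hzbar c * sigmaPos c := by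
  simp only [sigma, sigmaPos, Finset.sum_mul, Finset.mul_sum, smul_mul_assoc, mul_smul_comm,
    hg_mul_hz, smul_smul]

lemma sigma_mul_hzbar : sigma c * hzbar c = hz c * sigmaNeg c := by
  simp only [sigma, sigmaNeg, Finset.sum_mul, Finset.mul_sum, smul_mul_assoc, mul_smul_comm,
    hg_mul_hzbar, smul_smul]

lemma sigmaPos_mul_hzeta : sigmaPos c * hzeta c = hzetabar c * sigma c := by
  simp only [sigma, sigmaPos, Finset.sum_mul, Finset.mul_sum, smul_mul_assoc, mul_smul_comm,
    hg_mul_hzeta, smul_smul, mul_assoc, phase_mul_phaseInv, mul_one]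

lemma sigmaNeg_mul_hzetabar : sigmaNeg c * hzetabar c = hzeta c * sigma c := by
  simp only [sigma, sigmaNeg, Finset.sum_mul, Finset.mul_sum, smul_mul_assoc, mul_smul_comm,
    hg_mul_hzetabar, smul_smul, mul_assoc, mul_comm (phaseInv _), phase_mul_phaseInv, mul_one]

lemma sigma_mul_hzetabar : sigma c * hzetabar c = hzeta c * sigmaPos c := by
  simp only [sigma, sigmaPos, Finset.sum_mul, Finset.mul_sum, smul_mul_assoc, mul_smul_comm,
    hg_mul_hzetabar, smul_smul]

lemma sigmaPos_mul_hzbar : sigmaPos c * hzbar c = hz c * sigma c := by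
  simp only [sigma, sigmaPos, Finset.sum_mul, Finset.mul_sum, smul_mul_assoc, mul_smul_comm,
    hg_mul_hzbar, smul_smul, mul_assoc, phase_mul_phaseInv, mul_one]

lemma cherednik_sub_smul (a b : ℂ) (h : Cherednik c) : (a - b) • h = a • h - b • h := by
  module

/-- Twice the projector onto a root is the identity minus the matrix of the reflection. The root
coefficients thus become matrix entries `±cos`, `sin` of the doubled angle, which assemble into
`ω^(±j)` in complex coordinates. -/
lemma hxi_mul_hx_eq (i j : Fin 2) :
    hxi c i * hx c j = hx c j * hxi c i + ((if i = j then 1 - sigma c else 0)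
      + ∑ s : ZMod m, ((c s : ℂ) * mat (sr s) j i) • hg c (sr s)) := by
  rw [hxi_mul_hx]
  congr 1
  have h (s : ZMod m) : ((2 * root s j * root s i * c s : ℝ) : ℂ)
      = (if i = j then (c s : ℂ) else 0) - (c s : ℂ) * mat (sr s) j i := by
    rw [mat_refl]
    by_cases hij : i = j
    · subst hij; simp; ring
    · have hji : j ≠ i := fun e => hij e.symm
      simp [hij, hji, mul_comm]
  simp only [h, cherednik_sub_smul, Finset.sum_sub_distrib]
  by_cases hij : i = j
  · simp only [hij, if_true, sigma]; abel
  · simp [hij]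

lemma sigmaPos_eq : sigmaPos c =
    ∑ s : ZMod m, ((c s : ℂ) * mat (sr s) 0 0) • hg c (sr s)
      + Complex.I • ∑ s : ZMod m, ((c s : ℂ) * mat (sr s) 0 1) • hg c (sr s) := by
  rw [sigmaPos, Finset.smul_sum, ← Finset.sum_add_distrib]
  refine Finset.sum_congr rfl fun s _ => ?_
  have h : (c s : ℂ) * phase s
      = (c s : ℂ) * mat (sr s) 0 0 + Complex.I * ((c s : ℂ) * mat (sr s) 0 1) := by
    simp [phase, mat]; ring
  rw [h, add_smul, smul_smul]

lemma sigmaNeg_eq : sigmaNeg c =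
    ∑ s : ZMod m, ((c s : ℂ) * mat (sr s) 0 0) • hg c (sr s)
      - Complex.I • ∑ s : ZMod m, ((c s : ℂ) * mat (sr s) 0 1) • hg c (sr s) := by
  rw [sigmaNeg, Finset.smul_sum, ← Finset.sum_sub_distrib]
  refine Finset.sum_congr rfl fun s _ => ?_
  have h : (c s : ℂ) * phaseInv s
      = (c s : ℂ) * mat (sr s) 0 0 - Complex.I * ((c s : ℂ) * mat (sr s) 0 1) := by
    simp [phaseInv, mat]; ring
  rw [h, cherednik_sub_smul, smul_smul]

lemma hxi_mul_hx_coords :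
    hxi c 0 * hx c 0 = hx c 0 * hxi c 0 + (1 - sigma c
      + ∑ s : ZMod m, ((c s : ℂ) * mat (sr s) 0 0) • hg c (sr s)) ∧
    hxi c 1 * hx c 1 = hx c 1 * hxi c 1 + (1 - sigma c
      - ∑ s : ZMod m, ((c s : ℂ) * mat (sr s) 0 0) • hg c (sr s)) ∧
    hxi c 0 * hx c 1 = hx c 1 * hxi c 0
      + ∑ s : ZMod m, ((c s : ℂ) * mat (sr s) 0 1) • hg c (sr s) ∧
    hxi c 1 * hx c 0 = hx c 0 * hxi c 1
      + ∑ s : ZMod m, ((c s : ℂ) * mat (sr s) 0 1) • hg c (sr s) := by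
  have neg (a : ℂ) (h : Cherednik c) : (-a) • h = -(a • h) := by module
  refine ⟨?_, ?_, ?_, ?_⟩ <;> rw [hxi_mul_hx_eq] <;> simp [mat, sub_eq_add_neg, neg]

lemma hzeta_mul_hz : hzeta c * hz c = hz c * hzeta c + (1 - sigma c) := by
  obtain ⟨h00, h11, h01, h10⟩ := hxi_mul_hx_coords c
  simp only [hzeta, hz, mul_add, add_mul, mul_sub, sub_mul, mul_smul_comm, smul_mul_assoc,
    h00, h11, h01, h10]
  linear_combination (norm := module) (-(1 / 2 : ℂ) * Complex.I_sq) • (1 - sigma c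
    - ∑ s : ZMod m, ((c s : ℂ) * mat (sr s) 0 0) • hg c (sr s))

lemma hzetabar_mul_hzbar : hzetabar c * hzbar c = hzbar c * hzetabar c + (1 - sigma c) := by
  obtain ⟨h00, h11, h01, h10⟩ := hxi_mul_hx_coords c
  simp only [hzetabar, hzbar, mul_add, add_mul, mul_sub, sub_mul, mul_smul_comm, smul_mul_assoc,
    h00, h11, h01, h10]
  linear_combination (norm := module) (-(1 / 2 : ℂ) * Complex.I_sq) • (1 - sigma c
    - ∑ s : ZMod m, ((c s : ℂ) * mat (sr s) 0 0) • hg c (sr s))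

lemma hzetabar_mul_hz : hzetabar c * hz c = hz c * hzetabar c + sigmaPos c := by
  obtain ⟨h00, h11, h01, h10⟩ := hxi_mul_hx_coords c
  simp only [hzetabar, hz, mul_add, add_mul, mul_smul_comm, smul_mul_assoc,
    h00, h11, h01, h10, sigmaPos_eq]
  linear_combination (norm := module) ((1 / 2 : ℂ) * Complex.I_sq) • (1 - sigma c
    - ∑ s : ZMod m, ((c s : ℂ) * mat (sr s) 0 0) • hg c (sr s))

lemma hzeta_mul_hzbar : hzeta c * hzbar c = hzbar c * hzeta c + sigmaNeg c := by
  obtain ⟨h00, h11, h01, h10⟩ := hxi_mul_hx_coords c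
  simp only [hzeta, hzbar, mul_sub, sub_mul, mul_smul_comm, smul_mul_assoc,
    h00, h11, h01, h10, sigmaNeg_eq]
  linear_combination (norm := module) ((1 / 2 : ℂ) * Complex.I_sq) • (1 - sigma c
    - ∑ s : ZMod m, ((c s : ℂ) * mat (sr s) 0 0) • hg c (sr s))

lemma Eplus_eq : Eplus c = (1 / 2 : ℂ) • (hz c * hzbar c) := by
  simp only [Eplus, hz, hzbar, Fin.sum_univ_two, pow_two, add_mul, mul_sub,
    mul_smul_comm, smul_mul_assoc, hx_mul_comm c 1 0]
  linear_combination (norm := module) ((1 / 2 : ℂ) * Complex.I_sq) • (hx c 1 * hx c 1)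

lemma Eminus_eq : Eminus c = (-2 : ℂ) • (hzeta c * hzetabar c) := by
  simp only [Eminus, hzeta, hzetabar, Fin.sum_univ_two, pow_two, mul_add,
    sub_mul, mul_smul_comm, smul_mul_assoc, hxi_mul_comm c 1 0]
  linear_combination (norm := module) (-(1 / 2 : ℂ) * Complex.I_sq) • (hxi c 1 * hxi c 1)

/-- The Euler element `zζ + z̄ζ̄`. -/
def euler : Cherednik c := hz c * hzeta c + hzbar c * hzetabar c

lemma euler_eq : euler c = ∑ i, hx c i * hxi c i := by
  simp only [euler, hz, hzbar, hzeta, hzetabar, Fin.sum_univ_two, mul_add, add_mul, mul_sub,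
    sub_mul, mul_smul_comm, smul_mul_assoc]
  linear_combination (norm := module) (-Complex.I_sq) • (hx c 1 * hxi c 1)

/-- The commutators of `ζ` and `ζ̄` with `z` contribute `-zσ` and `z̄ sigmaPos = σz`; subtracting
`σ` from the Euler element cancels both. -/
lemma euler_sub_sigma_mul_hz :
    (euler c - sigma c) * hz c = hz c * (euler c - sigma c) + hz c := by
  have h1 := hzeta_mul_hz c
  have h2 := hzetabar_mul_hz c
  have h3 := sigma_mul_hz c
  have h4 := hz_mul_hzbar c
  simp only [euler, sub_mul, add_mul, mul_assoc, h1, h2, h3]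
  simp only [mul_add, mul_sub, mul_one, ← mul_assoc, h4]
  abel

lemma euler_sub_sigma_mul_hzbar :
    (euler c - sigma c) * hzbar c = hzbar c * (euler c - sigma c) + hzbar c := by
  have h1 := hzeta_mul_hzbar c
  have h2 := hzetabar_mul_hzbar c
  have h3 := sigma_mul_hzbar c
  have h4 := hz_mul_hzbar c
  simp only [euler, sub_mul, add_mul, mul_assoc, h1, h2, h3]
  simp only [mul_add, mul_sub, mul_one, ← mul_assoc, h4]
  abel

lemma sigma_mul_Eplus : sigma c * Eplus c = Eplus c * sigma c := by
  rw [Eplus_eq, mul_smul_comm, smul_mul_assoc, ← mul_assoc, sigma_mul_hz, mul_assoc,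
    sigmaPos_mul_hzbar, hz_mul_hzbar, ← hz_mul_hzbar, ← mul_assoc, hz_mul_hzbar]

lemma sigma_mul_Eminus : sigma c * Eminus c = Eminus c * sigma c := by
  rw [Eminus_eq, mul_smul_comm, smul_mul_assoc, hzeta_mul_hzetabar, ← mul_assoc,
    sigma_mul_hzetabar, mul_assoc, sigmaPos_mul_hzeta, ← mul_assoc, hzeta_mul_hzetabar]

lemma Z0_mul_hz : Z0 c * hz c = hz c * Z0 c + (sigma c * hz c + hz c * sigma c - hz c) := by
  simp only [Z0, sub_mul, mul_assoc, hzeta_mul_hz, hzetabar_mul_hz, sigma_mul_hz]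
  simp only [mul_add, mul_sub, mul_one, ← mul_assoc, hz_mul_hzbar]
  abel

lemma Z0_mul_hzbar :
    Z0 c * hzbar c = hzbar c * Z0 c + (hzbar c - sigma c * hzbar c - hzbar c * sigma c) := by
  simp only [Z0, sub_mul, mul_assoc, hzeta_mul_hzbar, hzetabar_mul_hzbar, sigma_mul_hzbar]
  simp only [mul_add, mul_sub, mul_one, ← mul_assoc, hz_mul_hzbar]
  abel

/-- The corrections for `z` and `z̄` have opposite signs: in the product `z z̄` everything cancels
except the commutator of `σ` with `z z̄`, which is zero. -/
lemma Z0_mul_Eplus : Z0 c * Eplus c = Eplus c * Z0 c := by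
  have hs := sigma_mul_Eplus c
  have e : Z0 c * (hz c * hzbar c) = hz c * hzbar c * Z0 c
      + (sigma c * (hz c * hzbar c) - hz c * hzbar c * sigma c) := by
    rw [← mul_assoc, Z0_mul_hz, add_mul, mul_assoc, Z0_mul_hzbar]
    simp only [add_mul, sub_mul, mul_add, mul_sub, mul_assoc]
    abel
  rw [Eplus_eq, mul_smul_comm, smul_mul_assoc] at hs ⊢
  rw [e, smul_add, smul_sub, hs, sub_self, add_zero]

lemma Z0_mul_hzeta :
    Z0 c * hzeta c = hzeta c * Z0 c + (hzeta c - hzeta c * sigma c - sigma c * hzeta c) := by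
  have e1 : hzeta c * (hzbar c * hzetabar c)
      = hzbar c * (hzeta c * hzetabar c) + hzeta c * sigma c := by
    rw [← mul_assoc, hzeta_mul_hzbar, add_mul, sigmaNeg_mul_hzetabar, mul_assoc]
  have e2 : hzeta c * (hz c * hzeta c) = hz c * hzeta c * hzeta c + (1 - sigma c) * hzeta c := by
    rw [← mul_assoc, hzeta_mul_hz, add_mul]
  rw [Z0, mul_sub, e1, e2, sub_mul, mul_assoc, ← hzeta_mul_hzetabar, sub_mul, one_mul]
  abel

lemma Z0_mul_hzetabar :
    Z0 c * hzetabar c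
      = hzetabar c * Z0 c + (sigma c * hzetabar c + hzetabar c * sigma c - hzetabar c) := by
  have e1 : hzetabar c * (hz c * hzeta c)
      = hz c * (hzetabar c * hzeta c) + hzetabar c * sigma c := by
    rw [← mul_assoc, hzetabar_mul_hz, add_mul, sigmaPos_mul_hzeta, mul_assoc]
  have e2 : hzetabar c * (hzbar c * hzetabar c)
      = hzbar c * hzetabar c * hzetabar c + (1 - sigma c) * hzetabar c := by
    rw [← mul_assoc, hzetabar_mul_hzbar, add_mul]
  rw [Z0, mul_sub, e1, e2, sub_mul, mul_assoc (hz c), hzeta_mul_hzetabar, sub_mul, one_mul]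
  abel

lemma Z0_mul_Eminus : Z0 c * Eminus c = Eminus c * Z0 c := by
  have hs := sigma_mul_Eminus c
  have e : Z0 c * (hzeta c * hzetabar c) = hzeta c * hzetabar c * Z0 c
      + (hzeta c * hzetabar c * sigma c - sigma c * (hzeta c * hzetabar c)) := by
    rw [← mul_assoc, Z0_mul_hzeta, add_mul, mul_assoc, Z0_mul_hzetabar]
    simp only [sub_mul, mul_add, mul_sub, mul_assoc]
    abel
  rw [Eminus_eq, mul_smul_comm, smul_mul_assoc] at hs ⊢
  rw [e, smul_add, smul_sub, hs, sub_self, add_zero]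

/-- No reflection survives: the term `ζ sigmaPos` equals `σ ζ̄` and cancels the `-σ ζ̄` coming from
the commutator of `ζ` with `z`. -/
lemma Eminus_mul_hz : Eminus c * hz c = hz c * Eminus c - (2 : ℂ) • hzetabar c := by
  have e : hzeta c * hzetabar c * hz c = hz c * (hzeta c * hzetabar c) + hzetabar c := by
    rw [mul_assoc, hzetabar_mul_hz, mul_add, ← sigma_mul_hzetabar, ← mul_assoc, hzeta_mul_hz]
    simp only [add_mul, sub_mul, one_mul, mul_assoc]
    abel
  rw [Eminus_eq, smul_mul_assoc, e, mul_smul_comm]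
  module

lemma Eminus_mul_hzbar : Eminus c * hzbar c = hzbar c * Eminus c - (2 : ℂ) • hzeta c := by
  have e : hzeta c * hzetabar c * hzbar c = hzbar c * (hzeta c * hzetabar c) + hzeta c := by
    rw [mul_assoc, hzetabar_mul_hzbar, mul_add, ← mul_assoc, hzeta_mul_hzbar, add_mul,
      sigmaNeg_mul_hzetabar]
    simp only [mul_sub, mul_one, mul_assoc]
    abel
  rw [Eminus_eq, smul_mul_assoc, e, mul_smul_comm]
  module

/-- The sl₂ relation on which the projector rests. -/
lemma Eminus_mul_Eplus :
    Eminus c * Eplus c = Eplus c * Eminus c - (euler c - sigma c + 1) := by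
  have e : Eminus c * (hz c * hzbar c) = hz c * hzbar c * Eminus c
      - (2 : ℂ) • (euler c - sigma c + 1) := by
    rw [← mul_assoc, Eminus_mul_hz, sub_mul, mul_assoc, Eminus_mul_hzbar, smul_mul_assoc,
      hzetabar_mul_hzbar, mul_sub, mul_smul_comm, ← mul_assoc, euler]
    module
  rw [Eplus_eq, mul_smul_comm, smul_mul_assoc, e]
  module

end ComplexRelations

/-! ## The grading of the standard module -/

section Polynomials

lemma exists_homogeneous_of_succ {k : ℕ} {p : Poly} (hp : p.IsHomogeneous (k + 1)) :
    ∃ q r : Poly, q.IsHomogeneous k ∧ r.IsHomogeneous k ∧ p = X 0 * q + X 1 * r := by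
  have mono : ∀ d : Fin 2 →₀ ℕ, ∀ a : ℂ, d.degree = k + 1 →
      ∃ q r : Poly, q.IsHomogeneous k ∧ r.IsHomogeneous k ∧
        monomial d a = X 0 * q + X 1 * r := by
    intro d a hd
    have hsum : d 0 + d 1 = k + 1 := by rw [← hd, Finsupp.degree_eq_sum, Fin.sum_univ_two]
    have key : ∀ i : Fin 2, 1 ≤ d i →
        ∃ q : Poly, q.IsHomogeneous k ∧ monomial d a = X i * q := by
      intro i hi
      have hle : Finsupp.single i 1 ≤ d := by simpa using hi
      refine ⟨monomial (d - Finsupp.single i 1) a, isHomogeneous_monomial _ ?_, ?_⟩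
      · have := congrArg Finsupp.degree (tsub_add_cancel_of_le hle)
        rw [map_add, Finsupp.degree_single, hd] at this
        omega
      · rw [X, monomial_mul, one_mul, add_tsub_cancel_of_le hle]
    rcases Nat.eq_zero_or_pos (d 0) with h0 | h0
    · obtain ⟨q, hq, e⟩ := key 1 (by omega)
      exact ⟨0, q, isHomogeneous_zero _ _ _, hq, by rw [e]; ring⟩
    · obtain ⟨q, hq, e⟩ := key 0 h0
      exact ⟨q, 0, hq, isHomogeneous_zero _ _ _, by rw [e]; ring⟩
  rw [p.as_sum]
  refine Finset.sum_induction _ (fun p => ∃ q r : Poly, q.IsHomogeneous k ∧ r.IsHomogeneous k ∧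
    p = X 0 * q + X 1 * r) ?_ ⟨0, 0, isHomogeneous_zero _ _ _, isHomogeneous_zero _ _ _, by simp⟩ ?_
  · rintro _ _ ⟨q, r, hq, hr, rfl⟩ ⟨q', r', hq', hr', rfl⟩
    exact ⟨q + q', r + r', hq.add hq', hr.add hr', by ring⟩
  · intro d hd
    refine mono d _ ?_
    rw [Finsupp.degree_eq_weight_one]
    exact hp (mem_support_iff.mp hd)

end Polynomials

section Grading

variable {m : ℕ} [NeZero m] {c : ZMod m → ℝ} {V : Type*} [AddCommGroup V] [Module ℂ V]

lemma mem_degreePart_zero {p : StdSpace V} :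
    p ∈ degreePart V 0 ↔ ∃ v : V, p = 1 ⊗ₜ[ℂ] v := by
  constructor
  · intro hp
    induction hp using Submodule.span_induction with
    | mem x h =>
      obtain ⟨q, v, hq, rfl⟩ := h
      rw [← totalDegree_zero_iff_isHomogeneous] at hq
      rw [totalDegree_eq_zero_iff_eq_C.mp hq]
      refine ⟨coeff 0 q • v, ?_⟩
      rw [← TensorProduct.smul_tmul, smul_eq_C_mul, mul_one]
    | zero => exact ⟨0, by simp⟩
    | add x y _ _ hx hy =>
      obtain ⟨v, rfl⟩ := hx
      obtain ⟨w, rfl⟩ := hy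
      exact ⟨v + w, by rw [TensorProduct.tmul_add]⟩
    | smul a x _ hx =>
      obtain ⟨v, rfl⟩ := hx
      exact ⟨a • v, by rw [TensorProduct.tmul_smul]⟩
  · rintro ⟨v, rfl⟩
    exact Submodule.subset_span ⟨1, v, isHomogeneous_one _ _, rfl⟩

lemma xOp_mem_degreePart {k : ℕ} (i : Fin 2) {p : StdSpace V} (hp : p ∈ degreePart V k) :
    xOp V i p ∈ degreePart V (k + 1) := by
  induction hp using Submodule.span_induction with
  | mem x h =>
    obtain ⟨q, v, hq, rfl⟩ := h
    rw [xOp_tmul, add_comm]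
    exact Submodule.subset_span ⟨_, v, (isHomogeneous_X ℂ i).mul hq, rfl⟩
  | zero => simp
  | add x y _ _ hx hy => rw [map_add]; exact add_mem hx hy
  | smul a x _ hx => rw [map_smul]; exact Submodule.smul_mem _ _ hx

lemma exists_xOp_of_mem_degreePart_succ {k : ℕ} {p : StdSpace V}
    (hp : p ∈ degreePart V (k + 1)) :
    ∃ q ∈ degreePart V k, ∃ r ∈ degreePart V k, p = xOp V 0 q + xOp V 1 r := by
  induction hp using Submodule.span_induction with
  | mem x h =>
    obtain ⟨f, v, hf, rfl⟩ := h
    obtain ⟨q, r, hq, hr, rfl⟩ := exists_homogeneous_of_succ hf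
    refine ⟨q ⊗ₜ v, Submodule.subset_span ⟨q, v, hq, rfl⟩, r ⊗ₜ v,
      Submodule.subset_span ⟨r, v, hr, rfl⟩, ?_⟩
    rw [xOp_tmul, xOp_tmul, TensorProduct.add_tmul]
  | zero => exact ⟨0, zero_mem _, 0, zero_mem _, by simp⟩
  | add x y _ _ hx hy =>
    obtain ⟨q, hq, r, hr, rfl⟩ := hx
    obtain ⟨q', hq', r', hr', rfl⟩ := hy
    refine ⟨q + q', add_mem hq hq', r + r', add_mem hr hr', ?_⟩
    rw [map_add, map_add]; abel
  | smul a x _ hx =>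
    obtain ⟨q, hq, r, hr, rfl⟩ := hx
    refine ⟨a • q, Submodule.smul_mem _ _ hq, a • r, Submodule.smul_mem _ _ hr, ?_⟩
    rw [map_smul, map_smul, smul_add]

variable (hc : IsParameter c) (ρ : Representation ℂ (DihedralGroup m) V)

lemma stdModule_mul_apply (a b : Cherednik c) (p : StdSpace V) :
    stdModule hc ρ (a * b) p = stdModule hc ρ a (stdModule hc ρ b p) := by
  rw [map_mul]; rfl

lemma stdModule_add_apply (a b : Cherednik c) (p : StdSpace V) :
    stdModule hc ρ (a + b) p = stdModule hc ρ a p + stdModule hc ρ b p := by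
  rw [map_add]; rfl

lemma stdModule_smul_apply (a : ℂ) (b : Cherednik c) (p : StdSpace V) :
    stdModule hc ρ (a • b) p = a • stdModule hc ρ b p := by
  rw [map_smul]; rfl

lemma stdModule_sub_apply (a b : Cherednik c) (p : StdSpace V) :
    stdModule hc ρ (a - b) p = stdModule hc ρ a p - stdModule hc ρ b p := by
  rw [show a - b = a + (-1 : ℂ) • b by module, stdModule_add_apply, stdModule_smul_apply]
  module

lemma stdModule_one_apply (p : StdSpace V) : stdModule hc ρ 1 p = p := by
  rw [map_one]; rfl

lemma stdModule_sum_apply {ι : Type*} (s : Finset ι) (f : ι → Cherednik c) (p : StdSpace V) :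
    stdModule hc ρ (∑ i ∈ s, f i) p = ∑ i ∈ s, stdModule hc ρ (f i) p := by
  rw [map_sum, LinearMap.sum_apply]

lemma stdModule_hz_tmul (f : Poly) (v : V) :
    stdModule hc ρ (hz c) (f ⊗ₜ v) = (zPoly * f) ⊗ₜ v := by
  simp only [hz, stdModule_add_apply, stdModule_smul_apply, stdModule_hx, xOp_tmul, zPoly, add_mul,
    TensorProduct.add_tmul, smul_mul_assoc, TensorProduct.smul_tmul']

lemma stdModule_hzbar_tmul (f : Poly) (v : V) :
    stdModule hc ρ (hzbar c) (f ⊗ₜ v) = (zbarPoly * f) ⊗ₜ v := by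
  simp only [hzbar, stdModule_sub_apply, stdModule_smul_apply, stdModule_hx, xOp_tmul, zbarPoly,
    sub_mul, TensorProduct.sub_tmul, smul_mul_assoc, TensorProduct.smul_tmul']

lemma hz_mem_degreePart {k : ℕ} {p : StdSpace V} (hp : p ∈ degreePart V k) :
    stdModule hc ρ (hz c) p ∈ degreePart V (k + 1) := by
  simp only [hz, stdModule_add_apply, stdModule_smul_apply, stdModule_hx]
  exact add_mem (xOp_mem_degreePart 0 hp) (Submodule.smul_mem _ _ (xOp_mem_degreePart 1 hp))

lemma hzbar_mem_degreePart {k : ℕ} {p : StdSpace V} (hp : p ∈ degreePart V k) :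
    stdModule hc ρ (hzbar c) p ∈ degreePart V (k + 1) := by
  simp only [hzbar, stdModule_sub_apply, stdModule_smul_apply, stdModule_hx]
  exact sub_mem (xOp_mem_degreePart 0 hp) (Submodule.smul_mem _ _ (xOp_mem_degreePart 1 hp))

/-- The induction step for every statement about degrees: an operator on degree `k + 1` is computed
by commuting it past `z` or `z̄`. -/
lemma exists_of_mem_degreePart_succ {k : ℕ} {p : StdSpace V} (hp : p ∈ degreePart V (k + 1)) :
    ∃ q ∈ degreePart V k, ∃ r ∈ degreePart V k,
      p = stdModule hc ρ (hz c) q + stdModule hc ρ (hzbar c) r := by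
  obtain ⟨q, hq, r, hr, rfl⟩ := exists_xOp_of_mem_degreePart_succ hp
  have half {a : ℂ} {x : StdSpace V} (hx : x ∈ degreePart V k) : a • x ∈ degreePart V k :=
    Submodule.smul_mem _ _ hx
  -- Substitute `x = (z + z̄)/2` and `y = (z - z̄)/(2i)` in `xq + yr`.
  refine ⟨(1 / 2 : ℂ) • q - (1 / 2 * Complex.I) • r, sub_mem (half hq) (half hr),
    (1 / 2 : ℂ) • q + (1 / 2 * Complex.I) • r, add_mem (half hq) (half hr), ?_⟩
  simp only [hz, hzbar, stdModule_add_apply, stdModule_sub_apply, stdModule_smul_apply,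
    stdModule_hx]
  simp only [map_add, map_sub, map_smul]
  linear_combination (norm := module) Complex.I_sq • xOp V 1 r

lemma hg_one_tmul (g : DihedralGroup m) (v : V) :
    stdModule hc ρ (hg c g) (1 ⊗ₜ v) = 1 ⊗ₜ ρ g v := by
  rw [stdModule_hg, gOp_tmul, map_one]

lemma hxi_one_tmul (i : Fin 2) (v : V) : stdModule hc ρ (hxi c i) (1 ⊗ₜ v) = 0 := by
  rw [stdModule_hxi, dunklOp_one_tmul]

lemma hzeta_of_mem_degreePart_zero {p : StdSpace V} (hp : p ∈ degreePart V 0) :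
    stdModule hc ρ (hzeta c) p = 0 := by
  obtain ⟨v, rfl⟩ := mem_degreePart_zero.mp hp
  simp only [hzeta, stdModule_smul_apply, stdModule_sub_apply, hxi_one_tmul, smul_zero, sub_zero]

lemma hzetabar_of_mem_degreePart_zero {p : StdSpace V} (hp : p ∈ degreePart V 0) :
    stdModule hc ρ (hzetabar c) p = 0 := by
  obtain ⟨v, rfl⟩ := mem_degreePart_zero.mp hp
  simp only [hzetabar, stdModule_smul_apply, stdModule_add_apply, hxi_one_tmul, smul_zero,
    add_zero]

lemma hg_mem_degreePart (s : ZMod m) {k : ℕ} {p : StdSpace V} (hp : p ∈ degreePart V k) :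
    stdModule hc ρ (hg c (sr s)) p ∈ degreePart V k := by
  induction k generalizing p with
  | zero =>
    obtain ⟨v, rfl⟩ := mem_degreePart_zero.mp hp
    rw [hg_one_tmul]
    exact mem_degreePart_zero.mpr ⟨_, rfl⟩
  | succ k ih =>
    obtain ⟨q, hq, r, hr, rfl⟩ := exists_of_mem_degreePart_succ hc ρ hp
    rw [map_add, ← stdModule_mul_apply, ← stdModule_mul_apply, hg_mul_hz, hg_mul_hzbar]
    simp only [stdModule_smul_apply, stdModule_mul_apply]
    exact add_mem (Submodule.smul_mem _ _ (hzbar_mem_degreePart hc ρ (ih hq)))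
      (Submodule.smul_mem _ _ (hz_mem_degreePart hc ρ (ih hr)))

lemma sum_hg_mem_degreePart (a : ZMod m → ℂ) {k : ℕ} {p : StdSpace V}
    (hp : p ∈ degreePart V k) :
    stdModule hc ρ (∑ s : ZMod m, a s • hg c (sr s)) p ∈ degreePart V k := by
  rw [stdModule_sum_apply]
  refine sum_mem fun s _ => ?_
  rw [stdModule_smul_apply]
  exact Submodule.smul_mem _ _ (hg_mem_degreePart hc ρ s hp)

lemma sigma_mem_degreePart {k : ℕ} {p : StdSpace V} (hp : p ∈ degreePart V k) :
    stdModule hc ρ (sigma c) p ∈ degreePart V k :=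
  sum_hg_mem_degreePart hc ρ _ hp

/-- The commutation relations, together with the vanishing of the Dunkl operators on `1 ⊗ V`,
determine the degree; divided differences need not be examined. -/
lemma hzeta_hzetabar_mem_degreePart {k : ℕ} {p : StdSpace V} (hp : p ∈ degreePart V (k + 1)) :
    stdModule hc ρ (hzeta c) p ∈ degreePart V k ∧
      stdModule hc ρ (hzetabar c) p ∈ degreePart V k := by
  have pos {k : ℕ} {q : StdSpace V} (hq : q ∈ degreePart V k) :
      stdModule hc ρ (sigmaPos c) q ∈ degreePart V k := sum_hg_mem_degreePart hc ρ _ hq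
  have neg {k : ℕ} {q : StdSpace V} (hq : q ∈ degreePart V k) :
      stdModule hc ρ (sigmaNeg c) q ∈ degreePart V k := sum_hg_mem_degreePart hc ρ _ hq
  have sig {k : ℕ} {q : StdSpace V} (hq : q ∈ degreePart V k) :
      q - stdModule hc ρ (sigma c) q ∈ degreePart V k :=
    sub_mem hq (sigma_mem_degreePart hc ρ hq)
  -- The induction hypothesis enters only through the statement that a lowering operator followed by
  -- a raising one preserves degree `k`; in degree 0 this is trivial because the lowering operator
  -- vanishes.
  have step {k : ℕ} {q r : StdSpace V} (hq : q ∈ degreePart V k) (hr : r ∈ degreePart V k)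
      (h : ∀ x ∈ degreePart V k,
        stdModule hc ρ (hz c) (stdModule hc ρ (hzeta c) x) ∈ degreePart V k ∧
        stdModule hc ρ (hzbar c) (stdModule hc ρ (hzeta c) x) ∈ degreePart V k ∧
        stdModule hc ρ (hz c) (stdModule hc ρ (hzetabar c) x) ∈ degreePart V k ∧
        stdModule hc ρ (hzbar c) (stdModule hc ρ (hzetabar c) x) ∈ degreePart V k) :
      stdModule hc ρ (hzeta c) (stdModule hc ρ (hz c) q + stdModule hc ρ (hzbar c) r)
        ∈ degreePart V k ∧
      stdModule hc ρ (hzetabar c) (stdModule hc ρ (hz c) q + stdModule hc ρ (hzbar c) r)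
        ∈ degreePart V k := by
    rw [map_add, map_add]
    simp only [← stdModule_mul_apply, hzeta_mul_hz, hzeta_mul_hzbar, hzetabar_mul_hz,
      hzetabar_mul_hzbar]
    simp only [stdModule_mul_apply, stdModule_add_apply, stdModule_sub_apply, stdModule_one_apply]
    exact ⟨add_mem (add_mem (h q hq).1 (sig hq)) (add_mem (h r hr).2.1 (neg hr)),
      add_mem (add_mem (h q hq).2.2.1 (pos hq)) (add_mem (h r hr).2.2.2 (sig hr))⟩
  induction k generalizing p with
  | zero =>
    obtain ⟨q, hq, r, hr, rfl⟩ := exists_of_mem_degreePart_succ hc ρ hp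
    refine step hq hr fun x hx => ?_
    rw [hzeta_of_mem_degreePart_zero hc ρ hx, hzetabar_of_mem_degreePart_zero hc ρ hx]
    simp
  | succ k ih =>
    obtain ⟨q, hq, r, hr, rfl⟩ := exists_of_mem_degreePart_succ hc ρ hp
    refine step hq hr fun x hx => ?_
    exact ⟨hz_mem_degreePart hc ρ (ih hx).1, hzbar_mem_degreePart hc ρ (ih hx).1,
      hz_mem_degreePart hc ρ (ih hx).2, hzbar_mem_degreePart hc ρ (ih hx).2⟩

lemma Eplus_mem_degreePart {k : ℕ} {p : StdSpace V} (hp : p ∈ degreePart V k) :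
    stdModule hc ρ (Eplus c) p ∈ degreePart V (k + 2) := by
  rw [Eplus_eq, stdModule_smul_apply, stdModule_mul_apply]
  exact Submodule.smul_mem _ _ (hz_mem_degreePart hc ρ (hzbar_mem_degreePart hc ρ hp))

lemma Eminus_mem_degreePart {k : ℕ} {p : StdSpace V} (hp : p ∈ degreePart V (k + 2)) :
    stdModule hc ρ (Eminus c) p ∈ degreePart V k := by
  rw [Eminus_eq, stdModule_smul_apply, stdModule_mul_apply]
  exact Submodule.smul_mem _ _ (hzeta_hzetabar_mem_degreePart hc ρ
    (hzeta_hzetabar_mem_degreePart hc ρ hp).2).1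

lemma Eminus_of_mem_degreePart_of_lt {k : ℕ} (hk : k < 2) {p : StdSpace V}
    (hp : p ∈ degreePart V k) : stdModule hc ρ (Eminus c) p = 0 := by
  rw [Eminus_eq, stdModule_smul_apply, stdModule_mul_apply]
  interval_cases k
  · rw [hzetabar_of_mem_degreePart_zero hc ρ hp, map_zero, smul_zero]
  · rw [hzeta_of_mem_degreePart_zero hc ρ (hzeta_hzetabar_mem_degreePart hc ρ hp).2, smul_zero]

lemma Z0_mem_degreePart {k : ℕ} {p : StdSpace V} (hp : p ∈ degreePart V k) :
    stdModule hc ρ (Z0 c) p ∈ degreePart V k := by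
  rw [Z0, stdModule_sub_apply, stdModule_mul_apply, stdModule_mul_apply]
  cases k with
  | zero =>
    rw [hzeta_of_mem_degreePart_zero hc ρ hp, hzetabar_of_mem_degreePart_zero hc ρ hp]
    simp
  | succ k =>
    obtain ⟨h1, h2⟩ := hzeta_hzetabar_mem_degreePart hc ρ hp
    exact sub_mem (hzbar_mem_degreePart hc ρ h2) (hz_mem_degreePart hc ρ h1)

lemma zOp_apply (ε : ℝ) (p : StdSpace V) : zOp hc ρ ε p
    = stdModule hc ρ (Z0 c) p + (ε : ℂ) • stdModule hc ρ (sigma c) p := by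
  rw [zOp, stdModule_add_apply, stdModule_smul_apply]

lemma zOp_mem_degreePart (ε : ℝ) {k : ℕ} {p : StdSpace V} (hp : p ∈ degreePart V k) :
    zOp hc ρ ε p ∈ degreePart V k := by
  rw [zOp_apply]
  exact add_mem (Z0_mem_degreePart hc ρ hp)
    (Submodule.smul_mem _ _ (sigma_mem_degreePart hc ρ hp))

lemma zOp_Eplus_pow (ε : ℝ) (j : ℕ) (p : StdSpace V) :
    zOp hc ρ ε (stdModule hc ρ (Eplus c ^ j) p)
      = stdModule hc ρ (Eplus c ^ j) (zOp hc ρ ε p) := by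
  have h : Commute (Z0 c + (ε : ℂ) • sigma c) (Eplus c) :=
    Commute.add_left (Z0_mul_Eplus c) (Commute.smul_left (sigma_mul_Eplus c) _)
  rw [zOp, ← stdModule_mul_apply, ← stdModule_mul_apply, (h.pow_right j).eq]

lemma zOp_proj (ε N : ℝ) (k : ℕ) (p : StdSpace V) :
    zOp hc ρ ε (proj hc ρ N k p) = proj hc ρ N k (zOp hc ρ ε p) := by
  have h1 : Commute (Z0 c + (ε : ℂ) • sigma c) (Eplus c) :=
    Commute.add_left (Z0_mul_Eplus c) (Commute.smul_left (sigma_mul_Eplus c) _)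
  have h2 : Commute (Z0 c + (ε : ℂ) • sigma c) (Eminus c) :=
    Commute.add_left (Z0_mul_Eminus c) (Commute.smul_left (sigma_mul_Eminus c) _)
  simp only [proj, LinearMap.sum_apply, LinearMap.smul_apply, map_sum, map_smul, zOp]
  refine Finset.sum_congr rfl fun j _ => ?_
  rw [← stdModule_mul_apply, ← stdModule_mul_apply,
    ((h1.pow_right j).mul_right (h2.pow_right j)).eq]

lemma sigma_one_tmul {N : ℝ} (hN : ∀ v : V, ∑ j : ZMod m, (c j : ℂ) • ρ (sr j) v = (N : ℂ) • v)
    (v : V) : stdModule hc ρ (sigma c) (1 ⊗ₜ v) = (N : ℂ) • (1 ⊗ₜ[ℂ] v) := by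
  rw [sigma, stdModule_sum_apply]
  simp only [stdModule_smul_apply, hg_one_tmul]
  rw [← TensorProduct.tmul_smul, ← hN, TensorProduct.tmul_sum]
  simp only [TensorProduct.tmul_smul]

/-- The element `euler - σ` is `-N` on `1 ⊗ V`, and each factor `z` or `z̄` raises it by one. -/
lemma euler_apply {N : ℝ}
    (hN : ∀ v : V, ∑ j : ZMod m, (c j : ℂ) • ρ (sr j) v = (N : ℂ) • v)
    {k : ℕ} {p : StdSpace V} (hp : p ∈ degreePart V k) :
    stdModule hc ρ (euler c) p = ((k - N : ℝ) : ℂ) • p + stdModule hc ρ (sigma c) p := by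
  suffices h : stdModule hc ρ (euler c - sigma c) p = ((k - N : ℝ) : ℂ) • p by
    rw [stdModule_sub_apply, sub_eq_iff_eq_add] at h
    exact h
  induction k generalizing p with
  | zero =>
    obtain ⟨v, rfl⟩ := mem_degreePart_zero.mp hp
    rw [stdModule_sub_apply, euler, stdModule_add_apply, stdModule_mul_apply, stdModule_mul_apply,
      hzeta_of_mem_degreePart_zero hc ρ hp, hzetabar_of_mem_degreePart_zero hc ρ hp,
      sigma_one_tmul hc ρ hN]
    push_cast
    simp only [map_zero]
    module
  | succ k ih =>
    obtain ⟨q, hq, r, hr, rfl⟩ := exists_of_mem_degreePart_succ hc ρ hp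
    rw [map_add, ← stdModule_mul_apply, ← stdModule_mul_apply, euler_sub_sigma_mul_hz,
      euler_sub_sigma_mul_hzbar]
    simp only [stdModule_add_apply, stdModule_mul_apply, ih hq, ih hr, map_smul]
    push_cast
    module

end Grading

/-! ## The projection onto the harmonics -/

section Projection

/-- The coefficients of `Proj_k`. -/
def projCoeff (N : ℝ) (k j : ℕ) : ℝ :=
  (-1) ^ j / ((j.factorial : ℝ) * (ascPochhammer ℝ j).eval (N - k + 1))

/-- Every factor `N - k + 1 + i` with `i + 1 ≤ k / 2` is negative, as `N < 1` and `i + 2 ≤ k`. -/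
lemma ascPochhammer_eval_ne_zero {N : ℝ} (hN : N < 1) {k j : ℕ} (hj : j ≤ k / 2) :
    (ascPochhammer ℝ j).eval (N - k + 1) ≠ 0 := by
  induction j with
  | zero => simp
  | succ j ih =>
    rw [ascPochhammer_succ_eval]
    refine mul_ne_zero (ih (by omega)) (ne_of_lt ?_)
    have : ((j + 2 : ℕ) : ℝ) ≤ (k : ℝ) := by exact_mod_cast (by omega : j + 2 ≤ k)
    push_cast at this
    linarith

lemma projCoeff_zero (N : ℝ) (k : ℕ) : projCoeff N k 0 = 1 := by simp [projCoeff]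

/-- The recurrence that makes `Proj_k` telescope: `(j + 1)(k - N - (j + 1))` is the factor produced
when `E_-` passes `E_+^(j+1)` on degree `k - 2(j + 1)`. -/
lemma projCoeff_succ {N : ℝ} (hN : N < 1) {k j : ℕ} (hj : j + 1 ≤ k / 2) :
    projCoeff N k (j + 1) * (((j : ℝ) + 1) * (k - N - (j + 1))) = projCoeff N k j := by
  have h := ascPochhammer_eval_ne_zero hN hj
  rw [ascPochhammer_succ_eval] at h
  have h1 := left_ne_zero_of_mul h
  have h2 := right_ne_zero_of_mul h
  have h3 : (j.factorial : ℝ) ≠ 0 := by exact_mod_cast j.factorial_ne_zero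
  have h4 : (j : ℝ) + 1 ≠ 0 := by positivity
  rw [projCoeff, projCoeff, ascPochhammer_succ_eval, Nat.factorial_succ, pow_succ]
  push_cast
  field_simp
  ring

variable {m : ℕ} [NeZero m] {c : ZMod m → ℝ} {V : Type*} [AddCommGroup V] [Module ℂ V]
  (hc : IsParameter c) (ρ : Representation ℂ (DihedralGroup m) V)

lemma proj_apply (N : ℝ) (k : ℕ) (p : StdSpace V) : proj hc ρ N k p =
    ∑ j ∈ Finset.range (k / 2 + 1), (projCoeff N k j : ℂ) •
      stdModule hc ρ (Eplus c ^ j) (stdModule hc ρ (Eminus c ^ j) p) := by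
  simp only [proj, LinearMap.sum_apply, LinearMap.smul_apply, stdModule_mul_apply, projCoeff]

lemma stdModule_pow_succ (a : Cherednik c) (j : ℕ) (p : StdSpace V) :
    stdModule hc ρ (a ^ (j + 1)) p = stdModule hc ρ (a ^ j) (stdModule hc ρ a p) := by
  rw [pow_succ, stdModule_mul_apply]

lemma stdModule_pow_succ' (a : Cherednik c) (j : ℕ) (p : StdSpace V) :
    stdModule hc ρ (a ^ (j + 1)) p = stdModule hc ρ a (stdModule hc ρ (a ^ j) p) := by
  rw [pow_succ', stdModule_mul_apply]

lemma Eplus_pow_mem_degreePart (j : ℕ) {k : ℕ} {p : StdSpace V} (hp : p ∈ degreePart V k) :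
    stdModule hc ρ (Eplus c ^ j) p ∈ degreePart V (k + 2 * j) := by
  induction j with
  | zero => simpa [stdModule_one_apply] using hp
  | succ j ih =>
    rw [stdModule_pow_succ']
    exact Eplus_mem_degreePart hc ρ ih

lemma Eminus_pow_mem_degreePart (j : ℕ) {k : ℕ} {p : StdSpace V}
    (hp : p ∈ degreePart V (k + 2 * j)) : stdModule hc ρ (Eminus c ^ j) p ∈ degreePart V k := by
  induction j generalizing p with
  | zero => simpa [stdModule_one_apply] using hp
  | succ j ih =>
    rw [stdModule_pow_succ]
    exact ih (Eminus_mem_degreePart hc ρ hp)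

lemma Eminus_pow_eq_zero {j k : ℕ} (hjk : k < 2 * j) {p : StdSpace V}
    (hp : p ∈ degreePart V k) : stdModule hc ρ (Eminus c ^ j) p = 0 := by
  induction j generalizing p k with
  | zero => omega
  | succ j ih =>
    rw [stdModule_pow_succ]
    rcases lt_or_ge k 2 with hk | hk
    · rw [Eminus_of_mem_degreePart_of_lt hc ρ hk hp, map_zero]
    · obtain ⟨l, rfl⟩ := Nat.exists_eq_add_of_le' hk
      exact ih (by omega) (Eminus_mem_degreePart hc ρ hp)

variable {N : ℝ} (hN : ∀ v : V, ∑ j : ZMod m, (c j : ℂ) • ρ (sr j) v = (N : ℂ) • v)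

include hN

lemma Eminus_Eplus {l : ℕ} {q : StdSpace V} (hq : q ∈ degreePart V l) :
    stdModule hc ρ (Eminus c) (stdModule hc ρ (Eplus c) q)
      = stdModule hc ρ (Eplus c) (stdModule hc ρ (Eminus c) q) - ((l - N + 1 : ℝ) : ℂ) • q := by
  rw [← stdModule_mul_apply, Eminus_mul_Eplus, stdModule_sub_apply, stdModule_add_apply,
    stdModule_sub_apply, stdModule_mul_apply, euler_apply hc ρ hN hq, stdModule_one_apply]
  push_cast
  module

/-- The coefficient is the sum of the weights `l + 2i - N + 1` for `0 ≤ i ≤ j`. -/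
lemma Eminus_Eplus_pow (j : ℕ) {l : ℕ} {q : StdSpace V} (hq : q ∈ degreePart V l) :
    stdModule hc ρ (Eminus c) (stdModule hc ρ (Eplus c ^ (j + 1)) q)
      = stdModule hc ρ (Eplus c ^ (j + 1)) (stdModule hc ρ (Eminus c) q)
        - (((j + 1) * (l - N + (j + 1)) : ℝ) : ℂ) • stdModule hc ρ (Eplus c ^ j) q := by
  induction j generalizing l q with
  | zero =>
    simp only [zero_add, pow_one, pow_zero, stdModule_one_apply]
    rw [Eminus_Eplus hc ρ hN hq]
    push_cast
    module
  | succ j ih =>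
    rw [stdModule_pow_succ, ih (Eplus_mem_degreePart hc ρ hq), Eminus_Eplus hc ρ hN hq, map_sub,
      map_smul, ← stdModule_pow_succ, ← stdModule_pow_succ]
    push_cast
    module

/-- Mirror image of `Eminus_Eplus_pow`: now the weights `l - 2i - N + 1` decrease as `E_-` lowers
the degree. -/
lemma Eminus_pow_Eplus (j : ℕ) {l : ℕ} {q : StdSpace V} (hq : q ∈ degreePart V l) :
    stdModule hc ρ (Eminus c ^ (j + 1)) (stdModule hc ρ (Eplus c) q)
      = stdModule hc ρ (Eplus c) (stdModule hc ρ (Eminus c ^ (j + 1)) q)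
        - (((j + 1) * (l + 2 - N - (j + 1)) : ℝ) : ℂ) • stdModule hc ρ (Eminus c ^ j) q := by
  induction j generalizing l q with
  | zero =>
    simp only [zero_add, pow_one, pow_zero, stdModule_one_apply]
    rw [Eminus_Eplus hc ρ hN hq]
    push_cast
    module
  | succ j ih =>
    rw [stdModule_pow_succ, Eminus_Eplus hc ρ hN hq, map_sub, map_smul]
    -- Below degree 2 there is no degree `l - 2` for the induction hypothesis, but then every term
    -- vanishes.
    rcases lt_or_ge l 2 with hl | hl
    · have h1 : stdModule hc ρ (Eminus c ^ (j + 1)) q = 0 :=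
        Eminus_pow_eq_zero hc ρ (by omega) hq
      have h2 : stdModule hc ρ (Eminus c ^ (j + 1 + 1)) q = 0 :=
        Eminus_pow_eq_zero hc ρ (by omega) hq
      rw [h1, h2, Eminus_of_mem_degreePart_of_lt hc ρ hl hq]
      simp
    · obtain ⟨l, rfl⟩ := Nat.exists_eq_add_of_le' hl
      rw [ih (Eminus_mem_degreePart hc ρ hq), ← stdModule_pow_succ, ← stdModule_pow_succ]
      push_cast
      module

lemma Eminus_proj_term (hN1 : N < 1) {k j : ℕ} (hj : j + 1 ≤ k / 2) {p : StdSpace V}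
    (hp : p ∈ degreePart V k) :
    stdModule hc ρ (Eminus c) ((projCoeff N k (j + 1) : ℂ) •
        stdModule hc ρ (Eplus c ^ (j + 1)) (stdModule hc ρ (Eminus c ^ (j + 1)) p))
      = (projCoeff N k (j + 1) : ℂ) •
          stdModule hc ρ (Eplus c ^ (j + 1)) (stdModule hc ρ (Eminus c ^ (j + 1 + 1)) p)
        - (projCoeff N k j : ℂ) •
          stdModule hc ρ (Eplus c ^ j) (stdModule hc ρ (Eminus c ^ (j + 1)) p) := by
  obtain ⟨l, hl⟩ := Nat.exists_eq_add_of_le' (by omega : 2 * (j + 1) ≤ k)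
  subst hl
  rw [map_smul, Eminus_Eplus_pow hc ρ hN j (Eminus_pow_mem_degreePart hc ρ _ hp),
    ← projCoeff_succ hN1 hj, ← stdModule_pow_succ']
  push_cast
  module

lemma proj_mem_harmonics (hN1 : N < 1) {k : ℕ} {p : StdSpace V} (hp : p ∈ degreePart V k) :
    proj hc ρ N k p ∈ harmonics hc ρ k := by
  refine ⟨?_, ?_⟩
  · rw [proj_apply]
    refine sum_mem fun j hj => Submodule.smul_mem _ _ ?_
    obtain ⟨l, hl⟩ := Nat.exists_eq_add_of_le'
      (by rw [Finset.mem_range] at hj; omega : 2 * j ≤ k)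
    subst hl
    exact Eplus_pow_mem_degreePart hc ρ j (Eminus_pow_mem_degreePart hc ρ j hp)
  -- By `Eminus_proj_term` the partial sums telescope to one boundary term. At `t = k / 2` it
  -- contains `E_-^(k/2+1)`, which lowers below degree 0.
  · have key : ∀ t ≤ k / 2, stdModule hc ρ (Eminus c) (∑ j ∈ Finset.range (t + 1),
        (projCoeff N k j : ℂ) •
          stdModule hc ρ (Eplus c ^ j) (stdModule hc ρ (Eminus c ^ j) p))
        = (projCoeff N k t : ℂ) •
          stdModule hc ρ (Eplus c ^ t) (stdModule hc ρ (Eminus c ^ (t + 1)) p) := by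
      intro t ht
      induction t with
      | zero => simp
      | succ t ih =>
        rw [Finset.sum_range_succ, map_add, ih (by omega),
          Eminus_proj_term hc ρ hN hN1 ht hp]
        abel
    rw [SetLike.mem_coe, LinearMap.mem_ker, proj_apply, key _ le_rfl,
      Eminus_pow_eq_zero hc ρ (by omega) hp]
    simp

omit hN in
lemma proj_of_mem_harmonics {k : ℕ} {p : StdSpace V} (hp : p ∈ harmonics hc ρ k) :
    proj hc ρ N k p = p := by
  rw [proj_apply, Finset.sum_range_succ', Finset.sum_eq_zero]
  · simp [projCoeff_zero]
  · intro j _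
    rw [stdModule_pow_succ hc ρ (Eminus c), LinearMap.mem_ker.mp hp.2]
    simp

lemma proj_Eplus (hN1 : N < 1) {l : ℕ} {q : StdSpace V} (hq : q ∈ degreePart V l) :
    proj hc ρ N (l + 2) (stdModule hc ρ (Eplus c) q) = 0 := by
  -- The same telescoping with `E_+` applied first; the boundary term at `t = (l + 2) / 2` contains
  -- too high a power of `E_-` for degree `l`.
  have key : ∀ t ≤ (l + 2) / 2, ∑ j ∈ Finset.range (t + 1), (projCoeff N (l + 2) j : ℂ) •
        stdModule hc ρ (Eplus c ^ j)
          (stdModule hc ρ (Eminus c ^ j) (stdModule hc ρ (Eplus c) q))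
      = (projCoeff N (l + 2) t : ℂ) •
        stdModule hc ρ (Eplus c ^ (t + 1)) (stdModule hc ρ (Eminus c ^ t) q) := by
    intro t ht
    induction t with
    | zero => simp
    | succ t ih =>
      rw [Finset.sum_range_succ, ih (by omega), Eminus_pow_Eplus hc ρ hN t hq,
        ← projCoeff_succ hN1 ht, map_sub, map_smul, ← stdModule_pow_succ]
      push_cast
      module
  rw [proj_apply, key _ le_rfl, Eminus_pow_eq_zero hc ρ (by omega) hq]
  simp

omit hN in
-- The term `j = 0` of `Proj` is the identity and every other term begins with `E_+`.
lemma exists_sub_proj {k : ℕ} {p : StdSpace V} (hp : p ∈ degreePart V (k + 2)) :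
    ∃ q ∈ degreePart V k, p = proj hc ρ N (k + 2) p + stdModule hc ρ (Eplus c) q := by
  refine ⟨-∑ j ∈ Finset.range (k / 2 + 1), (projCoeff N (k + 2) (j + 1) : ℂ) •
      stdModule hc ρ (Eplus c ^ j) (stdModule hc ρ (Eminus c ^ (j + 1)) p), ?_, ?_⟩
  · refine neg_mem (sum_mem fun j hj => Submodule.smul_mem _ _ ?_)
    obtain ⟨l, hl⟩ := Nat.exists_eq_add_of_le'
      (by rw [Finset.mem_range] at hj; omega : 2 * j ≤ k)
    subst hl
    refine Eplus_pow_mem_degreePart hc ρ j ?_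
    exact Eminus_pow_mem_degreePart hc ρ (j + 1) hp
  · rw [proj_apply, show (k + 2) / 2 + 1 = k / 2 + 1 + 1 by omega, Finset.sum_range_succ']
    simp only [map_neg, map_sum, map_smul, ← stdModule_pow_succ', projCoeff_zero, pow_zero,
      stdModule_one_apply, Complex.ofReal_one, one_smul]
    abel

omit hN in
lemma proj_of_lt_two {k : ℕ} (hk : k < 2) (p : StdSpace V) : proj hc ρ N k p = p := by
  rw [proj_apply, Nat.div_eq_of_lt hk]
  simp [projCoeff_zero]

/-! ### `Z_0` modulo the image of `E_+` -/

/-- Write `Z_0 = 2 z̄ζ̄ - euler`. Moving `ζ̄` past `z` gives `z̄ζ̄z = 2E_+ ζ̄ + σz`, so modulo the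
image of `E_+` the operator is `2σ - euler`, and `euler` is `k + 1 - N + σ` in this degree. -/
lemma proj_Z0_hz (hN1 : N < 1) {k : ℕ} {p : StdSpace V} (hp : p ∈ degreePart V k) :
    proj hc ρ N (k + 1) (stdModule hc ρ (Z0 c) (stdModule hc ρ (hz c) p))
      = proj hc ρ N (k + 1) (-((((k + 1 : ℕ) : ℝ) - N : ℝ) : ℂ) • stdModule hc ρ (hz c) p
        + stdModule hc ρ (sigma c) (stdModule hc ρ (hz c) p)) := by
  have e : Z0 c * hz c = (4 : ℂ) • (Eplus c * hzetabar c) + (2 : ℂ) • (sigma c * hz c)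
      - euler c * hz c := by
    have h : hzbar c * hzetabar c * hz c
        = (2 : ℂ) • (Eplus c * hzetabar c) + sigma c * hz c := by
      rw [Eplus_eq, mul_assoc, hzetabar_mul_hz, mul_add, ← sigma_mul_hz, ← mul_assoc,
        ← hz_mul_hzbar, smul_mul_assoc]
      module
    rw [Z0, euler, sub_mul, add_mul, h]
    module
  have h0 : proj hc ρ N (k + 1) (stdModule hc ρ (Eplus c) (stdModule hc ρ (hzetabar c) p)) = 0 := by
    cases k with
    | zero => rw [hzetabar_of_mem_degreePart_zero hc ρ hp]; simp
    | succ k => exact proj_Eplus hc ρ hN hN1 (hzeta_hzetabar_mem_degreePart hc ρ hp).2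
  rw [← stdModule_mul_apply, e, stdModule_sub_apply, stdModule_add_apply, stdModule_smul_apply,
    stdModule_smul_apply]
  simp only [stdModule_mul_apply]
  rw [euler_apply hc ρ hN (hz_mem_degreePart hc ρ hp)]
  simp only [map_add, map_sub, map_smul, h0]
  module

/-- The conjugate computation, starting from `Z_0 = euler - 2 zζ`; the sign is reversed. -/
lemma proj_Z0_hzbar (hN1 : N < 1) {k : ℕ} {p : StdSpace V} (hp : p ∈ degreePart V k) :
    proj hc ρ N (k + 1) (stdModule hc ρ (Z0 c) (stdModule hc ρ (hzbar c) p))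
      = proj hc ρ N (k + 1) (((((k + 1 : ℕ) : ℝ) - N : ℝ) : ℂ) • stdModule hc ρ (hzbar c) p
        - stdModule hc ρ (sigma c) (stdModule hc ρ (hzbar c) p)) := by
  have e : Z0 c * hzbar c = euler c * hzbar c - (4 : ℂ) • (Eplus c * hzeta c)
      - (2 : ℂ) • (sigma c * hzbar c) := by
    have h : hz c * hzeta c * hzbar c
        = (2 : ℂ) • (Eplus c * hzeta c) + sigma c * hzbar c := by
      rw [Eplus_eq, mul_assoc, hzeta_mul_hzbar, mul_add, ← sigma_mul_hzbar, ← mul_assoc,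
        smul_mul_assoc]
      module
    rw [Z0, euler, sub_mul, add_mul, h]
    module
  have h0 : proj hc ρ N (k + 1) (stdModule hc ρ (Eplus c) (stdModule hc ρ (hzeta c) p)) = 0 := by
    cases k with
    | zero => rw [hzeta_of_mem_degreePart_zero hc ρ hp]; simp
    | succ k => exact proj_Eplus hc ρ hN hN1 (hzeta_hzetabar_mem_degreePart hc ρ hp).1
  rw [← stdModule_mul_apply, e, stdModule_sub_apply, stdModule_sub_apply, stdModule_smul_apply,
    stdModule_smul_apply]
  simp only [stdModule_mul_apply]
  rw [euler_apply hc ρ hN (hzbar_mem_degreePart hc ρ hp)]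
  simp only [map_add, map_sub, map_smul, h0]
  module

end Projection

/-! ## Top components -/

section TopComponents

variable {m : ℕ} [NeZero m] {c : ZMod m → ℝ} {V : Type*} [AddCommGroup V] [Module ℂ V]
  (hc : IsParameter c) (ρ : Representation ℂ (DihedralGroup m) V)

lemma zPoly_isHomogeneous : zPoly.IsHomogeneous 1 := by
  rw [zPoly, smul_eq_C_mul]
  exact (isHomogeneous_X ℂ 0).add (isHomogeneous_C_mul_X _ 1)

lemma zbarPoly_isHomogeneous : zbarPoly.IsHomogeneous 1 := by
  rw [zbarPoly, smul_eq_C_mul]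
  exact (isHomogeneous_X ℂ 0).sub (isHomogeneous_C_mul_X _ 1)

lemma zPoly_pow_tmul_mem (k : ℕ) (v : V) : (zPoly ^ k) ⊗ₜ[ℂ] v ∈ degreePart V k :=
  Submodule.subset_span ⟨_, v, by simpa using zPoly_isHomogeneous.pow k, rfl⟩

lemma zbarPoly_pow_tmul_mem (k : ℕ) (v : V) : (zbarPoly ^ k) ⊗ₜ[ℂ] v ∈ degreePart V k :=
  Submodule.subset_span ⟨_, v, by simpa using zbarPoly_isHomogeneous.pow k, rfl⟩

lemma Eplus_apply (p : StdSpace V) : stdModule hc ρ (Eplus c) p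
    = (1 / 2 : ℂ) • stdModule hc ρ (hz c) (stdModule hc ρ (hzbar c) p) := by
  rw [Eplus_eq, stdModule_smul_apply, stdModule_mul_apply]

lemma hz_hzbar_apply (p : StdSpace V) :
    stdModule hc ρ (hz c) (stdModule hc ρ (hzbar c) p)
      = (2 : ℂ) • stdModule hc ρ (Eplus c) p := by
  rw [Eplus_apply]; module

lemma hzbar_hz_apply (p : StdSpace V) :
    stdModule hc ρ (hzbar c) (stdModule hc ρ (hz c) p)
      = (2 : ℂ) • stdModule hc ρ (Eplus c) p := by
  rw [← hz_hzbar_apply, ← stdModule_mul_apply, ← hz_mul_hzbar, stdModule_mul_apply]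

lemma hz_Eplus (p : StdSpace V) : stdModule hc ρ (hz c) (stdModule hc ρ (Eplus c) p)
    = stdModule hc ρ (Eplus c) (stdModule hc ρ (hz c) p) := by
  rw [Eplus_apply, Eplus_apply, map_smul, hzbar_hz_apply, hz_hzbar_apply]

lemma hzbar_Eplus (p : StdSpace V) : stdModule hc ρ (hzbar c) (stdModule hc ρ (Eplus c) p)
    = stdModule hc ρ (Eplus c) (stdModule hc ρ (hzbar c) p) := by
  rw [Eplus_apply, Eplus_apply, map_smul, hzbar_hz_apply, hz_hzbar_apply, Eplus_apply]

/-- Any monomial containing both `z` and `z̄` is a multiple of `E_+`. The alternative `q = 0` is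
needed in degree 1, where there is no degree two below. -/
lemma exists_top_components (k : ℕ) {p : StdSpace V} (hp : p ∈ degreePart V (k + 1)) :
    ∃ (v w : V) (q : StdSpace V), p = (zPoly ^ (k + 1)) ⊗ₜ[ℂ] v + (zbarPoly ^ (k + 1)) ⊗ₜ[ℂ] w
      + stdModule hc ρ (Eplus c) q ∧ (q = 0 ∨ ∃ l, k = l + 1 ∧ q ∈ degreePart V l) := by
  induction k generalizing p with
  | zero =>
    obtain ⟨q, hq, r, hr, rfl⟩ := exists_of_mem_degreePart_succ hc ρ hp
    obtain ⟨v, rfl⟩ := mem_degreePart_zero.mp hq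
    obtain ⟨w, rfl⟩ := mem_degreePart_zero.mp hr
    exact ⟨v, w, 0, by simp [stdModule_hz_tmul, stdModule_hzbar_tmul], Or.inl rfl⟩
  | succ k ih =>
    obtain ⟨a, ha, b, hb, rfl⟩ := exists_of_mem_degreePart_succ hc ρ hp
    obtain ⟨v, w, q, rfl, hq⟩ := ih ha
    obtain ⟨v', w', q', rfl, hq'⟩ := ih hb
    have hz_mem : ∀ q : StdSpace V, (q = 0 ∨ ∃ l, k = l + 1 ∧ q ∈ degreePart V l) →
        stdModule hc ρ (hz c) q ∈ degreePart V k ∧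
        stdModule hc ρ (hzbar c) q ∈ degreePart V k := by
      rintro q (rfl | ⟨l, rfl, hl⟩)
      · simp
      · exact ⟨hz_mem_degreePart hc ρ hl, hzbar_mem_degreePart hc ρ hl⟩
    -- The pure powers `z · z^(k+1)` and `z̄ · z̄^(k+1)` remain; the mixed products `z · z̄^(k+1)`
    -- and `z̄ · z^(k+1)` are `2E_+` times a `k`-th power and join the remainder.
    refine ⟨v, w', (2 : ℂ) • (zbarPoly ^ k) ⊗ₜ[ℂ] w + (2 : ℂ) • (zPoly ^ k) ⊗ₜ[ℂ] v'
      + stdModule hc ρ (hz c) q + stdModule hc ρ (hzbar c) q', ?_, Or.inr ⟨k, rfl, ?_⟩⟩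
    · have e1 : stdModule hc ρ (hz c) ((zbarPoly ^ (k + 1)) ⊗ₜ[ℂ] w)
          = (2 : ℂ) • stdModule hc ρ (Eplus c) ((zbarPoly ^ k) ⊗ₜ[ℂ] w) := by
        rw [pow_succ', ← stdModule_hzbar_tmul hc ρ, hz_hzbar_apply]
      have e2 : stdModule hc ρ (hzbar c) ((zPoly ^ (k + 1)) ⊗ₜ[ℂ] v')
          = (2 : ℂ) • stdModule hc ρ (Eplus c) ((zPoly ^ k) ⊗ₜ[ℂ] v') := by
        rw [pow_succ', ← stdModule_hz_tmul hc ρ, hzbar_hz_apply]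
      simp only [map_add, map_smul, e1, e2, hz_Eplus, hzbar_Eplus]
      rw [stdModule_hz_tmul, stdModule_hzbar_tmul, ← pow_succ', ← pow_succ']
      abel
    · exact add_mem (add_mem (add_mem
        (Submodule.smul_mem _ _ (zbarPoly_pow_tmul_mem k w))
        (Submodule.smul_mem _ _ (zPoly_pow_tmul_mem k v'))) (hz_mem q hq).1) (hz_mem q' hq').2

/-- Evaluation of polynomials at the point `(1, t)`. -/
def evalOneAt (V : Type*) [AddCommGroup V] [Module ℂ V] (t : ℂ) : StdSpace V →ₗ[ℂ] V :=
  (TensorProduct.lid ℂ V).toLinearMap ∘ₗ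
    TensorProduct.map (aeval ![1, t] : Poly →ₐ[ℂ] ℂ).toLinearMap LinearMap.id

lemma evalOneAt_tmul (t : ℂ) (f : Poly) (v : V) :
    evalOneAt V t (f ⊗ₜ v) = (aeval ![1, t] f : ℂ) • v := by
  simp [evalOneAt]

lemma evalOneAt_zPoly (t : ℂ) : (aeval ![1, t] zPoly : ℂ) = 1 + Complex.I * t := by
  rw [zPoly, map_add, map_smul]; simp

lemma evalOneAt_zbarPoly (t : ℂ) : (aeval ![1, t] zbarPoly : ℂ) = 1 - Complex.I * t := by
  rw [zbarPoly, map_sub, map_smul]; simp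

lemma Eplus_tmul (f : Poly) (v : V) : stdModule hc ρ (Eplus c) (f ⊗ₜ v)
    = (((1 / 2 : ℂ) • (zPoly * zbarPoly)) * f) ⊗ₜ v := by
  rw [Eplus_apply, stdModule_hzbar_tmul, stdModule_hz_tmul, TensorProduct.smul_tmul',
    smul_mul_assoc, mul_assoc]

lemma evalOneAt_Eplus {t : ℂ} (ht : t ^ 2 = -1) (q : StdSpace V) :
    evalOneAt V t (stdModule hc ρ (Eplus c) q) = 0 := by
  have h : (1 + Complex.I * t) * (1 - Complex.I * t) = 0 := by
    linear_combination -t ^ 2 * Complex.I_sq + ht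
  induction q using TensorProduct.induction_on with
  | zero => simp
  | tmul f v =>
    rw [Eplus_tmul, evalOneAt_tmul, map_mul, map_smul, map_mul, evalOneAt_zPoly,
      evalOneAt_zbarPoly, h]
    simp
  | add x y hx hy => rw [map_add, map_add, hx, hy, add_zero]

/-- Evaluate at the isotropic points `(1, ±i)`: `E_+` vanishes at both, while exactly one of `z`,
`z̄` vanishes at each and the other equals 2. -/
lemma top_components_eq_zero {k : ℕ} {v w : V} {q : StdSpace V}
    (h : (zPoly ^ (k + 1)) ⊗ₜ[ℂ] v + (zbarPoly ^ (k + 1)) ⊗ₜ[ℂ] w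
      = stdModule hc ρ (Eplus c) q) : v = 0 ∧ w = 0 := by
  have key (t : ℂ) (ht : t ^ 2 = -1) :
      (1 + Complex.I * t) ^ (k + 1) • v + (1 - Complex.I * t) ^ (k + 1) • w = 0 := by
    have := congrArg (evalOneAt V t) h
    rwa [evalOneAt_Eplus hc ρ ht, map_add, evalOneAt_tmul, evalOneAt_tmul, map_pow, map_pow,
      evalOneAt_zPoly, evalOneAt_zbarPoly] at this
  have h1 := key Complex.I Complex.I_sq
  have h2 := key (-Complex.I) (by simp)
  have n : (1 + 1 : ℂ) ^ (k + 1) ≠ 0 := pow_ne_zero _ (by norm_num)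
  constructor
  · simpa [n] using h2
  · simpa [n] using h1

/-- A vector killed by `Proj` lies in the image of `E_+`, so this reduces to
`top_components_eq_zero`. -/
lemma proj_top_components_eq_zero {N : ℝ} {k : ℕ} {v w : V}
    (h : proj hc ρ N (k + 1)
      ((zPoly ^ (k + 1)) ⊗ₜ[ℂ] v + (zbarPoly ^ (k + 1)) ⊗ₜ[ℂ] w) = 0) : v = 0 ∧ w = 0 := by
  cases k with
  | zero =>
    rw [proj_of_lt_two hc ρ (by norm_num)] at h
    exact top_components_eq_zero hc ρ (q := 0) (by rw [h, map_zero])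
  | succ k =>
    obtain ⟨q, -, hq⟩ := exists_sub_proj hc ρ (N := N)
      (add_mem (zPoly_pow_tmul_mem (k + 2) v) (zbarPoly_pow_tmul_mem (k + 2) w))
    rw [show k + 2 = k + 1 + 1 from rfl, h, zero_add] at hq
    exact top_components_eq_zero hc ρ hq

lemma exists_proj_top_components {N : ℝ}
    (hN : ∀ v : V, ∑ j : ZMod m, (c j : ℂ) • ρ (sr j) v = (N : ℂ) • v) (hN1 : N < 1) {k : ℕ}
    {p : StdSpace V} (hp : p ∈ harmonics hc ρ (k + 1)) :
    ∃ v w : V, p = proj hc ρ N (k + 1)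
      ((zPoly ^ (k + 1)) ⊗ₜ[ℂ] v + (zbarPoly ^ (k + 1)) ⊗ₜ[ℂ] w) := by
  obtain ⟨v, w, q, e, hq⟩ := exists_top_components hc ρ k hp.1
  refine ⟨v, w, ?_⟩
  have h0 : proj hc ρ N (k + 1) (stdModule hc ρ (Eplus c) q) = 0 := by
    rcases hq with rfl | ⟨l, rfl, hl⟩
    · simp
    · exact proj_Eplus hc ρ hN hN1 hl
  rw [← proj_of_mem_harmonics hc ρ (N := N) hp]
  conv_lhs => rw [e, map_add, h0, add_zero]

/-- `E_+` is multiplication by a nonzero element of an integral domain, and tensoring over a field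
preserves injectivity. -/
lemma Eplus_injective :
    Function.Injective (stdModule hc ρ (Eplus c) : Module.End ℂ (StdSpace V)) := by
  have hne : (1 / 2 : ℂ) • (zPoly * zbarPoly) ≠ 0 := by
    intro h
    have := congrArg (aeval ![1, 0] : Poly →ₐ[ℂ] ℂ) h
    rw [map_smul, map_mul, evalOneAt_zPoly, evalOneAt_zbarPoly] at this
    norm_num at this
  have e : (stdModule hc ρ (Eplus c) : Module.End ℂ (StdSpace V))
      = LinearMap.rTensor V (LinearMap.mulLeft ℂ ((1 / 2 : ℂ) • (zPoly * zbarPoly))) := by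
    apply TensorProduct.ext'
    intro f v
    rw [Eplus_tmul, LinearMap.rTensor_tmul, LinearMap.mulLeft_apply]
  rw [e]
  exact Module.Flat.rTensor_preserves_injective_linearMap _
    (mul_right_injective₀ hne)

end TopComponents

/-! ## Consequences of unitarity -/

section Unitarity

variable {m : ℕ} [NeZero m] {c : ZMod m → ℝ} {V : Type*} [AddCommGroup V] [Module ℂ V]
  {hc : IsParameter c} {ρ : Representation ℂ (DihedralGroup m) V}

/-- On a unitarisable module, eigenvalues of the Euler element in positive degree are positive. -/
lemma IsUnitarisableStd.euler_eigenvalue_pos (huni : IsUnitarisableStd hc ρ) {k : ℕ}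
    {p : StdSpace V} (hp : p ∈ degreePart V (k + 1)) (hp0 : p ≠ 0) {a : ℝ}
    (ha : stdModule hc ρ (euler c) p = (a : ℂ) • p) : 0 < a := by
  obtain ⟨β, -, pos, adj, -, -⟩ := huni
  have nonneg : ∀ q, 0 ≤ (β q q).re := by
    intro q
    by_cases hq : q = 0
    · simp [hq]
    · exact (pos q hq).le
  -- Contravariance turns the pairing of `∑ x_i ξ_i p` with `p` into a sum of squared norms of the
  -- `ξ_i p`.
  have e : (a : ℂ) * β p p = ∑ i, β (stdModule hc ρ (hxi c i) p) (stdModule hc ρ (hxi c i) p) := by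
    have := congrArg (fun q => β q p) ha
    simp only [map_smul, LinearMap.smul_apply, smul_eq_mul] at this
    rw [← this, euler_eq, stdModule_sum_apply, map_sum, LinearMap.sum_apply]
    exact Finset.sum_congr rfl fun i _ => by rw [stdModule_mul_apply, adj]
  have e' : a * (β p p).re
      = ∑ i, (β (stdModule hc ρ (hxi c i) p) (stdModule hc ρ (hxi c i) p)).re := by
    rw [← Complex.re_sum, ← e, Complex.re_ofReal_mul]
  have hβ := pos p hp0
  by_contra hneg
  push Not at hneg
  have hle : a * (β p p).re ≤ 0 := mul_nonpos_of_nonpos_of_nonneg hneg hβ.le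
  have hzero : ∀ i, stdModule hc ρ (hxi c i) p = 0 := by
    intro i
    by_contra hi
    have : 0 < ∑ i, (β (stdModule hc ρ (hxi c i) p) (stdModule hc ρ (hxi c i) p)).re :=
      Finset.sum_pos' (fun i _ => nonneg _) ⟨i, Finset.mem_univ i, pos _ hi⟩
    linarith
  -- In positive degree `p` is a combination of multiples of the coordinates, whose adjoints kill
  -- `p`; hence `p` would be orthogonal to itself.
  obtain ⟨q, -, r, -, hqr⟩ := exists_xOp_of_mem_degreePart_succ hp
  have : β p p = 0 := by
    have e := congrArg (fun x => β x p) hqr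
    simp only [map_add, LinearMap.add_apply] at e
    rw [e, ← stdModule_hx hc ρ, ← stdModule_hx hc ρ, adj, adj, hzero, hzero]
    simp
  rw [this] at hβ
  simp at hβ

variable {N : ℝ} (hN : ∀ v : V, ∑ j : ZMod m, (c j : ℂ) • ρ (sr j) v = (N : ℂ) • v)

include hN

lemma IsUnitarisableStd.sub_add_pos (huni : IsUnitarisableStd hc ρ) {k : ℕ}
    {p : StdSpace V} (hp : p ∈ degreePart V (k + 1)) (hp0 : p ≠ 0) {s : ℝ}
    (hs : stdModule hc ρ (sigma c) p = (s : ℂ) • p) : 0 < ((k + 1 : ℕ) : ℝ) - N + s := by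
  refine huni.euler_eigenvalue_pos hp hp0 ?_
  rw [euler_apply hc ρ hN hp, hs]
  push_cast
  module

omit hN in
lemma sigma_proj (k : ℕ) (p : StdSpace V) : stdModule hc ρ (sigma c) (proj hc ρ N k p)
    = proj hc ρ N k (stdModule hc ρ (sigma c) p) := by
  have h : Commute (sigma c) (Eplus c) := sigma_mul_Eplus c
  have h' : Commute (sigma c) (Eminus c) := sigma_mul_Eminus c
  simp only [proj, LinearMap.sum_apply, LinearMap.smul_apply, map_sum, map_smul]
  refine Finset.sum_congr rfl fun j _ => ?_
  rw [← stdModule_mul_apply, ← stdModule_mul_apply,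
    ((h.pow_right j).mul_right (h'.pow_right j)).eq]

/-- If `σ` exchanges the top components `z^k ⊗ v` and `z̄^k ⊗ w` up to the real factor `s`, and
`N < 1` as soon as `k > 1`, then `|s| < k - N`. -/
lemma IsUnitarisableStd.abs_sigma_lt (huni : IsUnitarisableStd hc ρ) {k : ℕ} (hk : k = 0 ∨ N < 1)
    {v w : V} (hw : w ≠ 0) {s : ℝ}
    (h1 : stdModule hc ρ (sigma c) ((zPoly ^ (k + 1)) ⊗ₜ v)
      = (s : ℂ) • (zbarPoly ^ (k + 1)) ⊗ₜ[ℂ] w)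
    (h2 : stdModule hc ρ (sigma c) ((zbarPoly ^ (k + 1)) ⊗ₜ w)
      = (s : ℂ) • (zPoly ^ (k + 1)) ⊗ₜ[ℂ] v) : |s| < ((k + 1 : ℕ) : ℝ) - N := by
  -- For `t = ±1`, the vector `z^(k+1) ⊗ v + t z̄^(k+1) ⊗ w` is an eigenvector of `σ` with
  -- eigenvalue `ts`, and so is its projection.
  have key : ∀ t : ℝ, t ^ 2 = 1 → 0 < ((k + 1 : ℕ) : ℝ) - N + t * s := by
    intro t ht
    have ht0 : t ≠ 0 := by rintro rfl; simp at ht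
    have htC : (t : ℂ) * t = 1 := by rw [← pow_two]; exact_mod_cast ht
    have hmem : (zPoly ^ (k + 1)) ⊗ₜ[ℂ] v + (zbarPoly ^ (k + 1)) ⊗ₜ[ℂ] ((t : ℂ) • w)
        ∈ degreePart V (k + 1) :=
      add_mem (zPoly_pow_tmul_mem _ _) (zbarPoly_pow_tmul_mem _ _)
    refine huni.sub_add_pos hN (p := proj hc ρ N (k + 1)
      ((zPoly ^ (k + 1)) ⊗ₜ[ℂ] v + (zbarPoly ^ (k + 1)) ⊗ₜ[ℂ] ((t : ℂ) • w))) ?_ ?_ ?_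
    -- In degree 1 the projection is the identity, so no bound on `N` is required; this case is what
    -- yields `N < 1` later.
    · rcases hk with rfl | hk
      · rwa [proj_of_lt_two hc ρ (by norm_num)]
      · exact (proj_mem_harmonics hc ρ hN hk hmem).1
    · intro h
      have := (proj_top_components_eq_zero hc ρ h).2
      simp [ht0, hw] at this
    · rw [sigma_proj, ← map_smul, map_add, TensorProduct.tmul_smul, map_smul, h1, h2]
      congr 1
      push_cast
      linear_combination (norm := module) (-s * htC) • (zbarPoly ^ (k + 1)) ⊗ₜ[ℂ] w
  have hp := key 1 (by norm_num)
  have hn := key (-1) (by norm_num)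
  rw [abs_lt]
  constructor <;> linarith

end Unitarity

/-- The set of eigenvalues of an operator on a submodule spanned by nonzero eigenvectors. -/
lemma setOf_eigenvalue_eq {K M ι : Type*} [Field K] [AddCommGroup M] [Module K M]
    (T : Module.End K M) (W : Submodule K M) (f : ι → M) (μ : ι → K)
    (hf : LinearIndependent K f) (hspan : Submodule.span K (Set.range f) = W)
    (hT : ∀ i, T (f i) = μ i • f i) :
    {a : K | ∃ p ∈ W, p ≠ 0 ∧ T p = a • p} = {a | ∃ i, a = μ i} := by
  ext a
  constructor
  · rintro ⟨p, hp, hp0, e⟩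
    rw [← hspan, ← Set.image_univ, Finsupp.mem_span_image_iff_linearCombination] at hp
    obtain ⟨l, -, rfl⟩ := hp
    by_contra hne
    simp only [Set.mem_ofPred_eq, not_exists] at hne
    have e2 : ∑ i ∈ l.support, (l i * (μ i - a)) • f i = 0 := by
      rw [Finsupp.linearCombination_apply, Finsupp.sum, map_sum, Finset.smul_sum,
        ← sub_eq_zero, ← Finset.sum_sub_distrib] at e
      rw [← e]
      refine Finset.sum_congr rfl fun i _ => ?_
      rw [map_smul, hT]
      module
    have e3 := linearIndependent_iff'.mp hf _ _ e2
    apply hp0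
    have : l = 0 := by
      ext i
      by_contra hi
      have := e3 i (Finsupp.mem_support_iff.mpr hi)
      rcases mul_eq_zero.mp this with h | h
      · exact hi h
      · exact hne i (sub_eq_zero.mp h).symm
    simp [this]
  · rintro ⟨i, rfl⟩
    exact ⟨f i, hspan ▸ Submodule.subset_span ⟨i, rfl⟩, hf.ne_zero i, hT i⟩

/-! ## Eigenvectors of `Z_0 + ε σ` -/

section Eigenvectors

variable {m : ℕ} [NeZero m] {c : ZMod m → ℝ} {V : Type*} [AddCommGroup V] [Module ℂ V]
  (hc : IsParameter c) (ρ : Representation ℂ (DihedralGroup m) V)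
  {N : ℝ} (hN : ∀ v : V, ∑ j : ZMod m, (c j : ℂ) • ρ (sr j) v = (N : ℂ) • v)

include hN

/-- One column of the 2 × 2 block of `Z_0 + ε σ`; the other is `zOp_proj_zbarPoly`. The `σ` inside
`Z_0` has opposite signs in the two columns, whence `1 + ε` here and `1 - ε` there. -/
lemma zOp_proj_zPoly (hN1 : N < 1) (ε : ℝ) {k : ℕ} {v w : V} {s : ℝ}
    (h1 : stdModule hc ρ (sigma c) ((zPoly ^ (k + 1)) ⊗ₜ v)
      = (s : ℂ) • (zbarPoly ^ (k + 1)) ⊗ₜ[ℂ] w) :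
    zOp hc ρ ε (proj hc ρ N (k + 1) ((zPoly ^ (k + 1)) ⊗ₜ v))
      = (-(((k + 1 : ℕ) : ℝ) - N : ℝ) : ℂ) • proj hc ρ N (k + 1) ((zPoly ^ (k + 1)) ⊗ₜ v)
        + ((s * (1 + ε) : ℝ) : ℂ) • proj hc ρ N (k + 1) ((zbarPoly ^ (k + 1)) ⊗ₜ w) := by
  have h := proj_Z0_hz hc ρ hN hN1 (zPoly_pow_tmul_mem k v)
  rw [stdModule_hz_tmul, ← pow_succ', h1] at h
  rw [zOp_proj, zOp_apply, map_add, h, h1]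
  simp only [map_add, map_smul]
  push_cast
  module

lemma zOp_proj_zbarPoly (hN1 : N < 1) (ε : ℝ) {k : ℕ} {v w : V} {s : ℝ}
    (h2 : stdModule hc ρ (sigma c) ((zbarPoly ^ (k + 1)) ⊗ₜ w)
      = (s : ℂ) • (zPoly ^ (k + 1)) ⊗ₜ[ℂ] v) :
    zOp hc ρ ε (proj hc ρ N (k + 1) ((zbarPoly ^ (k + 1)) ⊗ₜ w))
      = ((((k + 1 : ℕ) : ℝ) - N : ℝ) : ℂ) • proj hc ρ N (k + 1) ((zbarPoly ^ (k + 1)) ⊗ₜ w)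
        - ((s * (1 - ε) : ℝ) : ℂ) • proj hc ρ N (k + 1) ((zPoly ^ (k + 1)) ⊗ₜ v) := by
  have h := proj_Z0_hzbar hc ρ hN hN1 (zbarPoly_pow_tmul_mem k w)
  rw [stdModule_hzbar_tmul, ← pow_succ', h2] at h
  rw [zOp_proj, zOp_apply, map_add, h, h2]
  simp only [map_sub, map_smul]
  push_cast
  module

omit hN in
lemma eigval_false (N ε : ℝ) (k : ℕ) (s : ℝ) : eigval N ε k s false = -eigval N ε k s true := by
  simp [eigval]

omit hN in
lemma eigval_true_nonneg (N ε : ℝ) (k : ℕ) (s : ℝ) : 0 ≤ eigval N ε k s true := by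
  simp [eigval, Real.sqrt_nonneg]

omit hN in
lemma eigval_sq {N ε : ℝ} {k : ℕ} {s : ℝ} (h : 0 ≤ ((k : ℝ) - N) ^ 2 - (1 - ε ^ 2) * s ^ 2) :
    eigval N ε k s true ^ 2 = ((k : ℝ) - N) ^ 2 - (1 - ε ^ 2) * s ^ 2 := by
  simp [eigval, Real.sq_sqrt h]

omit hN in
lemma radicand_pos {N : ℝ} (ε : ℝ) {k : ℕ} {s : ℝ} (h : |s| < (k : ℝ) - N) :
    0 < ((k : ℝ) - N) ^ 2 - (1 - ε ^ 2) * s ^ 2 := by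
  have h2 : s ^ 2 < ((k : ℝ) - N) ^ 2 := by
    rw [← sq_abs]; exact pow_lt_pow_left₀ h (abs_nonneg s) two_ne_zero
  nlinarith [mul_nonneg (sq_nonneg ε) (sq_nonneg s)]

omit hN in
lemma eigvec_true (N ε : ℝ) (k : ℕ) (s : ℝ) (v w : V) : eigvec hc ρ N ε k s v w true
    = ((k - N + eigval N ε k s true : ℝ) : ℂ) • proj hc ρ N k ((zbarPoly ^ k) ⊗ₜ w)
      - ((s * (1 - ε) : ℝ) : ℂ) • proj hc ρ N k ((zPoly ^ k) ⊗ₜ v) := by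
  rw [eigvec, map_sub, map_smul, map_smul]

omit hN in
lemma eigvec_false (N ε : ℝ) (k : ℕ) (s : ℝ) (v w : V) : eigvec hc ρ N ε k s v w false
    = ((k - N + eigval N ε k s true : ℝ) : ℂ) • proj hc ρ N k ((zPoly ^ k) ⊗ₜ v)
      - ((s * (1 + ε) : ℝ) : ℂ) • proj hc ρ N k ((zbarPoly ^ k) ⊗ₜ w) := by
  rw [eigvec, map_sub, map_smul, map_smul, eigval_false, sub_neg_eq_add]

/-- The block `A` satisfies `A² = λ²` with `λ = λ^+`, so `A + λ` maps into the `λ`-eigenspace and `A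
- λ` into the `-λ`-eigenspace. Here `h^+` is `A + λ` applied to the `z̄`-vector, and `h^-` is minus
`A - λ` applied to the `z`-vector. -/
lemma zOp_eigvec (hN1 : N < 1) (ε : ℝ) {k : ℕ} {v w : V} {s : ℝ}
    (h1 : stdModule hc ρ (sigma c) ((zPoly ^ (k + 1)) ⊗ₜ v)
      = (s : ℂ) • (zbarPoly ^ (k + 1)) ⊗ₜ[ℂ] w)
    (h2 : stdModule hc ρ (sigma c) ((zbarPoly ^ (k + 1)) ⊗ₜ w)
      = (s : ℂ) • (zPoly ^ (k + 1)) ⊗ₜ[ℂ] v)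
    (hs : 0 ≤ (((k + 1 : ℕ) : ℝ) - N) ^ 2 - (1 - ε ^ 2) * s ^ 2) (sgn : Bool) :
    zOp hc ρ ε (eigvec hc ρ N ε (k + 1) s v w sgn)
      = (eigval N ε (k + 1) s sgn : ℂ) • eigvec hc ρ N ε (k + 1) s v w sgn := by
  have hsq : (eigval N ε (k + 1) s true : ℂ) ^ 2
      = (((k + 1 : ℕ) : ℂ) - N) ^ 2 - (1 - (ε : ℂ) ^ 2) * (s : ℂ) ^ 2 := by
    exact_mod_cast eigval_sq hs
  cases sgn
  · rw [eigvec_false, eigval_false, map_sub, map_smul, map_smul,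
      zOp_proj_zPoly hc ρ hN hN1 ε h1, zOp_proj_zbarPoly hc ρ hN hN1 ε h2]
    push_cast at hsq ⊢
    linear_combination (norm := module)
      hsq • proj hc ρ N (k + 1) ((zPoly ^ (k + 1)) ⊗ₜ v)
  · rw [eigvec_true, map_sub, map_smul, map_smul,
      zOp_proj_zPoly hc ρ hN hN1 ε h1, zOp_proj_zbarPoly hc ρ hN hN1 ε h2]
    push_cast at hsq ⊢
    linear_combination (norm := module)
      (-hsq) • proj hc ρ N (k + 1) ((zbarPoly ^ (k + 1)) ⊗ₜ w)

end Eigenvectors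

/-! ## Generation of all eigenvectors by `E_+` -/

section Generation

variable {V : Type*} [AddCommGroup V] [Module ℂ V]

/-- The projection of the standard module onto its degree-`k` part. -/
def degreeProj (V : Type*) [AddCommGroup V] [Module ℂ V] (k : ℕ) : Module.End ℂ (StdSpace V) :=
  LinearMap.rTensor V (homogeneousComponent k)

lemma degreeProj_mem (k : ℕ) (p : StdSpace V) : degreeProj V k p ∈ degreePart V k := by
  induction p using TensorProduct.induction_on with
  | zero => simp
  | tmul f v =>
    rw [degreeProj, LinearMap.rTensor_tmul]
    exact Submodule.subset_span ⟨_, v, homogeneousComponent_isHomogeneous k f, rfl⟩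
  | add x y hx hy => rw [map_add]; exact add_mem hx hy

lemma degreeProj_of_mem (k : ℕ) {l : ℕ} {p : StdSpace V} (hp : p ∈ degreePart V l) :
    degreeProj V k p = if l = k then p else 0 := by
  induction hp using Submodule.span_induction with
  | mem x h =>
    obtain ⟨f, v, hf, rfl⟩ := h
    rw [degreeProj, LinearMap.rTensor_tmul,
      homogeneousComponent_of_mem ((mem_homogeneousSubmodule _ _).mpr hf)]
    by_cases h : l = k
    · simp [h]
    · simp [h, Ne.symm h]
  | zero => simp
  | add x y _ _ hx hy => rw [map_add, hx, hy]; split_ifs <;> simp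
  | smul a x _ hx => rw [map_smul, hx]; split_ifs <;> simp

lemma stdSpace_induction {P : StdSpace V → Prop} (zero : P 0)
    (add : ∀ p q, P p → P q → P (p + q)) (homogeneous : ∀ k, ∀ p ∈ degreePart V k, P p)
    (p : StdSpace V) : P p := by
  induction p using TensorProduct.induction_on with
  | zero => exact zero
  | tmul f v =>
    rw [← sum_homogeneousComponent f, TensorProduct.sum_tmul]
    refine Finset.sum_induction _ P add zero fun k _ => homogeneous k _ ?_
    exact Submodule.subset_span ⟨_, v, homogeneousComponent_isHomogeneous k f, rfl⟩
  | add x y hx hy => exact add _ _ hx hy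

lemma degreeProj_comm {T : Module.End ℂ (StdSpace V)}
    (hT : ∀ k, ∀ p ∈ degreePart V k, T p ∈ degreePart V k) (k : ℕ) (p : StdSpace V) :
    degreeProj V k (T p) = T (degreeProj V k p) := by
  induction p using stdSpace_induction with
  | zero => simp
  | add p q hp hq => simp only [map_add, hp, hq]
  | homogeneous l p hp =>
    rw [degreeProj_of_mem k hp, degreeProj_of_mem k (hT l p hp)]
    split_ifs <;> simp

/-- Quantifying over all `n' ≥ n` lets two vectors share a common bound in the additive step. -/
lemma exists_sum_degreeProj (p : StdSpace V) :
    ∃ n, ∀ n' ≥ n, p = ∑ k ∈ Finset.range n', degreeProj V k p := by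
  induction p using stdSpace_induction with
  | zero => exact ⟨0, fun n' _ => by simp⟩
  | add p q hp hq =>
    obtain ⟨a, ha⟩ := hp
    obtain ⟨b, hb⟩ := hq
    refine ⟨max a b, fun n' hn => ?_⟩
    simp only [map_add, Finset.sum_add_distrib]
    rw [← ha n' (le_of_max_le_left hn), ← hb n' (le_of_max_le_right hn)]
  | homogeneous l p hp =>
    refine ⟨l + 1, fun n' hn => ?_⟩
    simp only [degreeProj_of_mem _ hp]
    rw [Finset.sum_ite_eq, if_pos (Finset.mem_range.mpr hn)]

variable {m : ℕ} [NeZero m] {c : ZMod m → ℝ} (hc : IsParameter c)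
  (ρ : Representation ℂ (DihedralGroup m) V)

lemma Eplus_pow_mem_of_eigenvector {N : ℝ}
    (hN : ∀ v : V, ∑ j : ZMod m, (c j : ℂ) • ρ (sr j) v = (N : ℂ) • v) (hN1 : N < 1) (ε : ℝ)
    (μ : ℂ) (k j : ℕ) {p : StdSpace V} (hp : p ∈ degreePart V k) (e : zOp hc ρ ε p = μ • p) :
    stdModule hc ρ (Eplus c ^ j) p ∈
      ⨆ (k : ℕ) (j : ℕ), Submodule.map (stdModule hc ρ (Eplus c ^ j))
        (harmonics hc ρ k ⊓ Module.End.eigenspace (zOp hc ρ ε) μ) := by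
  induction k using Nat.strong_induction_on generalizing p j with
  | _ k ih =>
    have harm : ∀ q ∈ harmonics hc ρ k, zOp hc ρ ε q = μ • q →
        stdModule hc ρ (Eplus c ^ j) q ∈
          ⨆ (k : ℕ) (j : ℕ), Submodule.map (stdModule hc ρ (Eplus c ^ j))
            (harmonics hc ρ k ⊓ Module.End.eigenspace (zOp hc ρ ε) μ) := fun q hq hqe =>
      Submodule.mem_iSup_of_mem k (Submodule.mem_iSup_of_mem j
        (Submodule.mem_map_of_mem ⟨hq, Module.End.mem_eigenspace_iff.mpr hqe⟩))
    rcases lt_or_ge k 2 with hk | hk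
    · exact harm p ⟨hp, LinearMap.mem_ker.mpr (Eminus_of_mem_degreePart_of_lt hc ρ hk hp)⟩ e
    · obtain ⟨l, rfl⟩ := Nat.exists_eq_add_of_le' hk
      obtain ⟨q, hq, hpq⟩ := exists_sub_proj hc ρ (N := N) hp
      have h1 : zOp hc ρ ε (proj hc ρ N (l + 2) p) = μ • proj hc ρ N (l + 2) p := by
        rw [zOp_proj, e, map_smul]
      -- The vector `E_+ q = p - Proj p` is an eigenvector; commuting with `E_+` and cancelling it
      -- passes this on to `q`, two degrees lower.
      have h2 : zOp hc ρ ε q = μ • q := by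
        apply Eplus_injective hc ρ
        have h3 := zOp_Eplus_pow hc ρ ε 1 q
        rw [pow_one] at h3
        rw [← h3, map_smul, ← sub_eq_iff_eq_add'.mpr hpq, map_sub, h1, e, smul_sub]
      rw [hpq, map_add]
      refine add_mem (harm _ (proj_mem_harmonics hc ρ hN hN1 hp) h1) ?_
      rw [← stdModule_pow_succ]
      exact ih l (by omega) (j + 1) hq h2

/-- `Z_0 + ε σ` preserves degrees, so every homogeneous component of an eigenvector satisfies the
same eigenvalue equation. -/
lemma eigenspace_eq_iSup {N : ℝ}
    (hN : ∀ v : V, ∑ j : ZMod m, (c j : ℂ) • ρ (sr j) v = (N : ℂ) • v) (hN1 : N < 1) (ε : ℝ)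
    (μ : ℂ) : Module.End.eigenspace (zOp hc ρ ε) μ =
      ⨆ (k : ℕ) (j : ℕ), Submodule.map (stdModule hc ρ (Eplus c ^ j))
        (harmonics hc ρ k ⊓ Module.End.eigenspace (zOp hc ρ ε) μ) := by
  apply le_antisymm
  · intro p hp
    rw [Module.End.mem_eigenspace_iff] at hp
    obtain ⟨n, hn⟩ := exists_sum_degreeProj p
    rw [hn n le_rfl]
    refine sum_mem fun k _ => ?_
    have := Eplus_pow_mem_of_eigenvector hc ρ hN hN1 ε μ k 0 (degreeProj_mem k p)
      (by rw [← degreeProj_comm (fun l q hq => zOp_mem_degreePart hc ρ ε hq), hp, map_smul])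
    rwa [pow_zero, stdModule_one_apply] at this
  · refine iSup_le fun k => iSup_le fun j => ?_
    rintro _ ⟨p, ⟨-, hp⟩, rfl⟩
    rw [SetLike.mem_coe, Module.End.mem_eigenspace_iff] at hp
    rw [Module.End.mem_eigenspace_iff, zOp_Eplus_pow, hp, map_smul]

end Generation

/-! ## Character sums -/

section CharacterSums

variable {m : ℕ} [NeZero m]

omit [NeZero m] in
lemma phase_ne_zero (j : ZMod m) : phase j ≠ 0 :=
  left_ne_zero_of_mul_eq_one (phase_mul_phaseInv j)

omit [NeZero m] in
lemma phase_eq_exp (j : ZMod m) :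
    phase j = Complex.exp (2 * Real.pi * Complex.I / m) ^ j.val := by
  rw [← Complex.exp_nat_mul, phase, mul_comm Complex.I, Complex.ofReal_cos, Complex.ofReal_sin,
    ← Complex.exp_mul_I, angle]
  congr 1
  push_cast
  ring

omit [NeZero m] in
lemma omegaPow_eq (j : ZMod m) (n : ℤ) : omegaPow j n = phase j ^ n := by
  rw [omegaPow, phase_eq_exp, zpow_mul, zpow_natCast]

omit [NeZero m] in
lemma phaseInv_eq (j : ZMod m) : phaseInv j = (phase j)⁻¹ :=
  eq_inv_of_mul_eq_one_right (phase_mul_phaseInv j)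

lemma phase_add (j k : ZMod m) : phase (j + k) = phase j * phase k := by
  simp only [phase, trig_add, Real.cos_add, Real.sin_add, Complex.ofReal_add, Complex.ofReal_sub,
    Complex.ofReal_mul]
  linear_combination -(Real.sin (angle j) * Real.sin (angle k) : ℂ) * Complex.I_sq

lemma phase_neg (j : ZMod m) : phase (-j) = (phase j)⁻¹ := by
  refine eq_inv_of_mul_eq_one_left ?_
  rw [← phase_add, neg_add_cancel, phase_eq_exp, ZMod.val_zero, pow_zero]

omit [NeZero m] in
lemma conj_phase (j : ZMod m) : (starRingEnd ℂ) (phase j) = (phase j)⁻¹ := by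
  rw [← phaseInv_eq, phase, phaseInv]
  simp only [map_add, map_mul, Complex.conj_ofReal, Complex.conj_I]
  ring

lemma even_val_neg (hm : Even m) (j : ZMod m) : Even (-j).val ↔ Even j.val := by
  rw [ZMod.neg_val]
  split_ifs with h
  · simp [h]
  · rw [Nat.even_sub (ZMod.val_lt j).le]
    simp [hm]

variable {c : ZMod m → ℝ}

omit [NeZero m] in
-- Conjugation by the rotation `r k` sends `s_j` to `s_(j-2k)`; take `k = j`.
lemma IsParameter.neg (hc : IsParameter c) (j : ZMod m) : c (-j) = c j :=
  (hc (r j) j (-j) (by simp)).symm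

omit [NeZero m] in
lemma IsParameter.sub_two (hc : IsParameter c) (j : ZMod m) : c (j - 1 - 1) = c j :=
  (hc (r 1) j (j - 1 - 1) (by simp [sub_eq_add_neg])).symm

namespace IrrepType

variable (τ : IrrepType m)

/-- A uniform formula for all types, so that the later arguments need only the behaviour of `coef`
and `phase`. -/
lemma sigmaElt_eq (c : ZMod m → ℝ) (k : ℕ) (a : τ.Idx) :
    τ.sigmaElt c k a = ∑ j : ZMod m, (c j : ℂ) * phase j ^ k * τ.coef j a := by
  have hadd (j : ZMod m) (n : ℤ) : phase j ^ ((k : ℤ) + n) = phase j ^ k * phase j ^ n := by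
    rw [zpow_add₀ (phase_ne_zero j), zpow_natCast]
  rcases τ with _ | _ | h | h | ⟨u, h1, h2⟩
  · simp [sigmaElt, coef, sigmaSum, omegaPow_eq]
  · simp [sigmaElt, coef, sigmaSum, omegaPow_eq]
  · simp only [sigmaElt, coef, sigmaEven, sigmaOdd, omegaPow_eq, ← Finset.sum_neg_distrib,
      ← Finset.sum_add_distrib, zpow_natCast]
    exact Finset.sum_congr rfl fun j _ => by split_ifs <;> ring
  · simp only [sigmaElt, coef, sigmaEven, sigmaOdd, omegaPow_eq,
      ← Finset.sum_sub_distrib, zpow_natCast]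
    exact Finset.sum_congr rfl fun j _ => by split_ifs <;> ring
  · cases a
    · simp only [sigmaElt, coef, sigmaSum, omegaPow_eq, sub_eq_add_neg, hadd, mul_assoc]
    · simp only [sigmaElt, coef, sigmaSum, omegaPow_eq, hadd, mul_assoc]

lemma coef_neg (j : ZMod m) (a : τ.Idx) : τ.coef (-j) a = τ.coef j (τ.conj a) := by
  rcases τ with _ | _ | h | h | ⟨u, h1, h2⟩
  · rfl
  · rfl
  · simp [coef, even_val_neg h]
  · simp [coef, even_val_neg h]
  · cases a <;> simp [coef, conj, omegaPow_eq, phase_neg]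

omit [NeZero m] in
lemma conj_coef (j : ZMod m) (a : τ.Idx) :
    (starRingEnd ℂ) (τ.coef j a) = τ.coef j (τ.conj a) := by
  rcases τ with _ | _ | h | h | ⟨u, h1, h2⟩
  · simp [coef]
  · simp [coef]
  · simp only [coef]; split_ifs <;> simp
  · simp only [coef]; split_ifs <;> simp
  · cases a <;> simp [coef, conj, omegaPow_eq, conj_phase]

omit [NeZero m] in
lemma conj_conj (a : τ.Idx) : τ.conj (τ.conj a) = a := by
  rcases τ with _ | _ | h | h | ⟨u, h1, h2⟩ <;> cases a <;> rfl

/-- The substitution `j ↦ -j` preserves `c`, inverts the phase and conjugates the index of `coef`.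
The identity shows that `σ` has the same factor in both directions between the two top vectors. -/
lemma sum_phaseInv (hc : IsParameter c) (k : ℕ) (a : τ.Idx) :
    ∑ j : ZMod m, (c j : ℂ) * phaseInv j ^ k * τ.coef j (τ.conj a) = τ.sigmaElt c k a := by
  rw [sigmaElt_eq, ← Equiv.sum_comp (Equiv.neg (ZMod m))]
  refine Finset.sum_congr rfl fun j _ => ?_
  rw [Equiv.neg_apply, hc.neg, coef_neg, conj_conj, phaseInv_eq, phase_neg, inv_inv]

/-- Complex conjugation has the same effect on each summand as `j ↦ -j`, which leaves the sum
unchanged. -/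
lemma sigmaElt_real (hc : IsParameter c) (k : ℕ) (a : τ.Idx) :
    ((τ.sigmaElt c k a).re : ℂ) = τ.sigmaElt c k a := by
  rw [← Complex.conj_eq_iff_re]
  conv_rhs => rw [← sum_phaseInv τ hc]
  rw [sigmaElt_eq, map_sum]
  refine Finset.sum_congr rfl fun j _ => ?_
  rw [map_mul, map_mul, map_pow, conj_phase, conj_coef, Complex.conj_ofReal, phaseInv_eq]

instance instFintypeIdx : Fintype τ.Idx := by
  rcases τ with _ | _ | h | h | ⟨u, h1, h2⟩
  exacts [inferInstanceAs (Fintype Unit), inferInstanceAs (Fintype Unit),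
    inferInstanceAs (Fintype Unit), inferInstanceAs (Fintype Unit),
    inferInstanceAs (Fintype Bool)]

instance instNonemptyIdx : Nonempty τ.Idx := by
  rcases τ with _ | _ | h | h | ⟨u, h1, h2⟩
  exacts [⟨()⟩, ⟨()⟩, ⟨()⟩, ⟨()⟩, ⟨true⟩]

end IrrepType

/-- The shift `j ↦ j + 2` preserves `c` and multiplies the sum by `ω^(2n)`. -/
lemma sigmaSum_eq_zero (hc : IsParameter c) {n : ℤ}
    (hn : Complex.exp (2 * Real.pi * Complex.I / m) ^ (2 * n) ≠ 1) : sigmaSum c n = 0 := by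
  have h1 : phase (1 : ZMod m) = Complex.exp (2 * Real.pi * Complex.I / m) := by
    rcases Nat.lt_or_ge 1 m with h | h
    · have : Fact (1 < m) := ⟨h⟩
      rw [phase_eq_exp, ZMod.val_one, pow_one]
    · obtain rfl : m = 1 := le_antisymm h (NeZero.pos m)
      rw [phase_eq_exp]
      simp [Subsingleton.elim (1 : ZMod 1) 0, Complex.exp_two_pi_mul_I]
  have key : sigmaSum c n = phase (1 : ZMod m) ^ (2 * n) * sigmaSum c n := by
    conv_lhs => rw [sigmaSum, ← Equiv.sum_comp (Equiv.addRight (2 : ZMod m))]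
    rw [sigmaSum, Finset.mul_sum]
    refine Finset.sum_congr rfl fun j _ => ?_
    have hcj : c (j + 2) = c j := by
      rw [← hc.sub_two (j + 2)]; congr 1; ring
    rw [Equiv.coe_addRight, hcj, omegaPow_eq, omegaPow_eq, ← one_add_one_eq_two, phase_add,
      phase_add, mul_zpow, mul_zpow, two_mul,
      zpow_add₀ (phase_ne_zero 1)]
    ring
  rw [h1] at key
  by_contra h0
  exact hn (mul_right_cancel₀ h0 (by rw [← key, one_mul]))

end CharacterSums

/-! ## Classification of the irreducible representations -/

section Classification

variable {m : ℕ} [NeZero m] {V : Type*} [AddCommGroup V] [Module ℂ V]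
  {ρ : Representation ℂ (DihedralGroup m) V}

lemma rep_r (ρ : Representation ℂ (DihedralGroup m) V) (k : ZMod m) :
    ρ (r k) = ρ (r 1) ^ k.val := by
  rw [← map_pow, r_one_pow, ZMod.natCast_zmod_val]

lemma rep_sr (ρ : Representation ℂ (DihedralGroup m) V) (k : ZMod m) (v : V) :
    ρ (sr k) v = ρ (sr 0) ((ρ (r 1) ^ k.val) v) := by
  rw [← rep_r, ← Module.End.mul_apply, ← map_mul, sr_mul_r, zero_add]

omit [NeZero m] in
lemma rep_sr_zero_sr_zero (ρ : Representation ℂ (DihedralGroup m) V) (v : V) :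
    ρ (sr 0) (ρ (sr 0) v) = v := by
  rw [← Module.End.mul_apply, ← map_mul, sr_mul_self, map_one, Module.End.one_apply]

omit [NeZero m] in
lemma pow_apply_of_eigenvector {T : Module.End ℂ V} {μ : ℂ} {v : V} (h : T v = μ • v) (n : ℕ) :
    (T ^ n) v = μ ^ n • v := by
  induction n with
  | zero => simp
  | succ n ih => rw [pow_succ, Module.End.mul_apply, h, map_smul, ih, smul_smul, pow_succ']

omit [NeZero m] in
lemma rep_r_sr_zero {μ : ℂ} (hμ : μ ≠ 0) {v : V} (h : ρ (r 1) v = μ • v) :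
    ρ (r 1) (ρ (sr 0) v) = μ⁻¹ • ρ (sr 0) v := by
  have e : ρ (r 1) (ρ (sr 0) (ρ (r 1) v)) = ρ (sr 0) v := by
    simp only [← Module.End.mul_apply, ← map_mul, sr_mul_r, r_mul_sr]
    simp
  rw [h, map_smul, map_smul] at e
  exact (inv_smul_eq_iff₀ hμ).mpr e.symm |>.symm

omit [NeZero m] in
lemma eq_top_of_invariant (hρ : ρ.IsIrreducible) (W : Submodule ℂ V)
    (h : ∀ g, ∀ w ∈ W, ρ g w ∈ W) {w : V} (hw : w ∈ W) (hw0 : w ≠ 0) : W = ⊤ := by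
  have := hρ
  let S : Subrepresentation ρ := ⟨W, fun g v hv => h g v hv⟩
  rcases eq_bot_or_eq_top S with e | e
  · have : W = (⊥ : Subrepresentation ρ).toSubmodule := congrArg Subrepresentation.toSubmodule e
    rw [this] at hw
    exact absurd hw hw0
  · exact congrArg Subrepresentation.toSubmodule e

lemma eq_top_of_generators (hρ : ρ.IsIrreducible) (W : Submodule ℂ V)
    (hr : ∀ w ∈ W, ρ (r 1) w ∈ W) (hs : ∀ w ∈ W, ρ (sr 0) w ∈ W) {w : V} (hw : w ∈ W)
    (hw0 : w ≠ 0) : W = ⊤ := by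
  have hpow : ∀ n : ℕ, ∀ w ∈ W, (ρ (r 1) ^ n) w ∈ W := by
    intro n
    induction n with
    | zero => intro w hw; simpa using hw
    | succ n ih => intro w hw; rw [pow_succ']; exact hr _ (ih w hw)
  refine eq_top_of_invariant hρ W (fun g w hw => ?_) hw hw0
  rcases g with k | k
  · rw [rep_r]; exact hpow _ w hw
  · rw [rep_sr]; exact hs _ (hpow _ w hw)

omit [NeZero m] in
lemma nontrivial_of_isIrreducible (hρ : ρ.IsIrreducible) : Nontrivial V := by
  by_contra h
  rw [not_nontrivial_iff_subsingleton] at h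
  have := hρ
  obtain ⟨x, y, hxy⟩ := exists_pair_ne (Subrepresentation ρ)
  exact hxy (Subrepresentation.toSubmodule_injective (Subsingleton.elim _ _))

lemma finiteDimensional_of_isIrreducible (hρ : ρ.IsIrreducible) : FiniteDimensional ℂ V := by
  have := nontrivial_of_isIrreducible hρ
  obtain ⟨v, hv⟩ := exists_ne (0 : V)
  have htop := eq_top_of_invariant hρ (Submodule.span ℂ (Set.range fun g => ρ g v)) (by
    intro g w hw
    induction hw using Submodule.span_induction with
    | mem x hx =>
      obtain ⟨h, rfl⟩ := hx
      exact Submodule.subset_span ⟨g * h, by simp⟩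
    | zero => simp
    | add x y _ _ hx hy => rw [map_add]; exact add_mem hx hy
    | smul a x _ hx => rw [map_smul]; exact Submodule.smul_mem _ _ hx)
    (w := v) (Submodule.subset_span ⟨1, by simp⟩) hv
  exact Module.Finite.of_fg_top (htop ▸ Submodule.fg_span (Set.finite_range _))

omit [NeZero m] in
lemma exists_eigenvector [FiniteDimensional ℂ V] [Nontrivial V]
    (ρ : Representation ℂ (DihedralGroup m) V) :
    ∃ (μ : ℂ) (v : V), v ≠ 0 ∧ μ ^ m = 1 ∧ ρ (r 1) v = μ • v := by
  obtain ⟨μ, hμ⟩ := Module.End.exists_eigenvalue (ρ (r 1))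
  obtain ⟨v, hv⟩ := hμ.exists_hasEigenvector
  have e := Module.End.mem_eigenspace_iff.mp hv.1
  refine ⟨μ, v, hv.2, ?_, e⟩
  have h := pow_apply_of_eigenvector e m
  rw [← map_pow, r_one_pow_n, map_one, Module.End.one_apply] at h
  have h2 : (μ ^ m - 1) • v = 0 := by rw [sub_smul, one_smul, ← h, sub_self]
  exact sub_eq_zero.mp ((smul_eq_zero.mp h2).resolve_right hv.2)

omit [NeZero m] in
lemma exists_basis_unit {x : V} (hx : x ≠ 0) (hspan : Submodule.span ℂ {x} = ⊤) :
    ∃ b : Module.Basis Unit ℂ V, ∀ a, b a = x := by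
  refine ⟨Module.Basis.mk (v := fun _ : Unit => x) ?_ ?_, fun a => ?_⟩
  · exact LinearIndependent.of_subsingleton () hx
  · rw [Set.range_const, hspan]
  · rw [Module.Basis.mk_apply]

lemma exists_standardBasis_of_line {x : V} (hx : x ≠ 0) (hspan : Submodule.span ℂ {x} = ⊤)
    {μ : ℂ} (hμ : μ ^ m = 1) (hμ2 : μ = 1 ∨ μ = -1) (hr : ρ (r 1) x = μ • x) {δ : ℂ}
    (hδ : δ = 1 ∨ δ = -1) (hs : ρ (sr 0) x = δ • x) :
    ∃ (τ : IrrepType m) (b : Module.Basis τ.Idx ℂ V), τ.IsStandardBasis ρ b := by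
  obtain ⟨b, hb⟩ := exists_basis_unit hx hspan
  have key : ∀ j : ZMod m, ρ (sr j) x = (μ ^ j.val * δ) • x := by
    intro j
    rw [rep_sr, pow_apply_of_eigenvector hr, map_smul, hs, smul_smul]
  rcases hμ2 with rfl | rfl
  · rcases hδ with rfl | rfl
    · have e (j : ZMod m) : ρ (sr j) (b ()) = IrrepType.coef (.triv) j () • b () := by
        rw [hb, key]; change _ = (1 : ℂ) • x; congr 1; simp
      exact ⟨.triv, b, fun j _ => e j⟩
    · have e (j : ZMod m) : ρ (sr j) (b ()) = IrrepType.coef (.sign) j () • b () := by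
        rw [hb, key]; change _ = (-1 : ℂ) • x; congr 1; simp
      exact ⟨.sign, b, fun j _ => e j⟩
  · have hm : Even m := (neg_one_pow_eq_one_iff_even (by norm_num)).mp hμ
    have hpar : ∀ j : ZMod m, (-1 : ℂ) ^ j.val = if Even j.val then 1 else -1 := by
      intro j
      split_ifs with h
      · exact h.neg_one_pow
      · exact (Nat.not_even_iff_odd.mp h).neg_one_pow
    rcases hδ with rfl | rfl
    · have e (j : ZMod m) : ρ (sr j) (b ()) = IrrepType.coef (.chiOne hm) j () • b () := by
        rw [hb, key, hpar]; change _ = (if Even j.val then 1 else -1 : ℂ) • x; congr 1; split_ifs <;> norm_num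
      exact ⟨.chiOne hm, b, fun j _ => e j⟩
    · have e (j : ZMod m) : ρ (sr j) (b ()) = IrrepType.coef (.chiZero hm) j () • b () := by
        rw [hb, key, hpar]; change _ = (if Even j.val then -1 else 1 : ℂ) • x; congr 1; split_ifs <;> norm_num
      exact ⟨.chiZero hm, b, fun j _ => e j⟩

/-- The vectors `x` and `s_0 x` have rotation eigenvalues `ω^u` and `ω^(-u)`, which differ because
`0 < 2u < m`; they are therefore independent. -/
lemma exists_standardBasis_of_plane {u : ℕ} (h1 : 1 ≤ u) (h2 : 2 * u < m) {x : V} (hx : x ≠ 0)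
    (hr : ρ (r 1) x = Complex.exp (2 * Real.pi * Complex.I / m) ^ u • x)
    (hspan : Submodule.span ℂ {x, ρ (sr 0) x} = ⊤) :
    ∃ (τ : IrrepType m) (b : Module.Basis τ.Idx ℂ V), τ.IsStandardBasis ρ b := by
  set ω := Complex.exp (2 * Real.pi * Complex.I / m) with hω
  have hω0 : ω ≠ 0 := Complex.exp_ne_zero _
  have hprim : IsPrimitiveRoot ω m := Complex.isPrimitiveRoot_exp m (NeZero.ne m)
  have hr' := rep_r_sr_zero (pow_ne_zero u hω0) hr
  have hy0 : ρ (sr 0) x ≠ 0 := by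
    intro h
    apply hx
    rw [← rep_sr_zero_sr_zero ρ x, h, map_zero]
  have hne : ω ^ u ≠ (ω ^ u)⁻¹ := by
    intro h
    have h3 : ω ^ (2 * u) = 1 := by
      rw [two_mul, pow_add]
      nth_rewrite 2 [h]
      exact mul_inv_cancel₀ (pow_ne_zero u hω0)
    have := Nat.le_of_dvd (by omega) (hprim.dvd_of_pow_eq_one _ h3)
    omega
  let v : Bool → V := fun a => if a then x else ρ (sr 0) x
  let ev : Bool → ℂ := fun a => if a then ω ^ u else (ω ^ u)⁻¹
  have hli : LinearIndependent ℂ v := by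
    refine Module.End.eigenvectors_linearIndependent' (ρ (r 1)) ev ?_ v ?_
    · intro a b hab
      cases a <;> cases b <;> simp_all [ev]
    · intro a
      cases a
      · exact Module.End.hasEigenvector_iff.mpr ⟨Module.End.mem_eigenspace_iff.mpr hr', hy0⟩
      · exact Module.End.hasEigenvector_iff.mpr ⟨Module.End.mem_eigenspace_iff.mpr hr, hx⟩
  have hsp : ⊤ ≤ Submodule.span ℂ (Set.range v) := by
    rw [← hspan, Submodule.span_le]
    rintro y (rfl | rfl)
    · exact Submodule.subset_span ⟨true, rfl⟩
    · exact Submodule.subset_span ⟨false, rfl⟩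
  let b : Module.Basis Bool ℂ V := Module.Basis.mk hli hsp
  have hbt : b true = x := Module.Basis.mk_apply hli hsp true
  have hbf : b false = ρ (sr 0) x := Module.Basis.mk_apply hli hsp false
  refine ⟨.rho u h1 h2, b, fun j a => ?_⟩
  cases a
  · have e : ρ (sr j) (b false) = IrrepType.coef (.rho u h1 h2) j false • b true := by
      rw [hbf, hbt, rep_sr, pow_apply_of_eigenvector hr', map_smul, rep_sr_zero_sr_zero,
        IrrepType.coef, omegaPow, ← hω, mul_comm (j.val : ℤ), zpow_mul, zpow_neg, zpow_natCast,
        zpow_natCast]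
    exact e
  · have e : ρ (sr j) (b true) = IrrepType.coef (.rho u h1 h2) j true • b false := by
      rw [hbf, hbt, rep_sr, pow_apply_of_eigenvector hr, map_smul,
        IrrepType.coef, omegaPow, ← hω, mul_comm (j.val : ℤ), zpow_mul, zpow_natCast, zpow_natCast]
    exact e

/-- Every irreducible representation of the dihedral group is one of the list. -/
theorem exists_standardBasis (hρ : ρ.IsIrreducible) :
    ∃ (τ : IrrepType m) (b : Module.Basis τ.Idx ℂ V), τ.IsStandardBasis ρ b := by
  have := nontrivial_of_isIrreducible hρ
  have := finiteDimensional_of_isIrreducible hρ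
  obtain ⟨μ, v, hv, hμ, hr⟩ := exists_eigenvector ρ
  have hμ0 : μ ≠ 0 := by
    rintro rfl
    rw [zero_pow (NeZero.ne m)] at hμ
    exact zero_ne_one hμ
  have hr' := rep_r_sr_zero hμ0 hr
  have hw0 : ρ (sr 0) v ≠ 0 := by
    intro h
    apply hv
    rw [← rep_sr_zero_sr_zero ρ v, h, map_zero]
  -- If `μ = μ⁻¹`, then `v` and `s_0 v` share a rotation eigenvalue and some combination spans an
  -- invariant line; otherwise they span an invariant plane.
  by_cases h2 : μ ^ 2 = 1
  · have hinv : μ⁻¹ = μ := inv_eq_of_mul_eq_one_left (by rw [← pow_two, h2])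
    rw [hinv] at hr'
    have line : ∀ x : V, x ≠ 0 → ρ (r 1) x = μ • x → ∀ δ : ℂ, (δ = 1 ∨ δ = -1) →
        ρ (sr 0) x = δ • x →
        ∃ (τ : IrrepType m) (b : Module.Basis τ.Idx ℂ V), τ.IsStandardBasis ρ b := by
      intro x hx hrx δ hδ hsx
      refine exists_standardBasis_of_line hx (eq_top_of_generators hρ _ ?_ ?_
        (Submodule.mem_span_singleton_self x) hx) hμ (sq_eq_one_iff.mp h2) hrx hδ hsx
      · intro w hw
        obtain ⟨a, rfl⟩ := Submodule.mem_span_singleton.mp hw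
        rw [map_smul, hrx]
        exact Submodule.smul_mem _ _ (Submodule.smul_mem _ _ (Submodule.mem_span_singleton_self x))
      · intro w hw
        obtain ⟨a, rfl⟩ := Submodule.mem_span_singleton.mp hw
        rw [map_smul, hsx]
        exact Submodule.smul_mem _ _ (Submodule.smul_mem _ _ (Submodule.mem_span_singleton_self x))
    by_cases hsum : v + ρ (sr 0) v = 0
    · exact line v hv hr (-1) (Or.inr rfl) (by
        rw [neg_one_smul]; exact eq_neg_of_add_eq_zero_right hsum)
    · refine line (v + ρ (sr 0) v) hsum ?_ 1 (Or.inl rfl) ?_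
      · rw [map_add, hr, hr', smul_add]
      · rw [map_add, rep_sr_zero_sr_zero, one_smul, add_comm]
  · have hspan : Submodule.span ℂ {v, ρ (sr 0) v} = ⊤ := by
      refine eq_top_of_generators hρ _ ?_ ?_
        (Submodule.subset_span (Set.mem_insert v _)) hv
      · intro w hw
        obtain ⟨a, b, rfl⟩ := Submodule.mem_span_pair.mp hw
        rw [map_add, map_smul, map_smul, hr, hr', smul_smul, smul_smul]
        exact Submodule.mem_span_pair.mpr ⟨_, _, rfl⟩
      · intro w hw
        obtain ⟨a, b, rfl⟩ := Submodule.mem_span_pair.mp hw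
        rw [map_add, map_smul, map_smul, rep_sr_zero_sr_zero, add_comm]
        exact Submodule.mem_span_pair.mpr ⟨_, _, rfl⟩
    have hprim := Complex.isPrimitiveRoot_exp m (NeZero.ne m)
    obtain ⟨n, hn, rfl⟩ := hprim.eq_pow_of_pow_eq_one hμ
    rw [← pow_mul] at h2
    have hn0 : n ≠ 0 := by rintro rfl; simp at h2
    rcases lt_trichotomy (2 * n) m with h | h | h
    · exact exists_standardBasis_of_plane (by omega) h hv hr hspan
    · exact absurd (by rw [mul_comm n, h]; exact hprim.pow_eq_one) h2
    -- For `n > m/2` the roles of `v` and `s_0 v` are exchanged, replacing `ω^n` by `ω^(m-n)`.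
    · refine exists_standardBasis_of_plane (u := m - n) (by omega) (by omega) hw0 ?_ ?_
      · rw [hr']
        congr 1
        refine inv_eq_of_mul_eq_one_left ?_
        rw [← pow_add, Nat.sub_add_cancel hn.le]
        exact hprim.pow_eq_one
      · rw [rep_sr_zero_sr_zero, Set.pair_comm, hspan]

end Classification

/-! ## The action of `σ` on top components -/

section SigmaAction

variable {m : ℕ} [NeZero m] {c : ZMod m → ℝ} {V : Type*} [AddCommGroup V] [Module ℂ V]
  (hc : IsParameter c) {ρ : Representation ℂ (DihedralGroup m) V}

lemma hg_zPoly_pow_tmul (s : ZMod m) (k : ℕ) (v : V) :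
    stdModule hc ρ (hg c (sr s)) ((zPoly ^ k) ⊗ₜ v)
      = phase s ^ k • (zbarPoly ^ k) ⊗ₜ[ℂ] ρ (sr s) v := by
  induction k with
  | zero => simp only [pow_zero, hg_one_tmul, one_smul]
  | succ k ih =>
    rw [pow_succ', ← stdModule_hz_tmul hc ρ, ← stdModule_mul_apply, hg_mul_hz,
      stdModule_smul_apply, stdModule_mul_apply, ih, map_smul, stdModule_hzbar_tmul, smul_smul,
      ← pow_succ', ← pow_succ']

lemma hg_zbarPoly_pow_tmul (s : ZMod m) (k : ℕ) (v : V) :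
    stdModule hc ρ (hg c (sr s)) ((zbarPoly ^ k) ⊗ₜ v)
      = phaseInv s ^ k • (zPoly ^ k) ⊗ₜ[ℂ] ρ (sr s) v := by
  induction k with
  | zero => simp only [pow_zero, hg_one_tmul, one_smul]
  | succ k ih =>
    rw [pow_succ', ← stdModule_hzbar_tmul hc ρ, ← stdModule_mul_apply, hg_mul_hzbar,
      stdModule_smul_apply, stdModule_mul_apply, ih, map_smul, stdModule_hz_tmul, smul_smul,
      ← pow_succ', ← pow_succ']

variable {τ : IrrepType m} {b : Module.Basis τ.Idx ℂ V}

lemma sigma_zPoly_pow_tmul (hb : τ.IsStandardBasis ρ b) (k : ℕ) (a : τ.Idx) :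
    stdModule hc ρ (sigma c) ((zPoly ^ k) ⊗ₜ b a)
      = τ.sigmaElt c k a • (zbarPoly ^ k) ⊗ₜ[ℂ] b (τ.conj a) := by
  rw [sigma, stdModule_sum_apply, IrrepType.sigmaElt_eq, Finset.sum_smul]
  refine Finset.sum_congr rfl fun j _ => ?_
  rw [stdModule_smul_apply, hg_zPoly_pow_tmul, hb j a, TensorProduct.tmul_smul, smul_smul,
    smul_smul]

lemma sigma_zbarPoly_pow_tmul (hb : τ.IsStandardBasis ρ b) (k : ℕ) (a : τ.Idx) :
    stdModule hc ρ (sigma c) ((zbarPoly ^ k) ⊗ₜ b (τ.conj a))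
      = τ.sigmaElt c k a • (zPoly ^ k) ⊗ₜ[ℂ] b a := by
  rw [sigma, stdModule_sum_apply, ← IrrepType.sum_phaseInv τ hc, Finset.sum_smul]
  refine Finset.sum_congr rfl fun j _ => ?_
  rw [stdModule_smul_apply, hg_zbarPoly_pow_tmul, hb j, IrrepType.conj_conj,
    TensorProduct.tmul_smul, smul_smul, smul_smul]

omit [NeZero m] in
lemma IrrepType.conj_eq_or (τ : IrrepType m) :
    (∀ a b : τ.Idx, a = b) ∨ ∃ u h₁ h₂, τ = .rho u h₁ h₂ := by
  rcases τ with _ | _ | h | h | ⟨u, h1, h2⟩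
  · exact Or.inl fun _ _ => rfl
  · exact Or.inl fun _ _ => rfl
  · exact Or.inl fun _ _ => rfl
  · exact Or.inl fun _ _ => rfl
  · exact Or.inr ⟨u, h1, h2, rfl⟩

include hc in
-- Here the sums are `σ_u` and `σ_(-u)`, and `0 < 2u < m` gives `ω^(±2u) ≠ 1`. Consequently `N = 0`
-- for `ρ^(u)`.
lemma sigmaElt_zero_rho {u : ℕ} (h₁ : 1 ≤ u) (h₂ : 2 * u < m)
    (a : (IrrepType.rho u h₁ h₂ : IrrepType m).Idx) :
    IrrepType.sigmaElt c 0 (.rho u h₁ h₂) a = 0 := by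
  have hprim := Complex.isPrimitiveRoot_exp m (NeZero.ne m)
  have key : ∀ n : ℤ, n.natAbs = u → sigmaSum c n = 0 := by
    intro n hn
    refine sigmaSum_eq_zero hc fun h => ?_
    have := Int.natAbs_dvd_natAbs.mpr (hprim.zpow_eq_one_iff_dvd _ |>.mp h)
    rw [Int.natAbs_mul, hn, Int.natAbs_natCast, show (2 : ℤ).natAbs = 2 from rfl] at this
    have := Nat.le_of_dvd (by omega) this
    omega
  cases a
  · exact key _ (by simp)
  · exact key _ (by simp)

include hc in
-- A priori `σ` sends `b a` to a multiple of `b (conj a)`. For characters `conj` is trivial, and for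
-- `ρ^(u)` the multiple is zero.
lemma sum_rho_basis (hb : τ.IsStandardBasis ρ b) (a : τ.Idx) :
    ∑ j : ZMod m, (c j : ℂ) • ρ (sr j) (b a) = τ.sigmaElt c 0 a • b a := by
  have e : ∑ j : ZMod m, (c j : ℂ) • ρ (sr j) (b a) = τ.sigmaElt c 0 a • b (τ.conj a) := by
    rw [IrrepType.sigmaElt_eq, Finset.sum_smul]
    refine Finset.sum_congr rfl fun j _ => ?_
    rw [hb j a, smul_smul, pow_zero, mul_one]
  rw [e]
  rcases τ.conj_eq_or with h | ⟨u, h₁, h₂, rfl⟩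
  · rw [h (τ.conj a) a]
  · rw [sigmaElt_zero_rho hc, zero_smul, zero_smul]

include hc in
/-- The central element `σ` acts on `V(τ)` by a real scalar. -/
lemma exists_real_scalar (hb : τ.IsStandardBasis ρ b) :
    ∃ N : ℝ, ∀ v : V, ∑ j : ZMod m, (c j : ℂ) • ρ (sr j) v = (N : ℂ) • v := by
  obtain ⟨a₀⟩ : Nonempty τ.Idx := inferInstance
  refine ⟨(τ.sigmaElt c 0 a₀).re, fun v => ?_⟩
  rw [τ.sigmaElt_real hc]
  have h : ∑ j : ZMod m, (c j : ℂ) • ρ (sr j) = τ.sigmaElt c 0 a₀ • LinearMap.id := by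
    refine b.ext fun a => ?_
    simp only [LinearMap.sum_apply, LinearMap.smul_apply, LinearMap.id_apply]
    rw [sum_rho_basis hc hb]
    rcases τ.conj_eq_or with h | ⟨u, h₁, h₂, rfl⟩
    · rw [h a a₀]
    · rw [sigmaElt_zero_rho hc, sigmaElt_zero_rho hc]
  have := LinearMap.congr_fun h v
  simpa only [LinearMap.sum_apply, LinearMap.smul_apply, LinearMap.id_apply] using this

include hc in
lemma sigmaElt_zero_eq (hb : τ.IsStandardBasis ρ b) {N : ℝ}
    (hN : ∀ v : V, ∑ j : ZMod m, (c j : ℂ) • ρ (sr j) v = (N : ℂ) • v) (a : τ.Idx) :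
    τ.sigmaElt c 0 a = N := by
  have h := (sum_rho_basis hc hb a).symm.trans (hN (b a))
  exact smul_left_injective ℂ (b.ne_zero a) h

lemma zOp_one_tmul {N : ℝ}
    (hN : ∀ v : V, ∑ j : ZMod m, (c j : ℂ) • ρ (sr j) v = (N : ℂ) • v) (ε : ℝ) (v : V) :
    zOp hc ρ ε (1 ⊗ₜ v) = ((ε : ℂ) * N) • (1 ⊗ₜ[ℂ] v) := by
  have h := mem_degreePart_zero.mpr ⟨v, rfl⟩
  rw [zOp_apply, sigma_one_tmul hc ρ hN, Z0, stdModule_sub_apply, stdModule_mul_apply,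
    stdModule_mul_apply, hzeta_of_mem_degreePart_zero hc ρ h,
    hzetabar_of_mem_degreePart_zero hc ρ h, map_zero, map_zero, sub_zero, zero_add, smul_smul]

lemma mem_harmonics_zero {p : StdSpace V} :
    p ∈ harmonics hc ρ 0 ↔ ∃ v : V, p = 1 ⊗ₜ[ℂ] v := by
  rw [← mem_degreePart_zero]
  exact ⟨fun h => h.1, fun h => ⟨h, LinearMap.mem_ker.mpr
    (Eminus_of_mem_degreePart_of_lt hc ρ (by norm_num) h)⟩⟩

end SigmaAction

/-! ## Bases adapted to pairs of top components -/

section Pairs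

variable {K M V ι : Type*} [Field K] [AddCommGroup M] [Module K M] [AddCommGroup V] [Module K V]

/-- The family obtained from `f (b a)` and `g (b (e a))` by the `2 × 2` matrices with rows
`(-B a, A a)` and `(A a, -C a)`. -/
def pairFamily (f g : V →ₗ[K] M) (b : ι → V) (e : ι → ι) (A B C : ι → K) (i : ι × Bool) : M :=
  if i.2 then A i.1 • g (b (e i.1)) - B i.1 • f (b i.1)
  else A i.1 • f (b i.1) - C i.1 • g (b (e i.1))

variable {f g : V →ₗ[K] M} (b : Module.Basis ι K V) {e : ι → ι} (he : Function.Involutive e)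
  {A B C : ι → K} (hdet : ∀ a, A a * A a - B a * C a ≠ 0)

include he hdet

lemma linearIndependent_pairFamily [Fintype ι] (hfg : ∀ v w, f v + g w = 0 → v = 0 ∧ w = 0) :
    LinearIndependent K (pairFamily f g b e A B C) := by
  rw [Fintype.linearIndependent_iff]
  intro l hl
  have hsum : f (∑ a, (A a * l (a, false) - B a * l (a, true)) • b a)
      + g (∑ a, (A a * l (a, true) - C a * l (a, false)) • b (e a)) = 0 := by
    rw [← hl, Fintype.sum_prod_type, map_sum, map_sum, ← Finset.sum_add_distrib]
    refine Finset.sum_congr rfl fun a _ => ?_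
    rw [Fintype.sum_bool, map_smul, map_smul]
    simp only [pairFamily, if_true, Bool.false_eq_true, if_false]
    module
  obtain ⟨h1, h2⟩ := hfg _ _ hsum
  have h1' := Fintype.linearIndependent_iff.mp b.linearIndependent _ h1
  have h2' := Fintype.linearIndependent_iff.mp
    (b.linearIndependent.comp e he.injective) _ h2
  rintro ⟨a, t⟩
  have e1 := h1' a
  have e2 := h2' a
  cases t
  -- The coefficients for each `a` satisfy a 2 × 2 system, solved by the adjugate matrix.
  · refine (mul_eq_zero.mp ?_).resolve_left (hdet a)
    linear_combination A a * e1 + B a * e2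
  · refine (mul_eq_zero.mp ?_).resolve_left (hdet a)
    linear_combination A a * e2 + C a * e1

lemma span_pairFamily :
    Submodule.span K (Set.range (pairFamily f g b e A B C))
      = LinearMap.range f ⊔ LinearMap.range g := by
  apply le_antisymm
  · rw [Submodule.span_le]
    rintro _ ⟨⟨a, t⟩, rfl⟩
    have hf (v : V) : f v ∈ LinearMap.range f ⊔ LinearMap.range g :=
      Submodule.mem_sup_left (LinearMap.mem_range_self f v)
    have hg (v : V) : g v ∈ LinearMap.range f ⊔ LinearMap.range g :=
      Submodule.mem_sup_right (LinearMap.mem_range_self g v)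
    cases t
    · exact sub_mem (Submodule.smul_mem _ _ (hf _)) (Submodule.smul_mem _ _ (hg _))
    · exact sub_mem (Submodule.smul_mem _ _ (hg _)) (Submodule.smul_mem _ _ (hf _))
  · set S := Submodule.span K (Set.range (pairFamily f g b e A B C)) with hS
    have h1 (a : ι) : A a • g (b (e a)) - B a • f (b a) ∈ S :=
      Submodule.subset_span ⟨(a, true), rfl⟩
    have h2 (a : ι) : A a • f (b a) - C a • g (b (e a)) ∈ S :=
      Submodule.subset_span ⟨(a, false), rfl⟩
    have hf (a : ι) : f (b a) ∈ S := by
      rw [← S.smul_mem_iff (hdet a)]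
      convert add_mem (S.smul_mem (A a) (h2 a)) (S.smul_mem (C a) (h1 a)) using 1
      module
    have hg (a : ι) : g (b (e a)) ∈ S := by
      rw [← S.smul_mem_iff (hdet a)]
      convert add_mem (S.smul_mem (A a) (h1 a)) (S.smul_mem (B a) (h2 a)) using 1
      module
    have hV (P : V → Prop) (h0 : P 0) (hadd : ∀ x y, P x → P y → P (x + y))
        (hsmul : ∀ (k : K) x, P x → P (k • x)) (hb : ∀ a, P (b a)) (v : V) : P v := by
      have hv : v ∈ Submodule.span K (Set.range b) := by rw [b.span_eq]; trivial
      induction hv using Submodule.span_induction with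
      | mem x hx => obtain ⟨a, rfl⟩ := hx; exact hb a
      | zero => exact h0
      | add x y _ _ hx hy => exact hadd x y hx hy
      | smul k x _ hx => exact hsmul k x hx
    rw [sup_le_iff]
    constructor
    · rintro _ ⟨v, rfl⟩
      exact hV (fun v => f v ∈ S) (by simp) (fun x y hx hy => by rw [map_add]; exact add_mem hx hy)
        (fun k x hx => by rw [map_smul]; exact S.smul_mem k hx) hf v
    · rintro _ ⟨v, rfl⟩
      exact hV (fun v => g v ∈ S) (by simp) (fun x y hx hy => by rw [map_add]; exact add_mem hx hy)
        (fun k x hx => by rw [map_smul]; exact S.smul_mem k hx)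
        -- As `e` is an involution, every basis vector has the form `b (e a')`, with `a' = e a`.
        (fun a => by simpa only [he a] using hg (e a)) v

end Pairs

/-! ### The eigenvectors as a basis of the harmonics -/

section Basis

variable {m : ℕ} [NeZero m] {c : ZMod m → ℝ} {V : Type*} [AddCommGroup V] [Module ℂ V]
  (hc : IsParameter c) (ρ : Representation ℂ (DihedralGroup m) V)

/-- The map `v ↦ Proj_k (f ⊗ v)`. -/
def projTmul (N : ℝ) (k : ℕ) (f : Poly) : V →ₗ[ℂ] StdSpace V :=
  proj hc ρ N k ∘ₗ TensorProduct.mk ℂ Poly V f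

lemma projTmul_apply (N : ℝ) (k : ℕ) (f : Poly) (v : V) :
    projTmul hc ρ N k f v = proj hc ρ N k (f ⊗ₜ v) := rfl

lemma eigvec_eq_pairFamily (N ε : ℝ) (k : ℕ) {ι : Type*} (s : ι → ℝ) (b : ι → V) (e : ι → ι) :
    (fun i : ι × Bool => eigvec hc ρ N ε k (s i.1) (b i.1) (b (e i.1)) i.2)
      = pairFamily (projTmul hc ρ N k (zPoly ^ k)) (projTmul hc ρ N k (zbarPoly ^ k)) b e
        (fun a => ((k - N + eigval N ε k (s a) true : ℝ) : ℂ))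
        (fun a => ((s a * (1 - ε) : ℝ) : ℂ)) (fun a => ((s a * (1 + ε) : ℝ) : ℂ)) := by
  funext ⟨a, t⟩
  cases t
  · simp only [eigvec_false, pairFamily, projTmul_apply, Bool.false_eq_true, if_false]
  · simp only [eigvec_true, pairFamily, projTmul_apply, if_true]

/-- With `κ = k - N` and `λ = λ^+`, the relation `λ² = κ² - (1 - ε²)s²` turns the determinant into
`2λ(κ + λ)`; both factors are positive because `|s| < κ`. -/
lemma det_ne_zero {N ε : ℝ} {k : ℕ} {s : ℝ} (h : |s| < (k : ℝ) - N) :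
    ((k - N + eigval N ε k s true : ℝ) : ℂ) * ((k - N + eigval N ε k s true : ℝ) : ℂ)
      - ((s * (1 - ε) : ℝ) : ℂ) * ((s * (1 + ε) : ℝ) : ℂ) ≠ 0 := by
  have hr := radicand_pos ε h
  have hsq := eigval_sq hr.le
  have hκ : 0 < (k : ℝ) - N := (abs_nonneg s).trans_lt h
  have hlam : 0 < eigval N ε k s true := by
    refine lt_of_le_of_ne (eigval_true_nonneg N ε k s) fun h0 => ?_
    rw [← h0] at hsq
    simp only [ne_eq, OfNat.ofNat_ne_zero, not_false_eq_true, zero_pow] at hsq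
    linarith
  have e : (k - N + eigval N ε k s true) * (k - N + eigval N ε k s true)
      - s * (1 - ε) * (s * (1 + ε))
      = 2 * eigval N ε k s true * (k - N + eigval N ε k s true) := by
    linear_combination -hsq
  have hne : (k - N + eigval N ε k s true) * (k - N + eigval N ε k s true)
      - s * (1 - ε) * (s * (1 + ε)) ≠ 0 := by
    rw [e]; positivity
  exact_mod_cast hne

lemma range_sup_range {N : ℝ}
    (hN : ∀ v : V, ∑ j : ZMod m, (c j : ℂ) • ρ (sr j) v = (N : ℂ) • v) (hN1 : N < 1) (k : ℕ) :
    LinearMap.range (projTmul hc ρ N (k + 1) (zPoly ^ (k + 1)))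
      ⊔ LinearMap.range (projTmul hc ρ N (k + 1) (zbarPoly ^ (k + 1)))
      = harmonics hc ρ (k + 1) := by
  apply le_antisymm
  · rw [sup_le_iff]
    constructor
    · rintro _ ⟨v, rfl⟩
      exact proj_mem_harmonics hc ρ hN hN1 (zPoly_pow_tmul_mem _ v)
    · rintro _ ⟨v, rfl⟩
      exact proj_mem_harmonics hc ρ hN hN1 (zbarPoly_pow_tmul_mem _ v)
  · intro p hp
    obtain ⟨v, w, rfl⟩ := exists_proj_top_components hc ρ hN hN1 hp
    rw [map_add]
    exact add_mem (Submodule.mem_sup_left ⟨v, rfl⟩) (Submodule.mem_sup_right ⟨w, rfl⟩)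

end Basis

end

end DihedralCherednik

/-! ### The main theorem -/

theorem theoremt {m : ℕ} [NeZero m] (c : ZMod m → ℝ) (hc : IsParameter c)
    {V : Type*} [AddCommGroup V] [Module ℂ V] (ρ : Representation ℂ (DihedralGroup m) V)
    (hρ : ρ.IsIrreducible) (hirr : IsIrreducibleStd hc ρ) (huni : IsUnitarisableStd hc ρ)
    (ε : ℝ) :
    -- `τ` is one of the representations of the list
    (∃ (τ : IrrepType m) (b : Module.Basis τ.Idx ℂ V), τ.IsStandardBasis ρ b) ∧
    -- `N = N_c(τ)` is the scalar by which `σ` acts on `V(τ)`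
    ∃ N : ℝ, (∀ v : V, ∑ j : ZMod m, (c j : ℂ) • ρ (DihedralGroup.sr j) v = (N : ℂ) • v) ∧
    ∀ (τ : IrrepType m) (b : Module.Basis τ.Idx ℂ V), τ.IsStandardBasis ρ b →
      -- positive degree; the `s a` are the elements of `σ(τ)_k`, which are real
      (∀ k : ℕ, 0 < k → ∃ s : τ.Idx → ℝ, (∀ a, (s a : ℂ) = τ.sigmaElt c k a) ∧
        (∀ a, 0 ≤ ((k : ℝ) - N) ^ 2 - (1 - ε ^ 2) * s a ^ 2) ∧
        -- the eigenvalues on the harmonics of degree `k`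
        {μ : ℂ | ∃ p ∈ harmonics hc ρ k, p ≠ 0 ∧ zOp hc ρ ε p = μ • p}
          = {μ : ℂ | ∃ a sgn, μ = (eigval N ε k (s a) sgn : ℂ)} ∧
        -- `Proj_k` is well defined and is the projection of `M_c(τ)_k` onto the harmonics
        -- along the image of `E_+`
        (∀ j ≤ k / 2, (ascPochhammer ℝ j).eval (N - k + 1) ≠ 0) ∧
        (∀ p ∈ degreePart V k, proj hc ρ N k p ∈ harmonics hc ρ k) ∧
        (∀ p ∈ harmonics hc ρ k, proj hc ρ N k p = p) ∧
        (∀ l, l + 2 = k → ∀ q ∈ degreePart V l,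
          proj hc ρ N k (stdModule hc ρ (Eplus c) q) = 0) ∧
        -- the eigenvectors, which form a basis of the harmonics of degree `k`
        (∀ a sgn, zOp hc ρ ε (eigvec hc ρ N ε k (s a) (b a) (b (τ.conj a)) sgn)
          = (eigval N ε k (s a) sgn : ℂ) •
            eigvec hc ρ N ε k (s a) (b a) (b (τ.conj a)) sgn) ∧
        LinearIndependent ℂ (fun i : τ.Idx × Bool =>
          eigvec hc ρ N ε k (s i.1) (b i.1) (b (τ.conj i.1)) i.2) ∧
        Submodule.span ℂ (Set.range fun i : τ.Idx × Bool =>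
          eigvec hc ρ N ε k (s i.1) (b i.1) (b (τ.conj i.1)) i.2) = harmonics hc ρ k) ∧
      -- degree zero
      (∀ p, p ∈ harmonics hc ρ 0 ↔ ∃ v : V, p = 1 ⊗ₜ[ℂ] v) ∧
      (Module.finrank ℂ V = 1 → ∀ (a : τ.Idx) (v : V),
        zOp hc ρ ε (1 ⊗ₜ[ℂ] v) = ((ε : ℂ) * τ.sigmaElt c 0 a) • ((1 : Poly) ⊗ₜ[ℂ] v)) ∧
      (Module.finrank ℂ V = 2 → ∀ v : V, zOp hc ρ ε ((1 : Poly) ⊗ₜ[ℂ] v) = 0) ∧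
      -- all eigenvectors are generated from harmonic ones through the action of `E_+`
      ∀ μ : ℂ, Module.End.eigenspace (zOp hc ρ ε) μ =
        ⨆ (k : ℕ) (j : ℕ), Submodule.map (stdModule hc ρ (Eplus c ^ j))
          (harmonics hc ρ k ⊓ Module.End.eigenspace (zOp hc ρ ε) μ) := by
  obtain ⟨τ₀, b₀, hb₀⟩ := exists_standardBasis hρ
  obtain ⟨N, hN⟩ := exists_real_scalar hc hb₀
  refine ⟨⟨τ₀, b₀, hb₀⟩, N, hN, fun τ b hb => ?_⟩
  -- Used twice: in degree 1 without any bound on `N`, which yields `N < 1`, and then in every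
  -- positive degree.
  have habs : ∀ (k : ℕ) (a : τ.Idx), (k = 0 ∨ N < 1) →
      |(τ.sigmaElt c (k + 1) a).re| < ((k + 1 : ℕ) : ℝ) - N := fun k a hk =>
    huni.abs_sigma_lt hN hk (b.ne_zero (τ.conj a))
      (by rw [sigma_zPoly_pow_tmul hc hb, τ.sigmaElt_real hc])
      (by rw [sigma_zbarPoly_pow_tmul hc hb, τ.sigmaElt_real hc])
  have hN1 : N < 1 := by
    obtain ⟨a⟩ : Nonempty τ.Idx := inferInstance
    have h := (abs_nonneg _).trans_lt (habs 0 a (Or.inl rfl))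
    push_cast at h
    linarith
  refine ⟨fun k hk => ?_, fun p => mem_harmonics_zero hc, fun _ a v => ?_, fun h v => ?_,
    eigenspace_eq_iSup hc ρ hN hN1 ε⟩
  · obtain ⟨k, rfl⟩ := Nat.exists_eq_add_of_le' hk
    have hs : ∀ a, |(τ.sigmaElt c (k + 1) a).re| < ((k + 1 : ℕ) : ℝ) - N :=
      fun a => habs k a (Or.inr hN1)
    have hrad := fun a => (radicand_pos ε (hs a)).le
    have hT : ∀ a sgn, zOp hc ρ ε
        (eigvec hc ρ N ε (k + 1) (τ.sigmaElt c (k + 1) a).re (b a) (b (τ.conj a)) sgn)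
        = (eigval N ε (k + 1) (τ.sigmaElt c (k + 1) a).re sgn : ℂ) •
          eigvec hc ρ N ε (k + 1) (τ.sigmaElt c (k + 1) a).re (b a) (b (τ.conj a)) sgn :=
      fun a sgn => zOp_eigvec hc ρ hN hN1 ε
        (by rw [sigma_zPoly_pow_tmul hc hb, τ.sigmaElt_real hc])
        (by rw [sigma_zbarPoly_pow_tmul hc hb, τ.sigmaElt_real hc]) (hrad a) sgn
    have hli := linearIndependent_pairFamily (f := projTmul hc ρ N (k + 1) (zPoly ^ (k + 1)))
      (g := projTmul hc ρ N (k + 1) (zbarPoly ^ (k + 1))) b τ.conj_conj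
      (fun a => det_ne_zero (ε := ε) (hs a)) (fun v w h =>
        proj_top_components_eq_zero hc ρ (N := N) (by rw [map_add]; exact h))
    have hspan := span_pairFamily (f := projTmul hc ρ N (k + 1) (zPoly ^ (k + 1)))
      (g := projTmul hc ρ N (k + 1) (zbarPoly ^ (k + 1))) b τ.conj_conj
      (fun a => det_ne_zero (ε := ε) (hs a))
    rw [range_sup_range hc ρ hN hN1] at hspan
    rw [← eigvec_eq_pairFamily] at hli hspan
    refine ⟨fun a => (τ.sigmaElt c (k + 1) a).re, fun a => τ.sigmaElt_real hc _ a, hrad, ?_,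
      fun j hj => ascPochhammer_eval_ne_zero hN1 hj,
      fun p hp => proj_mem_harmonics hc ρ hN hN1 hp,
      fun p hp => proj_of_mem_harmonics hc ρ hp, fun l hl q hq => ?_, hT, hli, hspan⟩
    · rw [setOf_eigenvalue_eq (zOp hc ρ ε) _ _
        (fun i : τ.Idx × Bool => (eigval N ε (k + 1) (τ.sigmaElt c (k + 1) i.1).re i.2 : ℂ))
        hli hspan (fun i => hT i.1 i.2)]
      ext μ
      simp only [Set.mem_ofPred_eq, Prod.exists]
    · rw [← hl]
      exact proj_Eplus hc ρ hN hN1 hq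
  · rw [zOp_one_tmul hc hN, sigmaElt_zero_eq hc hb hN]
  -- Dimension 2 excludes the characters, whose index set is a singleton; for `ρ^(u)` the scalar `N`
  -- is zero.
  · rcases τ.conj_eq_or with hτ | ⟨u, h₁, h₂, rfl⟩
    · have : Subsingleton τ.Idx := ⟨hτ⟩
      have h1 := Module.finrank_eq_card_basis b
      have h2 := Fintype.card_le_one_iff_subsingleton.mpr this
      omega
    · rw [zOp_one_tmul hc hN,
        ← sigmaElt_zero_eq hc hb hN (Classical.arbitrary _), sigmaElt_zero_rho hc, mul_zero,
        zero_smul]
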